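/- Let $X=[0,1]^p$ with $p\ge 1$. In a continuum-armed bandit problem each arm $x\in X$ has an unknown reward distribution $P(x)$ on $[0,1]$ (depending measurably on $x$), with mean $\mu(x)$; put $\mu^*=\sup_X\mu$. In round $t=1,2,\dots$ an arm $x_t\in X$ is chosen as a measurable function of $Y_1,\dots,Y_{t-1},Z_1,\dots,Z_t$, where the randomisation variable $Z_t$ is independent of $Y_1,\dots,Y_{t-1},Z_1,\dots,Z_{t-1}$, and a reward $Y_t$ is observed which, given these variables and $Z_t$, has distribution $P(x_t)$. After $T$ rounds an estimate $\hat x_T\in X$ is returned, a measurable function of $Y_1,\dots,Y_T,Z_1,\dots,Z_T$ and an independent randomisation variable $\hat Z_T$. A strategy consists of these functions and of the laws of the variables $Z_t$, $\hat Z_T$. The regrets are $$R_T=\sum_{t=1}^T(\mu^*-\mu(x_t)),\qquad S_T=\mu^*-\mu(\hat x_T).$$ For $U\subseteq X$ let $\operatorname{diam}(U)$ be its Euclidean diameter, $\operatorname{diam}_i(U)=\sup\{|x_i-y_i|:x,y\in U\}$ and $\|x\|_U^2=\sum_{i=1}^p(|x_i|/\operatorname{diam}_i(U))^2$. A function $f:X\to\mathbb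 R$ is *zooming continuous* if it is continuous with finitely many global maxima and $$\sup_{x^*,\,U:\ \operatorname{diam}(U)\le\eta}\ \frac{\sup_{x,y\in U:\ \|x-y\|_U\le\eta}|f(x)-f(y)|}{\sup_{z\in U}|f(x^*)-f(z)|}\ \longrightarrow\ 0\qquad(\eta\to0^+),$$ where $x^*$ runs over the global maxima of $f$ and $U$ over the neighbourhoods of $x^*$ in $X$. Computation time is the number of steps of a program on a real random-access machine with unit-cost operations: addition, subtraction and halving of natural numbers; arithmetic, square root, logarithm and exact comparison of reals; indirect addressing; drawing independent uniform variables on $[0,1]$. The only constants in programs are natural numbers. **Theorem.** Let $p\ge1$ and $\varepsilon\in(0,1)$. There are a strategy for continuum-armed bandits on $[0,1]^p$, depending only on $p$ and $\varepsilon$ (not on $\mu$, $P$ or a time horizon), a program which implements it (for all possible rewards and random draws the program halts with the arm of the strategy in every round, and with its estimate after any number of rounds), and an exponent $k\in\mathbb N$, such that the following holds. For every zooming continuous $\mu$ there is a constant $C$ such that, for all reward distributions $P$ with reward function $\mu$, there is an event of probability at least $1-\varepsilon$ on which, for all $T\ge2$, $$R_T\le C\sqrt T\,(\log T)^k,\qquad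 S_T\le C\,\frac{1}{\sqrt T}\,(\log T)^k,$$ and the total computation time of the program for the first $T$ rounds and the estimate $\hat x_T$ is at most $C\,T(\log T)^k$. That is, $R_T=\tilde O(\sqrt T)$, $S_T=\tilde O(1/\sqrt T)$, and the computation time is $\tilde O(T)$. -/

import Mathlib

open MeasureTheory ProbabilityTheory Filter Topology
open scoped unitInterval ENNReal

noncomputable section

/-! ### Zooming continuous functions on the cube -/

/-- The arm space `[0,1]^p`, with its product topology and Borel sigma-algebra. -/
abbrev Cube (p : ℕ) : Type := Fin p → I

namespace Cube

variable {p : ℕ}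

/-- The Euclidean distance on `[0,1]^p`. -/
def euclDist (x y : Cube p) : ℝ := √(∑ i, ((x i : ℝ) - (y i : ℝ)) ^ 2)

/-- The diameter of `U` along axis `i`. -/
def axisDiam (i : Fin p) (U : Set (Cube p)) : ℝ :=
  sSup {r | ∃ x ∈ U, ∃ y ∈ U, r = |(x i : ℝ) - (y i : ℝ)|}

/-- The overall (Euclidean) diameter of `U`. -/
def euclDiam (U : Set (Cube p)) : ℝ :=
  sSup {r | ∃ x ∈ U, ∃ y ∈ U, r = euclDist x y}

/-- The size `‖x - y‖_U` of `x - y` relative to `U`. -/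
def relSize (U : Set (Cube p)) (x y : Cube p) : ℝ :=
  √(∑ i, (|(x i : ℝ) - (y i : ℝ)| / axisDiam i U) ^ 2)

/-- `x` is a global maximum of `f`. -/
def IsGlobalMax (f : Cube p → ℝ) (x : Cube p) : Prop := ∀ y, f y ≤ f x

/-- The largest variation of `f` over pairs of points of `U` of relative distance at most `ε`,
divided by the largest deviation of `f` from `f x` over `U`. -/
def zoomRatio (f : Cube p → ℝ) (x : Cube p) (U : Set (Cube p)) (ε : ℝ) : ℝ :=
  sSup {r | ∃ y ∈ U, ∃ z ∈ U, relSize U y z ≤ ε ∧ r = |f y - f z|} /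
    sSup {r | ∃ z ∈ U, r = |f x - f z|}

/-- Zooming continuity. The outer supremum runs over all global maxima `x` and all
neighbourhoods `U` of `x` in the cube (not necessarily open) of diameter at most `ε`;
it is taken in `[0, ∞]`, since nothing bounds it a priori. -/
structure ZoomingContinuous (f : Cube p → ℝ) : Prop where
  continuous : Continuous f
  finite_maxima : {x | IsGlobalMax f x}.Finite
  zoom : Tendsto
    (fun ε : ℝ => ⨆ (x : Cube p) (_ : IsGlobalMax f x) (U : Set (Cube p)) (_ : U ∈ 𝓝 x)
      (_ : euclDiam U ≤ ε), ENNReal.ofReal (zoomRatio f x U ε))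
    (𝓝[>] 0) (𝓝 0)

end Cube

/-! ### Bandit problems, strategies and regrets

Rewards lie in `[0,1] = I`. Rounds are numbered `0, 1, 2, …`; the first `T` rounds are
rounds `0, …, T - 1`. -/

/-- A strategy with arm space `X` and randomisation space `𝒵`. In round `t` the arm is a
measurable function of the `t` earlier rewards and of the randomisation variables of
rounds `0, …, t`. After `T` rounds the estimated maximum is a measurable function of the `T`
rewards, the `T` randomisation variables, and one more randomisation variable. The strategy
includes the laws of all its randomisation variables. -/
structure BanditStrategy (X 𝒵 : Type*) [MeasurableSpace X] [MeasurableSpace 𝒵] where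
  law : ℕ → Measure 𝒵
  isProb_law : ∀ t, IsProbabilityMeasure (law t)
  hatLaw : ℕ → Measure 𝒵
  isProb_hatLaw : ∀ T, IsProbabilityMeasure (hatLaw T)
  arm : (t : ℕ) → (Fin t → I) × (Fin (t + 1) → 𝒵) → X
  measurable_arm : ∀ t, Measurable (arm t)
  estimate : (T : ℕ) → ((Fin T → I) × (Fin T → 𝒵)) × 𝒵 → X
  measurable_estimate : ∀ T, Measurable (estimate T)

namespace BanditStrategy

variable {X 𝒵 Ω : Type*} [MeasurableSpace X] [MeasurableSpace 𝒵] [MeasurableSpace Ω]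

/-- The arm `x_t` played in round `t`. -/
def armAt (S : BanditStrategy X 𝒵) (Y : ℕ → Ω → I) (Z : ℕ → Ω → 𝒵) (t : ℕ) (ω : Ω) : X :=
  S.arm t (fun i => Y i ω, fun i => Z i ω)

/-- The estimated maximum returned after `T` rounds. -/
def estimateAt (S : BanditStrategy X 𝒵) (Y : ℕ → Ω → I) (Z Zhat : ℕ → Ω → 𝒵) (T : ℕ)
    (ω : Ω) : X :=
  S.estimate T ((fun i => Y i ω, fun i => Z i ω), Zhat T ω)

/-- The random variables `Y`, `Z`, `Zhat` are the rewards and randomisation variables of a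
run of the strategy `S` on the bandit whose arm `x` has reward distribution `P x`. -/
structure IsRun (S : BanditStrategy X 𝒵) (P : Kernel X I) (Pr : Measure Ω)
    (Y : ℕ → Ω → I) (Z Zhat : ℕ → Ω → 𝒵) : Prop where
  measurable_reward : ∀ t, Measurable (Y t)
  measurable_rand : ∀ t, Measurable (Z t)
  measurable_hat : ∀ T, Measurable (Zhat T)
  law_rand : ∀ t, HasLaw (Z t) (S.law t) Pr
  indep_rand : ∀ t, IndepFun (Z t)
    (fun ω => ((fun i => Y i ω, fun i => Z i ω) : (Fin t → I) × (Fin t → 𝒵))) Pr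
  /-- Given the past and `Z t`, the reward has distribution `P` of the arm played. -/
  condDistrib_reward : ∀ t, HasCondDistrib (Y t)
    (fun ω => ((fun i => Y i ω, fun i => Z i ω) : (Fin t → I) × (Fin (t + 1) → 𝒵)))
    (P.comap (S.arm t) (S.measurable_arm t)) Pr
  law_hat : ∀ T, HasLaw (Zhat T) (S.hatLaw T) Pr
  indep_hat : ∀ T, IndepFun (Zhat T)
    (fun ω => ((fun i => Y i ω, fun i => Z i ω) : (Fin T → I) × (Fin T → 𝒵))) Pr

end BanditStrategy

/-- The reward function: the mean of the reward distribution of each arm. -/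
def rewardFunction {X : Type*} [MeasurableSpace X] (P : Kernel X I) (x : X) : ℝ :=
  ∫ y, (y : ℝ) ∂(P x)

/-- The cumulative regret over the first `T` rounds of playing the arms `x 0, x 1, …`. -/
def cumulativeRegret {X : Type*} (μ : X → ℝ) (x : ℕ → X) (T : ℕ) : ℝ :=
  ∑ t ∈ Finset.range T, ((⨆ y, μ y) - μ (x t))

/-- The simple regret of the estimated maximum `x`. -/
def simpleRegret {X : Type*} (μ : X → ℝ) (x : X) : ℝ := (⨆ y, μ y) - μ x

/-! ### The machine model

A real random-access machine with unit costs. It has one infinite memory of natural numbers and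
one of real numbers, both with indirect addressing. Natural numbers can be added, subtracted and
halved; real numbers can be added, subtracted, multiplied and divided, with square roots and
logarithms, and compared exactly. There is no rounding of reals to integers, and the only
constants of a program are natural numbers. A program can draw independent uniform random
variables on `[0,1]`. -/

namespace RealRAM

/-- The memory, with the number of random draws made so far in the current round. -/
structure Mem where
  nat : ℕ → ℕ
  real : ℕ → ℝ
  drawn : ℕ

/-- Elementary instructions. `d` is the address of the result, `a` and `b` those of the
operands. -/
inductive Instr : Type
  | natConst (d n : ℕ)
  | natAdd (d a b : ℕ)
  | natSub (d a b : ℕ)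
  | natHalf (d a : ℕ)
  | natLoad (d a : ℕ)
  | natStore (a b : ℕ)
  | realOfNat (d a : ℕ)
  | realAdd (d a b : ℕ)
  | realSub (d a b : ℕ)
  | realMul (d a b : ℕ)
  | realDiv (d a b : ℕ)
  | realSqrt (d a : ℕ)
  | realLog (d a : ℕ)
  | realLoad (d a : ℕ)
  | realStore (a b : ℕ)
  | draw (d : ℕ)

namespace Mem

def setNat (m : Mem) (d n : ℕ) : Mem := { m with nat := Function.update m.nat d n }

def setReal (m : Mem) (d : ℕ) (r : ℝ) : Mem := { m with real := Function.update m.real d r }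

/-- The memory before the first round. -/
def init : Mem := ⟨fun _ => 0, fun _ => 0, 0⟩

/-- Start reading a new tape of random draws. -/
def rewind (m : Mem) : Mem := { m with drawn := 0 }

end Mem

/-- The effect of an instruction, where `z` is the tape of random draws of the round. -/
def Instr.apply (z : ℕ → I) (m : Mem) : Instr → Mem
  | natConst d n => m.setNat d n
  | natAdd d a b => m.setNat d (m.nat a + m.nat b)
  | natSub d a b => m.setNat d (m.nat a - m.nat b)
  | natHalf d a => m.setNat d (m.nat a / 2)
  | natLoad d a => m.setNat d (m.nat (m.nat a))
  | natStore a b => m.setNat (m.nat a) (m.nat b)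
  | realOfNat d a => m.setReal d (m.nat a : ℝ)
  | realAdd d a b => m.setReal d (m.real a + m.real b)
  | realSub d a b => m.setReal d (m.real a - m.real b)
  | realMul d a b => m.setReal d (m.real a * m.real b)
  | realDiv d a b => m.setReal d (m.real a / m.real b)
  | realSqrt d a => m.setReal d (√(m.real a))
  | realLog d a => m.setReal d (Real.log (m.real a))
  | realLoad d a => m.setReal d (m.real (m.nat a))
  | realStore a b => m.setReal (m.nat a) (m.real b)
  | draw d => { m.setReal d (z m.drawn : ℝ) with drawn := m.drawn + 1 }

/-- Tests. -/
inductive Test : Type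
  | natEq (a b : ℕ)
  | natLt (a b : ℕ)
  | realLt (a b : ℕ)
  | realLe (a b : ℕ)

def Test.holds (m : Mem) : Test → Prop
  | natEq a b => m.nat a = m.nat b
  | natLt a b => m.nat a < m.nat b
  | realLt a b => m.real a < m.real b
  | realLe a b => m.real a ≤ m.real b

/-- Programs. -/
inductive Prog : Type
  | skip
  | instr (i : Instr)
  | seq (c₁ c₂ : Prog)
  | ifte (b : Test) (c₁ c₂ : Prog)
  | loop (b : Test) (c : Prog)

/-- `Exec z c m m' n`: with random draws `z`, the program `c` started in memory `m` halts in
memory `m'` after `n` steps. Each instruction and each evaluation of a test is one step. -/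
inductive Exec (z : ℕ → I) : Prog → Mem → Mem → ℕ → Prop
  | skip (m : Mem) : Exec z .skip m m 1
  | instr (i : Instr) (m : Mem) : Exec z (.instr i) m (i.apply z m) 1
  | seq {c₁ c₂ : Prog} {m m₁ m₂ : Mem} {n₁ n₂ : ℕ} :
      Exec z c₁ m m₁ n₁ → Exec z c₂ m₁ m₂ n₂ → Exec z (.seq c₁ c₂) m m₂ (n₁ + n₂)
  | ifteTrue {b : Test} {c₁ c₂ : Prog} {m m' : Mem} {n : ℕ} :
      b.holds m → Exec z c₁ m m' n → Exec z (.ifte b c₁ c₂) m m' (n + 1)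
  | ifteFalse {b : Test} {c₁ c₂ : Prog} {m m' : Mem} {n : ℕ} :
      ¬ b.holds m → Exec z c₂ m m' n → Exec z (.ifte b c₁ c₂) m m' (n + 1)
  | loopDone {b : Test} {c : Prog} {m : Mem} :
      ¬ b.holds m → Exec z (.loop b c) m m 1
  | loopStep {b : Test} {c : Prog} {m m₁ m₂ : Mem} {n₁ n₂ : ℕ} :
      b.holds m → Exec z c m m₁ n₁ → Exec z (.loop b c) m₁ m₂ n₂ →
        Exec z (.loop b c) m m₂ (n₁ + n₂ + 1)

/-- An implementation of a bandit strategy on the machine: a program run in every round to choose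
the arm, and a program which, run on the memory after some number of rounds, returns the
estimated maximum. -/
structure Learner where
  play : Prog
  recommend : Prog

/-- The law of a tape of independent uniform draws. -/
def uniformTape : Measure (ℕ → I) := Measure.infinitePi fun _ => (volume : Measure I)

/-- `A.Reaches p y z t m n`: on rewards `y` and random draws `z` (`z s` in round `s`), after `t`
rounds the memory is `m` and `n` steps have been made. In each round the program `A.play` runs on
the memory left by the round before; it leaves the arm in the real registers `0, …, p - 1`, and the
reward then appears in real register `p`. -/
inductive Learner.Reaches (A : Learner) (p : ℕ) (y : ℕ → I) (z : ℕ → ℕ → I) :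
    ℕ → Mem → ℕ → Prop
  | start : Learner.Reaches A p y z 0 Mem.init 0
  | round {t : ℕ} {m m' : Mem} {n k : ℕ} :
      Learner.Reaches A p y z t m n → Exec (z t) A.play m.rewind m' k →
        Learner.Reaches A p y z (t + 1) (m'.setReal p (y t : ℝ)) (n + k)

/-- The learner `A` implements the strategy `S`: the randomisation variables of `S` are tapes of
independent uniform draws and, whatever the rewards and the draws, `A` halts in every round with
the arm chosen by `S`, and returns the estimated maximum of `S` after any number of rounds. -/
structure Learner.Implements {p : ℕ} (A : Learner) (S : BanditStrategy (Cube p) (ℕ → I)) :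
    Prop where
  law_eq : ∀ t, S.law t = uniformTape
  hatLaw_eq : ∀ T, S.hatLaw T = uniformTape
  arm_eq : ∀ (y : ℕ → I) (z : ℕ → ℕ → I) (t : ℕ), ∃ m n m' k,
    A.Reaches p y z t m n ∧ Exec (z t) A.play m.rewind m' k ∧
      ∀ i : Fin p, m'.real i = (S.arm t (fun j => y j, fun j => z j) i : ℝ)
  estimate_eq : ∀ (y : ℕ → I) (z : ℕ → ℕ → I) (zhat : ℕ → I) (T : ℕ), ∃ m n m' k,
    A.Reaches p y z T m n ∧ Exec zhat A.recommend m.rewind m' k ∧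
      ∀ i : Fin p, m'.real i = (S.estimate T ((fun j => y j, fun j => z j), zhat) i : ℝ)

/-- `A.TotalTime p y z zhat T n`: the computation of `A` over the first `T` rounds, followed by
that of the estimated maximum, takes `n` steps. -/
def Learner.TotalTime (A : Learner) (p : ℕ) (y : ℕ → I) (z : ℕ → ℕ → I) (zhat : ℕ → I)
    (T n : ℕ) : Prop :=
  ∃ m m' n₁ n₂, A.Reaches p y z T m n₁ ∧ Exec zhat A.recommend m.rewind m' n₂ ∧ n = n₁ + n₂

end RealRAM

end

/-!
The bounds are attained by a deterministic algorithm without loops and random draws, so that each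
round takes boundedly many steps.

The algorithm works in runs `j = 1, 2, …`. A run has phases `m = 0, …, j`, with resolution
`r = 2 ^ (-m)`. Each phase has `j ^ p` boxes, which form the grid of mesh `1 / j` in the first
phase. Each box is divided into `j ^ p` cells, and the lower corner of each cell is sampled
`4 ^ m * j * (j + 1) / 2` times. A cell survives if its mean reward is at most `r` below `v`, where
`v` is the largest lower confidence bound so far, and the hull of the surviving cells of a box is a
box of the next phase. The boxes, the cells and the samples are counted by odometers to base `j`, so
the schedule does not depend on the rewards. The arms of the last phase are recommended.

Zooming continuity is used in the form `Cube.ZoomingContinuous.exists_osc_le`: on every small set,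
the regret varies by a small fraction of its maximum between points which are close relative to the
extents of the set. Hence, for large `j` (`Cube.BoxRegularity`), a box with regret at most `K * r`
can be explored through the corners of its cells, and if each face of the hull of the surviving
cells contains a point with regret `O(r)`, the regret on the whole hull is at most `K * (r / 2)`.
By induction over cells, boxes and phases (`RealRAM.Adaptive.BoxGood`), all boxes of late runs have
regret at most `K * r`, and a maximum is never lost.

The means are accurate up to `r / 4` because the deviations over all blocks of rounds are bounded at
once, with high probability (`BanditStrategy.exists_deviation_bound`), and the additional factor
`j * (j + 1) / 2` in the number of samples beats the logarithm of the time. As phase `m` of run `j`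
takes `4 ^ m` rounds up to powers of `j`, each of regret `O(2 ^ (-m))`, and there are `O(log T)`
runs in `T` rounds, the regrets are as claimed. Early runs, in which `j` is not yet large, only
contribute to the constant.
-/

/-! ### Oscillation of zooming continuous functions -/

namespace Cube

variable {p : ℕ} {f : Cube p → ℝ}

lemma bddAbove_range_of_continuous (hf : Continuous f) : BddAbove (Set.range f) :=
  (isCompact_range hf).bddAbove

lemma simpleRegret_nonneg (hf : Continuous f) (x : Cube p) : 0 ≤ simpleRegret f x :=
  sub_nonneg.2 (le_ciSup (bddAbove_range_of_continuous hf) x)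

lemma exists_isGlobalMax (hf : Continuous f) : ∃ x, IsGlobalMax f x := by
  obtain ⟨x, -, hx⟩ := isCompact_univ.exists_isMaxOn (Set.univ_nonempty (α := Cube p))
    hf.continuousOn
  exact ⟨x, fun y => hx (Set.mem_univ y)⟩

lemma IsGlobalMax.iSup_eq {x : Cube p} (hx : IsGlobalMax f x) : ⨆ y, f y = f x :=
  le_antisymm (ciSup_le hx) (le_ciSup ⟨f x, by rintro _ ⟨y, rfl⟩; exact hx y⟩ x)

lemma IsGlobalMax.simpleRegret_eq_zero {x : Cube p} (hx : IsGlobalMax f x) :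
    simpleRegret f x = 0 := by
  simp [simpleRegret, hx.iSup_eq]

/-- A bound on the zooming ratio bounds the oscillation. If the denominator vanishes, the ratio
is the junk value `0`, but then `f` is constant on `U`. -/
lemma abs_sub_le_of_zoomRatio_le {x y z : Cube p} {U : Set (Cube p)} {ε δ M : ℝ}
    (hx : IsGlobalMax f x) (hM : ∀ z ∈ U, f x - f z ≤ M) (hδ : 0 ≤ δ)
    (hr : zoomRatio f x U ε ≤ δ) (hy : y ∈ U) (hz : z ∈ U) (hyz : relSize U y z ≤ ε) :
    |f y - f z| ≤ δ * M := by
  have hM0 : 0 ≤ M := (sub_nonneg.2 (hx y)).trans (hM y hy)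
  set A : Set ℝ := {r | ∃ y ∈ U, ∃ z ∈ U, relSize U y z ≤ ε ∧ r = |f y - f z|} with hA
  set B : Set ℝ := {r | ∃ z ∈ U, r = |f x - f z|} with hB
  have hAb : BddAbove A := by
    refine ⟨M, ?_⟩
    rintro _ ⟨y, hy, z, hz, -, rfl⟩
    have h1 := hM y hy
    have h2 := hM z hz
    have h3 := hx y
    have h4 := hx z
    rw [abs_le]; constructor <;> linarith
  have hBb : ∀ r ∈ B, r ≤ M := by
    rintro _ ⟨z, hz, rfl⟩
    rw [abs_of_nonneg (sub_nonneg.2 (hx z))]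
    exact hM z hz
  have hnum : |f y - f z| ≤ sSup A := le_csSup hAb ⟨y, hy, z, hz, hyz, rfl⟩
  have hden : sSup B ≤ M := Real.sSup_le hBb hM0
  have hle : ∀ w ∈ U, |f x - f w| ≤ sSup B := fun w hw => le_csSup ⟨M, hBb⟩ ⟨w, hw, rfl⟩
  have hden0 : 0 ≤ sSup B := (abs_nonneg _).trans (hle y hy)
  rcases hden0.eq_or_lt with h0 | h0
  · have h1 := hle y hy
    have h2 := hle z hz
    rw [← h0] at h1 h2
    have h3 : f x - f y = 0 := abs_nonpos_iff.1 h1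
    have h4 : f x - f z = 0 := abs_nonpos_iff.1 h2
    have : f y - f z = 0 := by linarith
    rw [this, abs_zero]; positivity
  · have hr' : sSup A / sSup B ≤ δ := hr
    rw [div_le_iff₀ h0] at hr'
    exact (hnum.trans hr').trans (by gcongr)

lemma ZoomingContinuous.exists_zoomRatio_le (hf : ZoomingContinuous f) {δ : ℝ} (hδ : 0 < δ) :
    ∃ ε > 0, ∀ x, IsGlobalMax f x → ∀ U ∈ 𝓝 x, euclDiam U ≤ ε → zoomRatio f x U ε ≤ δ := by
  have h := (hf.zoom.eventually (gt_mem_nhds (ENNReal.ofReal_pos.2 hδ))).and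
    self_mem_nhdsWithin
  obtain ⟨ε, h1, h2⟩ := h.exists
  refine ⟨ε, h2, fun x hx U hU hd => ?_⟩
  have h3 : ENNReal.ofReal (zoomRatio f x U ε) < ENNReal.ofReal δ := by
    refine lt_of_le_of_lt ?_ h1
    exact le_iSup_of_le x <| le_iSup_of_le hx <| le_iSup_of_le U <| le_iSup_of_le hU <|
      le_iSup_of_le hd le_rfl
  exact ((ENNReal.ofReal_lt_ofReal_iff hδ).1 h3).le

lemma sqrt_sum_sq_le {g : Fin p → ℝ} {c ε : ℝ} (hε : 0 ≤ ε) (h0 : ∀ i, 0 ≤ g i)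
    (hg : ∀ i, g i ≤ c) (hc : c * (p + 1) ≤ ε) : √(∑ i, g i ^ 2) ≤ ε := by
  rw [Real.sqrt_le_left hε]
  rcases Nat.eq_zero_or_pos p with rfl | hp
  · simp; positivity
  have hc0 : 0 ≤ c := (h0 ⟨0, hp⟩).trans (hg _)
  calc ∑ i, g i ^ 2 ≤ ∑ _i : Fin p, c ^ 2 :=
        Finset.sum_le_sum fun i _ => pow_le_pow_left₀ (h0 i) (hg i) 2
    _ = p * c ^ 2 := by simp
    _ ≤ (c * (p + 1)) ^ 2 := by
        have : (0 : ℝ) ≤ p := p.cast_nonneg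
        nlinarith [mul_nonneg (sq_nonneg c) this, mul_nonneg (sq_nonneg c) (sq_nonneg (p : ℝ)),
          sq_nonneg c]
    _ ≤ ε ^ 2 := by gcongr

/-- The scale-free modulus of continuity which drives the algorithm: on any small set, whether or
not it contains a maximum, `f` varies by a small fraction of its largest regret between points
which are close relative to the extents of the set.

Near a maximum `x`, this is zooming continuity for the set enlarged by a tiny ball around `x`.
Away from the maxima, the regret is bounded below, and `f` is uniformly continuous. -/
lemma ZoomingContinuous.exists_osc_le (hf : ZoomingContinuous f) {δ : ℝ} (hδ : 0 < δ) :
    ∃ η > 0, ∀ (U : Set (Cube p)) (M : ℝ), (∀ x ∈ U, simpleRegret f x ≤ M) →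
      (∀ x ∈ U, ∀ y ∈ U, ∀ i, |(x i : ℝ) - y i| ≤ η) → ∀ y ∈ U, ∀ z ∈ U,
      (∀ i, ∃ a ∈ U, ∃ b ∈ U, |(y i : ℝ) - z i| ≤ η * |(a i : ℝ) - b i|) →
      |f y - f z| ≤ δ * M := by
  obtain ⟨ε, hε, hzoom⟩ := hf.exists_zoomRatio_le hδ
  set ρ : ℝ := ε / (4 * (p + 1)) with hρ
  have hρ0 : 0 < ρ := by positivity
  have hρε : 4 * (ρ * (p + 1)) = ε := by rw [hρ]; field_simp
  -- a positive lower bound for the regret away from the maxima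
  obtain ⟨c, hc0, hc⟩ : ∃ c > 0, ∀ x, (∀ y, IsGlobalMax f y → ρ ≤ dist x y) →
      c ≤ simpleRegret f x := by
    set N : Set (Cube p) := {x | ∀ y, IsGlobalMax f y → ρ ≤ dist x y} with hN
    have hNc : IsCompact N := by
      refine IsClosed.isCompact ?_
      have : N = ⋂ (y) (_ : IsGlobalMax f y), {x | ρ ≤ dist x y} := by ext; simp [hN]
      rw [this]
      exact isClosed_iInter fun y => isClosed_iInter fun _ =>
        isClosed_le continuous_const (by fun_prop)
    rcases N.eq_empty_or_nonempty with h | h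
    · exact ⟨1, one_pos, fun x hx => absurd (show x ∈ N from hx) (by simp [h])⟩
    · obtain ⟨x, hx, hmax⟩ := hNc.exists_isMaxOn h hf.continuous.continuousOn
      refine ⟨simpleRegret f x, ?_, fun z hz => ?_⟩
      · refine (simpleRegret_nonneg hf.continuous x).lt_of_ne' fun h0 => ?_
        have hxm : IsGlobalMax f x := fun y => by
          have := simpleRegret_nonneg hf.continuous y
          simp only [simpleRegret] at h0 this
          linarith
        have := hx x hxm
        simp at this
        linarith
      · have : f z ≤ f x := hmax (show z ∈ N from hz)
        simp only [simpleRegret]; linarith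
  obtain ⟨κ, hκ0, hκ⟩ := Metric.uniformContinuous_iff.1
    (CompactSpace.uniformContinuous_of_continuous hf.continuous) (δ * c) (by positivity)
  refine ⟨min ρ (κ / 2), by positivity, fun U M hM hd y hy z hz hyz => ?_⟩
  have hM0 : 0 ≤ M := (simpleRegret_nonneg hf.continuous y).trans (hM y hy)
  by_cases hnear : ∃ x, IsGlobalMax f x ∧ ∃ w ∈ U, dist w x < ρ
  · obtain ⟨x, hx, w, hw, hwx⟩ := hnear
    have hreg : ∀ u, f x - f u = simpleRegret f u := fun u => by simp [simpleRegret, hx.iSup_eq]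
    rcases hM0.eq_or_lt with h0 | h0
    · have h1 := hM y hy
      have h2 := hM z hz
      have h3 := simpleRegret_nonneg hf.continuous y
      have h4 := simpleRegret_nonneg hf.continuous z
      rw [← hreg] at h1 h2 h3 h4
      rw [← h0, mul_zero, abs_nonpos_iff]
      linarith
    obtain ⟨τ, hτ0, hτ⟩ := Metric.continuousAt_iff.1 (hf.continuous.continuousAt (x := x)) M h0
    set V := U ∪ Metric.ball x (min τ ρ) with hV
    have hVn : V ∈ 𝓝 x := Filter.mem_of_superset
      (Metric.ball_mem_nhds x (by positivity)) Set.subset_union_right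
    have hVM : ∀ u ∈ V, f x - f u ≤ M := by
      rintro u (hu | hu)
      · rw [hreg]; exact hM u hu
      · have := hτ (lt_of_lt_of_le (Metric.mem_ball.1 hu) (min_le_left _ _))
        rw [Real.dist_eq, abs_lt] at this
        linarith
    have hVx : ∀ u ∈ V, ∀ i, |(u i : ℝ) - x i| ≤ 2 * ρ := by
      rintro u (hu | hu) i
      · have h1 := (hd u hu w hw i).trans (min_le_left _ _)
        have h2 : |(w i : ℝ) - x i| ≤ ρ := ((dist_le_pi_dist w x i).trans hwx.le :)
        calc |(u i : ℝ) - x i| ≤ |(u i : ℝ) - w i| + |(w i : ℝ) - x i| := abs_sub_le _ _ _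
          _ ≤ 2 * ρ := by linarith
      · have h2 : |(u i : ℝ) - x i| ≤ min τ ρ :=
          ((dist_le_pi_dist u x i).trans (Metric.mem_ball.1 hu).le :)
        linarith [min_le_right τ ρ]
    have hVV : ∀ u ∈ V, ∀ v ∈ V, ∀ i, |(u i : ℝ) - v i| ≤ 4 * ρ := fun u hu v hv i => by
      have h1 := hVx u hu i
      have h2 := hVx v hv i
      rw [abs_sub_comm] at h2
      calc |(u i : ℝ) - v i| ≤ |(u i : ℝ) - x i| + |(x i : ℝ) - v i| := abs_sub_le _ _ _
        _ ≤ 4 * ρ := by linarith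
    have hdiam : euclDiam V ≤ ε := by
      refine Real.sSup_le ?_ hε.le
      rintro _ ⟨u, hu, v, hv, rfl⟩
      have := sqrt_sum_sq_le (g := fun i => |(u i : ℝ) - v i|) hε.le (fun _ => abs_nonneg _)
        (hVV u hu v hv) (by linarith)
      simpa [euclDist, sq_abs] using this
    have hrel : relSize V y z ≤ ε := by
      refine sqrt_sum_sq_le (c := ρ) hε.le (fun i => ?_) (fun i => ?_) (by nlinarith)
      · refine div_nonneg (abs_nonneg _) (Real.sSup_nonneg ?_)
        rintro _ ⟨_, _, _, _, rfl⟩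
        exact abs_nonneg _
      · obtain ⟨a, ha, b, hb, hab⟩ := hyz i
        have hle : |(a i : ℝ) - b i| ≤ axisDiam i V := by
          refine le_csSup ⟨4 * ρ, ?_⟩ ⟨a, Or.inl ha, b, Or.inl hb, rfl⟩
          rintro _ ⟨u, hu, v, hv, rfl⟩
          exact hVV u hu v hv i
        refine div_le_of_le_mul₀ ((abs_nonneg _).trans hle) hρ0.le (hab.trans ?_)
        gcongr
        exact min_le_left _ _
    exact abs_sub_le_of_zoomRatio_le hx hVM hδ.le (hzoom x hx V hVn hdiam)
      (Or.inl hy) (Or.inl hz) hrel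
  · push Not at hnear
    have hcM : c ≤ M := (hc y fun x hx => hnear x hx y hy).trans (hM y hy)
    have hdist : dist y z < κ := by
      refine lt_of_le_of_lt ?_ (half_lt_self hκ0)
      refine (dist_pi_le_iff (by positivity)).2 fun i => ?_
      exact ((hd y hy z hz i).trans (min_le_right _ _) :)
    have := (hκ hdist).le
    rw [Real.dist_eq] at this
    exact this.trans (by gcongr)

end Cube

/-! ### Boxes and their regret -/

namespace Cube

variable {p : ℕ} {f : Cube p → ℝ}

/-- The point of the cube nearest to a vector. -/
noncomputable def clamp (x : Fin p → ℝ) : Cube p := fun i => Set.projIcc 0 1 zero_le_one (x i)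

lemma clamp_coe {x : Fin p → ℝ} (h0 : 0 ≤ x) (h1 : x ≤ 1) (i : Fin p) :
    (clamp x i : ℝ) = x i := by
  have h0 : 0 ≤ x i := h0 i
  have h1 : x i ≤ 1 := h1 i
  simp [clamp, Set.coe_projIcc, h0, h1]

/-- The regret as a function of real vectors, which are moved into the cube first. -/
noncomputable def gap (f : Cube p → ℝ) (x : Fin p → ℝ) : ℝ := simpleRegret f (clamp x)

/-- `ZoomingContinuous.exists_osc_le` for sets of real vectors. -/
lemma ZoomingContinuous.exists_gap_osc_le (hf : ZoomingContinuous f) {δ : ℝ} (hδ : 0 < δ) :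
    ∃ η > 0, ∀ (U : Set (Fin p → ℝ)) (M : ℝ), U ⊆ Set.Icc 0 1 → (∀ x ∈ U, gap f x ≤ M) →
      (∀ x ∈ U, ∀ y ∈ U, ∀ i, |x i - y i| ≤ η) → ∀ y ∈ U, ∀ z ∈ U,
      (∀ i, ∃ a ∈ U, ∃ b ∈ U, |y i - z i| ≤ η * |a i - b i|) →
      |gap f y - gap f z| ≤ δ * M := by
  obtain ⟨η, hη, h⟩ := hf.exists_osc_le hδ
  refine ⟨η, hη, fun U M hU hM hd y hy z hz hyz => ?_⟩
  have hc : ∀ x ∈ U, ∀ i, (clamp x i : ℝ) = x i := fun x hx => clamp_coe (hU hx).1 (hU hx).2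
  have := h (clamp '' U) M (by rintro _ ⟨x, hx, rfl⟩; exact hM x hx)
    (by
      rintro _ ⟨x, hx, rfl⟩ _ ⟨y, hy, rfl⟩ i
      rw [hc x hx, hc y hy]; exact hd x hx y hy i)
    _ ⟨y, hy, rfl⟩ _ ⟨z, hz, rfl⟩
    (by
      intro i
      obtain ⟨a, ha, b, hb, hab⟩ := hyz i
      refine ⟨_, ⟨a, ha, rfl⟩, _, ⟨b, hb, rfl⟩, ?_⟩
      rw [hc y hy, hc z hz, hc a ha, hc b hb]; exact hab)
  rw [abs_sub_comm] at this
  simpa [gap, simpleRegret] using this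

/-- `lo` and `hi` are the extreme corners of a box in `[0,1]^p`, possibly degenerate, with sides
at most `1 / j`. -/
def IsBox (j : ℕ) (lo hi : Fin p → ℝ) : Prop :=
  ∀ i, 0 ≤ lo i ∧ lo i ≤ hi i ∧ hi i ≤ 1 ∧ hi i - lo i ≤ 1 / j

lemma IsBox.mono {j : ℕ} {lo hi lo' hi' : Fin p → ℝ} (h : IsBox j lo hi)
    (h1 : lo ≤ lo') (h2 : lo' ≤ hi') (h3 : hi' ≤ hi) : IsBox j lo' hi' := fun i => by
  have := h i
  have := h1 i
  have := h2 i
  have := h3 i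
  refine ⟨?_, ?_, ?_, ?_⟩ <;> linarith

lemma IsBox.subset {j : ℕ} {lo hi : Fin p → ℝ} (h : IsBox j lo hi) :
    Set.Icc lo hi ⊆ Set.Icc 0 1 := fun _ hx =>
  ⟨fun i => (h i).1.trans (hx.1 i), fun i => (hx.2 i).trans (h i).2.2.1⟩

lemma IsBox.le {j : ℕ} {lo hi : Fin p → ℝ} (h : IsBox j lo hi) : lo ≤ hi := fun i => (h i).2.1

lemma IsBox.abs_sub_le {j : ℕ} {lo hi x y : Fin p → ℝ} (h : IsBox j lo hi)
    (hx : x ∈ Set.Icc lo hi) (hy : y ∈ Set.Icc lo hi) (i : Fin p) : |x i - y i| ≤ 1 / j := by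
  have := h i
  have := hx.1 i
  have := hx.2 i
  have := hy.1 i
  have := hy.2 i
  rw [abs_le]; constructor <;> linarith

/-- If every face of a small box contains a point of regret at most `ρ`, then the regret on the
whole box is at most a constant times `ρ`: on the straight way to any point of the box, each of
boundedly many short steps at most doubles the regret. -/
lemma ZoomingContinuous.exists_hull_bound (hf : ZoomingContinuous f) (hp : 0 < p) :
    ∃ n j₀ : ℕ, ∀ j ≥ j₀, ∀ lo hi : Fin p → ℝ, IsBox j lo hi → ∀ ρ : ℝ,
      (∀ i, (∃ y ∈ Set.Icc lo hi, y i = lo i ∧ gap f y ≤ ρ) ∧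
        ∃ y ∈ Set.Icc lo hi, y i = hi i ∧ gap f y ≤ ρ) →
      ∀ x ∈ Set.Icc lo hi, gap f x ≤ 2 ^ n * ρ := by
  obtain ⟨η, hη, hosc⟩ := hf.exists_gap_osc_le (δ := 1 / 2) (by norm_num)
  obtain ⟨n, hn⟩ := exists_nat_gt (1 / η)
  have hn0 : (0 : ℝ) < n := lt_trans (by positivity) hn
  have hnη : 1 / (n : ℝ) ≤ η := by
    rw [div_le_iff₀ hn0]; rw [div_lt_iff₀ hη] at hn; linarith
  refine ⟨n, n, fun j hj lo hi hbox ρ hface x hx => ?_⟩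
  have hjη : 1 / (j : ℝ) ≤ η :=
    (one_div_le_one_div_of_le hn0 (by exact_mod_cast hj)).trans hnη
  obtain ⟨y, hy, -, hyρ⟩ := (hface ⟨0, hp⟩).1
  have hρ : 0 ≤ ρ := (simpleRegret_nonneg hf.continuous _).trans hyρ
  let w : ℕ → Fin p → ℝ := fun k i => y i + (k / n : ℝ) * (x i - y i)
  have hw : ∀ k ≤ n, w k ∈ Set.Icc lo hi := fun k hk => by
    have h0 : (0 : ℝ) ≤ k / n := by positivity
    have h1 : (k / n : ℝ) ≤ 1 := div_le_one_of_le₀ (by exact_mod_cast hk) hn0.le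
    have key : ∀ i, lo i ≤ w k i ∧ w k i ≤ hi i := fun i => by
      have a1 := hx.1 i
      have a2 := hx.2 i
      have a3 := hy.1 i
      have a4 := hy.2 i
      simp only [w]
      constructor <;> nlinarith
    exact ⟨fun i => (key i).1, fun i => (key i).2⟩
  have hstep : ∀ k ≤ n, gap f (w k) ≤ 2 ^ k * ρ := by
    intro k
    induction k with
    | zero =>
      intro _
      have : w 0 = y := by ext i; simp [w]
      simpa [this] using hyρ
    | succ k ih =>
      intro hk
      have ihk := ih (by omega)
      set R := 2 ^ k * ρ with hR
      have hR0 : 0 ≤ R := by positivity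
      have hρR : ρ ≤ R := le_mul_of_one_le_left hρ (one_le_pow₀ (by norm_num))
      have hgoal : (2 : ℝ) ^ (k + 1) * ρ = 2 * R := by rw [hR]; ring
      rw [hgoal]
      by_contra! hlt
      let U : Set (Fin p → ℝ) := insert (w (k + 1)) {v | v ∈ Set.Icc lo hi ∧ gap f v ≤ R}
      have hUbox : U ⊆ Set.Icc lo hi := by
        rintro v (rfl | hv)
        · exact hw _ hk
        · exact hv.1
      have hkU : w k ∈ U := Or.inr ⟨hw k (by omega), ihk⟩
      have := hosc U (gap f (w (k + 1))) (hUbox.trans hbox.subset)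
        (by
          rintro v (rfl | hv)
          · exact le_rfl
          · linarith [hv.2])
        (fun u hu v hv i => (hbox.abs_sub_le (hUbox hu) (hUbox hv) i).trans hjη)
        _ (Set.mem_insert _ _) _ hkU
        (by
          intro i
          obtain ⟨⟨a, ha, hai, haρ⟩, b, hb, hbi, hbρ⟩ := hface i
          refine ⟨b, Or.inr ⟨hb, hbρ.trans hρR⟩, a, Or.inr ⟨ha, haρ.trans hρR⟩, ?_⟩
          have hd : w (k + 1) i - w k i = (1 / n : ℝ) * (x i - y i) := by
            simp only [w]; push_cast; ring
          rw [hd, hai, hbi, abs_mul, abs_of_nonneg (by positivity : (0 : ℝ) ≤ 1 / n),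
            abs_of_nonneg (sub_nonneg.2 (hbox.le i))]
          refine mul_le_mul hnη ?_ (abs_nonneg _) hη.le
          have a1 := hx.1 i
          have a2 := hx.2 i
          have a3 := hy.1 i
          have a4 := hy.2 i
          rw [abs_le]; constructor <;> linarith)
      rw [abs_le] at this
      linarith [this.2]
  have hwn : w n = x := by ext i; simp [w, hn0.ne']
  simpa [hwn] using hstep n le_rfl

/-- The two properties of the regret on boxes of side at most `1 / j`, for large `j`, on which the
analysis of the algorithm rests: if the regret on the box is at most `K * r`, it varies by at most
`3 / 4 * r` over each cell of the `j`-fold subdivision of the box; and if every face contains a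
point of regret at most `7 * r`, then the regret on the box is at most `K / 2 * r`. -/
structure BoxRegularity (f : Cube p → ℝ) (K : ℝ) (j : ℕ) : Prop where
  osc : ∀ lo hi : Fin p → ℝ, IsBox j lo hi → ∀ r : ℝ, (∀ x ∈ Set.Icc lo hi, gap f x ≤ K * r) →
    ∀ y ∈ Set.Icc lo hi, ∀ z ∈ Set.Icc lo hi, (∀ i, |y i - z i| ≤ (hi i - lo i) / j) →
    |gap f y - gap f z| ≤ 3 / 4 * r
  hull : ∀ lo hi : Fin p → ℝ, IsBox j lo hi → ∀ r : ℝ,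
    (∀ i, (∃ y ∈ Set.Icc lo hi, y i = lo i ∧ gap f y ≤ 7 * r) ∧
      ∃ y ∈ Set.Icc lo hi, y i = hi i ∧ gap f y ≤ 7 * r) →
    ∀ x ∈ Set.Icc lo hi, gap f x ≤ K / 2 * r

theorem ZoomingContinuous.exists_boxRegularity (hf : ZoomingContinuous f) (hp : 0 < p) :
    ∃ K ≥ 8, ∃ j₀ : ℕ, ∀ j ≥ j₀, BoxRegularity f K j := by
  obtain ⟨n, j₁, hhull⟩ := hf.exists_hull_bound hp
  set K : ℝ := 14 * 2 ^ n with hK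
  have hK8 : 8 ≤ K := by
    have : (1 : ℝ) ≤ 2 ^ n := one_le_pow₀ (by norm_num)
    rw [hK]; linarith
  have hK0 : 0 < K := by linarith
  obtain ⟨η, hη, hosc⟩ := hf.exists_gap_osc_le (δ := 3 / (4 * K)) (by positivity)
  obtain ⟨j₂, hj₂⟩ := exists_nat_gt (1 / η)
  refine ⟨K, hK8, max j₁ j₂, fun j hj => ⟨?_, ?_⟩⟩
  · intro lo hi hbox r hr y hy z hz hyz
    have hj2 : (j₂ : ℝ) ≤ j := by exact_mod_cast (le_max_right _ _).trans hj
    have hj0 : (0 : ℝ) < j := lt_of_lt_of_le (lt_trans (by positivity) hj₂) hj2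
    have hjη : 1 / (j : ℝ) ≤ η := by
      rw [div_le_iff₀ hj0]; rw [div_lt_iff₀ hη] at hj₂; nlinarith
    have h := hosc (Set.Icc lo hi) (K * r) hbox.subset hr
      (fun u hu v hv i => (hbox.abs_sub_le hu hv i).trans hjη) y hy z hz
      (fun i => ⟨hi, ⟨hbox.le, le_rfl⟩, lo, ⟨le_rfl, hbox.le⟩, (hyz i).trans (by
        have h0 := sub_nonneg.2 (hbox.le i)
        rw [abs_of_nonneg h0, div_eq_mul_one_div, mul_comm]
        gcongr)⟩)
    refine h.trans (le_of_eq ?_)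
    field_simp
  · intro lo hi hbox r hface x hx
    have := hhull j ((le_max_left _ _).trans hj) lo hi hbox (7 * r) hface x hx
    refine this.trans (le_of_eq ?_)
    rw [hK]; ring

end Cube

/-! ### Deviations of the rewards from their means -/

namespace BanditStrategy

variable {X 𝒵 Ω : Type*} [MeasurableSpace X] [MeasurableSpace 𝒵]

/-- The deviation of the reward of round `t` from the mean reward of the arm played. -/
noncomputable def deviation (S : BanditStrategy X 𝒵) (P : Kernel X I) (Y : ℕ → Ω → I)
    (Z : ℕ → Ω → 𝒵) (t : ℕ) (ω : Ω) : ℝ :=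
  (Y t ω : ℝ) - rewardFunction P (S.armAt Y Z t ω)

/-- Hoeffding's lemma for a reward distribution. -/
lemma lintegral_exp_reward_le (P : Kernel X I) [IsMarkovKernel P] (x : X) (s : ℝ) :
    ∫⁻ y, ENNReal.ofReal (Real.exp (s * ((y : ℝ) - rewardFunction P x))) ∂(P x)
      ≤ ENNReal.ofReal (Real.exp (s ^ 2 / 8)) := by
  have h := hasSubgaussianMGF_of_mem_Icc (μ := P x) (X := fun y : I => (y : ℝ)) (a := 0) (b := 1)
    (by fun_prop) (Eventually.of_forall fun y => y.2)
  change ∫⁻ y, ENNReal.ofReal (Real.exp (s * ((y : ℝ) - ∫ y, (y : ℝ) ∂(P x)))) ∂(P x) ≤ _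
  rw [← ofReal_integral_eq_lintegral_ofReal (h.integrable_exp_mul s)
    (Eventually.of_forall fun _ => (Real.exp_pos _).le)]
  refine ENNReal.ofReal_le_ofReal ((h.mgf_le s).trans (le_of_eq ?_))
  congr 1
  simp
  ring

variable {S : BanditStrategy X 𝒵} {P : Kernel X I}

/-- The sum of the deviations over a block of rounds is a function of the past of any later
round. -/
lemma exists_sum_deviation_eq (S : BanditStrategy X 𝒵) (hμ : Measurable (rewardFunction P))
    (t n : ℕ) :
    ∃ F : (Fin (t + n) → I) × (Fin (t + n + 1) → 𝒵) → ℝ, Measurable F ∧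
      ∀ (Y : ℕ → Ω → I) (Z : ℕ → Ω → 𝒵) (ω : Ω),
        ∑ i ∈ Finset.range n, S.deviation P Y Z (t + i) ω
          = F (fun i => Y i ω, fun i => Z i ω) := by
  refine ⟨fun h => ∑ i : Fin n, ((h.1 ⟨t + i, by omega⟩ : ℝ) - rewardFunction P
    (S.arm (t + i) (fun k => h.1 ⟨k, by omega⟩, fun k => h.2 ⟨k, by omega⟩))), ?_, ?_⟩
  · refine Finset.measurable_sum _ fun i _ => Measurable.sub ?_ ?_
    · exact measurable_subtype_coe.comp ((measurable_pi_apply _).comp measurable_fst)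
    · refine hμ.comp ((S.measurable_arm _).comp (Measurable.prodMk ?_ ?_))
      · exact measurable_pi_lambda _ fun k => (measurable_pi_apply _).comp measurable_fst
      · exact measurable_pi_lambda _ fun k => (measurable_pi_apply _).comp measurable_snd
  · intro Y Z ω
    rw [Finset.sum_range]
    rfl

variable [MeasurableSpace Ω] {Pr : Measure Ω} {Y : ℕ → Ω → I} {Z Zhat : ℕ → Ω → 𝒵}

lemma IsRun.measurable_armAt (h : S.IsRun P Pr Y Z Zhat) (t : ℕ) :
    Measurable (S.armAt Y Z t) := by
  refine (S.measurable_arm t).comp (Measurable.prodMk ?_ ?_)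
  · exact measurable_pi_lambda _ fun i => h.measurable_reward i
  · exact measurable_pi_lambda _ fun i => h.measurable_rand i

lemma IsRun.measurable_deviation (h : S.IsRun P Pr Y Z Zhat)
    (hμ : Measurable (rewardFunction P)) (t : ℕ) : Measurable (S.deviation P Y Z t) :=
  (measurable_subtype_coe.comp (h.measurable_reward t)).sub (hμ.comp (h.measurable_armAt t))

/-- Given the past and the randomisation variable of a round, the deviation of its reward has mean
zero, so Hoeffding's lemma applies to one round after the other. -/
lemma IsRun.lintegral_exp_sum_deviation_le [IsProbabilityMeasure Pr] [IsMarkovKernel P]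
    (h : S.IsRun P Pr Y Z Zhat) (hμ : Measurable (rewardFunction P)) (s : ℝ) (t n : ℕ) :
    ∫⁻ ω, ENNReal.ofReal (Real.exp (s * ∑ i ∈ Finset.range n, S.deviation P Y Z (t + i) ω)) ∂Pr
      ≤ ENNReal.ofReal (Real.exp (n * (s ^ 2 / 8))) := by
  induction n with
  | zero => simp
  | succ n ih =>
    obtain ⟨F, hF, hFeq⟩ := exists_sum_deviation_eq (Ω := Ω) S hμ t n
    have hlaw := h.condDistrib_reward (t + n)
    have hm : Measurable fun q : ((Fin (t + n) → I) × (Fin (t + n + 1) → 𝒵)) × I =>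
        ENNReal.ofReal (Real.exp (s * F q.1)) *
          ENNReal.ofReal (Real.exp (s * ((q.2 : ℝ) - rewardFunction P (S.arm (t + n) q.1)))) := by
      have h1 : Measurable fun q : ((Fin (t + n) → I) × (Fin (t + n + 1) → 𝒵)) × I =>
        rewardFunction P (S.arm (t + n) q.1) := hμ.comp ((S.measurable_arm _).comp measurable_fst)
      have h2 : Measurable fun q : ((Fin (t + n) → I) × (Fin (t + n + 1) → 𝒵)) × I =>
        F q.1 := hF.comp measurable_fst
      fun_prop
    have hH : AEMeasurable (fun ω => ((fun i => Y i ω, fun i => Z i ω) :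
        (Fin (t + n) → I) × (Fin (t + n + 1) → 𝒵))) Pr := hlaw.aemeasurable_fst
    calc ∫⁻ ω, ENNReal.ofReal
          (Real.exp (s * ∑ i ∈ Finset.range (n + 1), S.deviation P Y Z (t + i) ω)) ∂Pr
        = ∫⁻ ω, (fun q : ((Fin (t + n) → I) × (Fin (t + n + 1) → 𝒵)) × I =>
            ENNReal.ofReal (Real.exp (s * F q.1)) * ENNReal.ofReal
              (Real.exp (s * ((q.2 : ℝ) - rewardFunction P (S.arm (t + n) q.1)))))
            ((fun i => Y i ω, fun i => Z i ω), Y (t + n) ω) ∂Pr := by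
          refine lintegral_congr fun ω => ?_
          rw [Finset.sum_range_succ, hFeq Y Z ω, mul_add, Real.exp_add,
            ENNReal.ofReal_mul (Real.exp_pos _).le]
          rfl
      _ = ∫⁻ q, _ ∂(Pr.map _) := (lintegral_map' hm.aemeasurable hlaw.aemeasurable).symm
      _ = ∫⁻ a, ∫⁻ y, ENNReal.ofReal (Real.exp (s * F a)) * ENNReal.ofReal
            (Real.exp (s * ((y : ℝ) - rewardFunction P (S.arm (t + n) a))))
            ∂(P (S.arm (t + n) a)) ∂(Pr.map fun ω => ((fun i => Y i ω, fun i => Z i ω) :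
              (Fin (t + n) → I) × (Fin (t + n + 1) → 𝒵))) := by
          rw [hlaw.map_eq, Measure.lintegral_compProd hm]
          rfl
      _ ≤ ∫⁻ a, ENNReal.ofReal (Real.exp (s * F a)) * ENNReal.ofReal (Real.exp (s ^ 2 / 8))
            ∂(Pr.map fun ω => ((fun i => Y i ω, fun i => Z i ω) :
              (Fin (t + n) → I) × (Fin (t + n + 1) → 𝒵))) := by
          refine lintegral_mono fun a => ?_
          rw [lintegral_const_mul' _ _ ENNReal.ofReal_ne_top]
          gcongr
          exact lintegral_exp_reward_le P _ s
      _ = (∫⁻ ω, ENNReal.ofReal (Real.exp (s * F (fun i => Y i ω, fun i => Z i ω))) ∂Pr)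
            * ENNReal.ofReal (Real.exp (s ^ 2 / 8)) := by
          rw [lintegral_mul_const' _ _ ENNReal.ofReal_ne_top, lintegral_map' (by fun_prop) hH]
      _ ≤ ENNReal.ofReal (Real.exp (n * (s ^ 2 / 8))) * ENNReal.ofReal (Real.exp (s ^ 2 / 8)) := by
          gcongr
          simpa only [hFeq Y Z] using ih
      _ = ENNReal.ofReal (Real.exp ((n + 1 : ℕ) * (s ^ 2 / 8))) := by
          rw [← ENNReal.ofReal_mul (Real.exp_pos _).le, ← Real.exp_add]
          congr 2; push_cast; ring

/-- The **Azuma–Hoeffding** inequality for the deviations over a block of rounds. -/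
lemma IsRun.measure_lt_abs_sum_deviation_le [IsProbabilityMeasure Pr] [IsMarkovKernel P]
    (h : S.IsRun P Pr Y Z Zhat) (hμ : Measurable (rewardFunction P)) (t n : ℕ) {L : ℝ}
    (hL : 0 ≤ L) :
    Pr {ω | √(n * L) < |∑ i ∈ Finset.range n, S.deviation P Y Z (t + i) ω|}
      ≤ 2 * ENNReal.ofReal (Real.exp (-2 * L)) := by
  rcases Nat.eq_zero_or_pos n with rfl | hn
  · simp
  have hn' : (0 : ℝ) < n := by exact_mod_cast hn
  set a := √(n * L) with ha
  have ha2 : a ^ 2 = n * L := Real.sq_sqrt (by positivity)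
  set D : Ω → ℝ := fun ω => ∑ i ∈ Finset.range n, S.deviation P Y Z (t + i) ω with hD
  have hDm : Measurable D := Finset.measurable_sum _ fun i _ => h.measurable_deviation hμ _
  -- the optimal exponent in the Chernoff bound is `4 * a / n`, up to sign
  have side : ∀ sg : ℝ, sg ^ 2 = 1 →
      Pr {ω | a ≤ sg * D ω} ≤ ENNReal.ofReal (Real.exp (-2 * L)) := by
    intro sg hsg
    have hs : (sg * (4 * a / n)) ^ 2 = 16 * L / n := by
      rw [mul_pow, hsg, div_pow, mul_pow, ha2]; field_simp; ring
    have hmk := mul_meas_ge_le_lintegral (μ := Pr)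
      (f := fun ω => ENNReal.ofReal (Real.exp (sg * (4 * a / n) * D ω))) (by fun_prop)
      (ENNReal.ofReal (Real.exp (4 * L)))
    have hint := h.lintegral_exp_sum_deviation_le hμ (sg * (4 * a / n)) t n
    rw [hs, show (n : ℝ) * (16 * L / n / 8) = 2 * L by field_simp; ring] at hint
    have hsub : Pr {ω | a ≤ sg * D ω} ≤ Pr {ω | ENNReal.ofReal (Real.exp (4 * L))
        ≤ ENNReal.ofReal (Real.exp (sg * (4 * a / n) * D ω))} := by
      refine measure_mono fun ω hω => ENNReal.ofReal_le_ofReal (Real.exp_le_exp.2 ?_)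
      have hω' : a ≤ sg * D ω := hω
      calc 4 * L = 4 * a / n * a := by
            have : a * a = n * L := by rw [← sq]; exact ha2
            field_simp; linarith
        _ ≤ 4 * a / n * (sg * D ω) := by gcongr
        _ = sg * (4 * a / n) * D ω := by ring
    have hfin : ENNReal.ofReal (Real.exp (4 * L)) * Pr {ω | a ≤ sg * D ω}
        ≤ ENNReal.ofReal (Real.exp (2 * L)) :=
      (mul_le_mul_right hsub _).trans (hmk.trans hint)
    have hexp : ENNReal.ofReal (Real.exp (-4 * L)) * ENNReal.ofReal (Real.exp (4 * L)) = 1 := by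
      rw [← ENNReal.ofReal_mul (Real.exp_pos _).le, ← Real.exp_add]; simp
    calc Pr {ω | a ≤ sg * D ω}
        = ENNReal.ofReal (Real.exp (-4 * L)) * (ENNReal.ofReal (Real.exp (4 * L))
            * Pr {ω | a ≤ sg * D ω}) := by rw [← mul_assoc, hexp, one_mul]
      _ ≤ ENNReal.ofReal (Real.exp (-4 * L)) * ENNReal.ofReal (Real.exp (2 * L)) := by gcongr
      _ = ENNReal.ofReal (Real.exp (-2 * L)) := by
          rw [← ENNReal.ofReal_mul (Real.exp_pos _).le, ← Real.exp_add]; congr 2; ring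
  calc Pr {ω | a < |D ω|} ≤ Pr ({ω | a ≤ 1 * D ω} ∪ {ω | a ≤ -1 * D ω}) := by
        refine measure_mono fun ω hω => ?_
        rcases lt_abs.1 (show a < |D ω| from hω) with h1 | h1
        · left; simpa using h1.le
        · right; simpa using h1.le
    _ ≤ _ := measure_union_le _ _
    _ ≤ _ := by
        rw [two_mul]
        exact add_le_add (side 1 (by norm_num)) (side (-1) (by norm_num))

/-- The square of the deviation bound for the block of `n` rounds from round `t` on, up to a
factor `n`. -/
noncomputable def logTerm (b : ℝ) (t n : ℕ) : ℝ := Real.log (t + 2) + Real.log (n + 2) + b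

lemma logTerm_nonneg {b : ℝ} (hb : 0 ≤ b) (t n : ℕ) : 0 ≤ logTerm b t n := by
  have h1 : 0 ≤ Real.log (t + 2) := Real.log_nonneg (by linarith [(t.cast_nonneg : (0 : ℝ) ≤ t)])
  have h2 : 0 ≤ Real.log (n + 2) := Real.log_nonneg (by linarith [(n.cast_nonneg : (0 : ℝ) ≤ n)])
  unfold logTerm; linarith

lemma exp_neg_two_mul_logTerm (b : ℝ) (t n : ℕ) :
    Real.exp (-2 * logTerm b t n)
      = Real.exp (-2 * b) * (((t : ℝ) + 2) ^ 2)⁻¹ * (((n : ℝ) + 2) ^ 2)⁻¹ := by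
  have h : ∀ x : ℝ, 0 < x → Real.exp (-2 * Real.log x) = (x ^ 2)⁻¹ := fun x hx => by
    rw [neg_mul, Real.exp_neg, two_mul, Real.exp_add, Real.exp_log hx, sq]
  rw [show -2 * logTerm b t n = -2 * b + -2 * Real.log (t + 2) + -2 * Real.log (n + 2) by
    unfold logTerm; ring, Real.exp_add, Real.exp_add, h _ (by positivity), h _ (by positivity)]

/-- With probability at least `1 - ε`, the sums of the deviations over all blocks of rounds are
bounded at once. The constant `b` depends on `ε` only. -/
theorem exists_deviation_bound {ε : ℝ} (hε : 0 < ε) :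
    ∃ b : ℝ, 0 ≤ b ∧ ∀ {X 𝒵 Ω : Type*} [MeasurableSpace X] [MeasurableSpace 𝒵]
      [MeasurableSpace Ω] {S : BanditStrategy X 𝒵} {P : Kernel X I} [IsMarkovKernel P]
      {Pr : Measure Ω} [IsProbabilityMeasure Pr] {Y : ℕ → Ω → I} {Z Zhat : ℕ → Ω → 𝒵},
      S.IsRun P Pr Y Z Zhat → Measurable (rewardFunction P) →
      ∃ E : Set Ω, MeasurableSet E ∧ ENNReal.ofReal (1 - ε) ≤ Pr E ∧
        ∀ ω ∈ E, ∀ t n : ℕ, |∑ i ∈ Finset.range n, S.deviation P Y Z (t + i) ω|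
          ≤ √(n * logTerm b t n) := by
  have hsum : Summable fun t : ℕ => (((t : ℝ) + 2) ^ 2)⁻¹ := by
    have := (summable_nat_add_iff 2).2 (Real.summable_nat_pow_inv.2 one_lt_two)
    simpa using this
  set c : ℝ := ∑' t : ℕ, (((t : ℝ) + 2) ^ 2)⁻¹ with hc
  -- the bound for the total probability of all bad events tends to zero
  have hlim : Tendsto (fun b : ℝ => 2 * (Real.exp (-2 * b) * c * c)) atTop (𝓝 0) := by
    have h1 : Tendsto (fun b : ℝ => Real.exp (-2 * b)) atTop (𝓝 0) :=
      Real.tendsto_exp_atBot.comp (tendsto_id.const_mul_atTop_of_neg (by norm_num))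
    simpa using ((h1.mul_const c).mul_const c).const_mul 2
  obtain ⟨b, hb0, hbε⟩ := ((eventually_ge_atTop 0).and (hlim.eventually (gt_mem_nhds hε))).exists
  refine ⟨b, hb0, fun {X 𝒵 Ω _ _ _ S P _ Pr _ Y Z Zhat} h hμ => ?_⟩
  let B : ℕ → ℕ → Set Ω := fun t n =>
    {ω | √(n * logTerm b t n) < |∑ i ∈ Finset.range n, S.deviation P Y Z (t + i) ω|}
  have hBm : ∀ t n, MeasurableSet (B t n) := fun t n => by
    have : Measurable fun ω => ∑ i ∈ Finset.range n, S.deviation P Y Z (t + i) ω :=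
      Finset.measurable_sum _ fun i _ => h.measurable_deviation hμ _
    exact measurableSet_lt measurable_const this.norm
  have hUm : MeasurableSet (⋃ t, ⋃ n, B t n) :=
    MeasurableSet.iUnion fun t => MeasurableSet.iUnion fun n => hBm t n
  have hc' : ∑' t : ℕ, ENNReal.ofReal (((t : ℝ) + 2) ^ 2)⁻¹ = ENNReal.ofReal c :=
    (ENNReal.ofReal_tsum_of_nonneg (fun _ => by positivity) hsum).symm
  have hU : Pr (⋃ t, ⋃ n, B t n) ≤ ENNReal.ofReal ε := by
    calc Pr (⋃ t, ⋃ n, B t n) ≤ ∑' t, ∑' n, Pr (B t n) :=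
          (measure_iUnion_le _).trans (ENNReal.tsum_le_tsum fun t => measure_iUnion_le _)
      _ ≤ ∑' t : ℕ, ∑' n : ℕ, 2 * (ENNReal.ofReal (Real.exp (-2 * b)) *
            ENNReal.ofReal (((t : ℝ) + 2) ^ 2)⁻¹ * ENNReal.ofReal (((n : ℝ) + 2) ^ 2)⁻¹) := by
          refine ENNReal.tsum_le_tsum fun t => ENNReal.tsum_le_tsum fun n => ?_
          refine (h.measure_lt_abs_sum_deviation_le hμ t n (logTerm_nonneg hb0 t n)).trans ?_
          rw [exp_neg_two_mul_logTerm, ENNReal.ofReal_mul (by positivity),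
            ENNReal.ofReal_mul (by positivity)]
      _ = ENNReal.ofReal (2 * (Real.exp (-2 * b) * c * c)) := by
          have hc0 : 0 ≤ c := tsum_nonneg fun _ => by positivity
          simp_rw [ENNReal.tsum_mul_left, hc', ENNReal.tsum_mul_right, ENNReal.tsum_mul_left, hc']
          rw [ENNReal.ofReal_mul (by norm_num), ENNReal.ofReal_mul (by positivity),
            ENNReal.ofReal_mul (by positivity)]
          simp
      _ ≤ ENNReal.ofReal ε := ENNReal.ofReal_le_ofReal hbε.le
  refine ⟨(⋃ t, ⋃ n, B t n)ᶜ, hUm.compl, ?_, fun ω hω t n => ?_⟩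
  · rw [prob_compl_eq_one_sub hUm, ENNReal.ofReal_sub _ hε.le, ENNReal.ofReal_one]
    exact tsub_le_tsub_left hU 1
  · simp only [Set.mem_compl_iff, Set.mem_iUnion, not_exists] at hω
    exact not_lt.1 (hω t n)

end BanditStrategy

/-! ### Straight-line programs -/

namespace RealRAM

namespace Prog

open Classical in
/-- The effect of a program without loops and random draws. Loops are skipped, and draws give
zero. -/
noncomputable def eval : Prog → Mem → Mem
  | skip, m => m
  | instr i, m => i.apply (fun _ => 0) m
  | seq c₁ c₂, m => c₂.eval (c₁.eval m)
  | ifte b c₁ c₂, m => if b.holds m then c₁.eval m else c₂.eval m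
  | loop _ _, m => m

/-- A program is plain if it has no loops and makes no random draws. -/
def IsPlain : Prog → Prop
  | skip => True
  | instr (.draw _) => False
  | instr _ => True
  | seq c₁ c₂ => c₁.IsPlain ∧ c₂.IsPlain
  | ifte _ c₁ c₂ => c₁.IsPlain ∧ c₂.IsPlain
  | loop _ _ => False

/-- A bound on the number of steps of a plain program. -/
def size : Prog → ℕ
  | skip => 1
  | instr _ => 1
  | seq c₁ c₂ => c₁.size + c₂.size
  | ifte _ c₁ c₂ => c₁.size + c₂.size + 1
  | loop _ _ => 1

/-- A plain program always halts, with the effect `eval`, after boundedly many steps. -/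
theorem IsPlain.exec {c : Prog} (hc : c.IsPlain) (z : ℕ → I) (m : Mem) :
    ∃ n ≤ c.size, Exec z c m (c.eval m) n := by
  induction c generalizing m with
  | skip => exact ⟨1, le_rfl, .skip m⟩
  | instr i =>
    refine ⟨1, le_rfl, ?_⟩
    have : i.apply (fun _ => 0) m = i.apply z m := by
      cases i <;> first | rfl | exact hc.elim
    rw [eval, this]
    exact .instr i m
  | seq c₁ c₂ h₁ h₂ =>
    obtain ⟨n₁, hn₁, e₁⟩ := h₁ hc.1 m
    obtain ⟨n₂, hn₂, e₂⟩ := h₂ hc.2 (c₁.eval m)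
    exact ⟨n₁ + n₂, add_le_add hn₁ hn₂, .seq e₁ e₂⟩
  | ifte b c₁ c₂ h₁ h₂ =>
    by_cases hb : b.holds m
    · obtain ⟨n, hn, e⟩ := h₁ hc.1 m
      refine ⟨n + 1, by simp only [size]; omega, ?_⟩
      rw [eval, if_pos hb]
      exact .ifteTrue hb e
    · obtain ⟨n, hn, e⟩ := h₂ hc.2 m
      refine ⟨n + 1, by simp only [size]; omega, ?_⟩
      rw [eval, if_neg hb]
      exact .ifteFalse hb e
  | loop b c _ => exact hc.elim

end Prog

/-- A memory which depends measurably on a parameter. The number of draws is left out, as plain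
programs do not use it. -/
structure Mem.MeasurableFamily {Ω : Type*} [MeasurableSpace Ω] (g : Ω → Mem) : Prop where
  nat : ∀ a, Measurable fun ω => (g ω).nat a
  real : ∀ a, Measurable fun ω => (g ω).real a

namespace Mem.MeasurableFamily

variable {Ω : Type*} [MeasurableSpace Ω] {g : Ω → Mem}

lemma apply_index {E : Type*} [MeasurableSpace E] {F : Ω → ℕ → E} {h : Ω → ℕ}
    (hF : ∀ a, Measurable fun ω => F ω a) (hh : Measurable h) :
    Measurable fun ω => F ω (h ω) := by
  have : Measurable fun q : ℕ × Ω => F q.2 q.1 := measurable_from_prod_countable_right hF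
  exact this.comp (hh.prodMk measurable_id)

lemma setNat (hg : MeasurableFamily g) {d h : Ω → ℕ} (hd : Measurable d) (hh : Measurable h) :
    MeasurableFamily fun ω => (g ω).setNat (d ω) (h ω) where
  nat a := by
    simp only [Mem.setNat, Function.update_apply]
    exact Measurable.ite (measurableSet_eq_fun measurable_const hd) hh (hg.nat a)
  real a := hg.real a

lemma setReal (hg : MeasurableFamily g) {d : Ω → ℕ} {h : Ω → ℝ} (hd : Measurable d)
    (hh : Measurable h) : MeasurableFamily fun ω => (g ω).setReal (d ω) (h ω) where
  nat a := hg.nat a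
  real a := by
    simp only [Mem.setReal, Function.update_apply]
    exact Measurable.ite (measurableSet_eq_fun measurable_const hd) hh (hg.real a)

lemma instr (hg : MeasurableFamily g) (i : Instr) :
    MeasurableFamily fun ω => i.apply (fun _ => 0) (g ω) := by
  have hn := hg.nat
  have hr := hg.real
  have hnat : ∀ h : ℕ → ℕ, Measurable h := fun h => measurable_of_countable h
  cases i with
  | natConst d n => exact hg.setNat measurable_const measurable_const
  | natAdd d a b => exact hg.setNat measurable_const ((hn a).add (hn b))
  | natSub d a b => exact hg.setNat measurable_const ((hn a).sub (hn b))
  | natHalf d a => exact hg.setNat measurable_const ((hnat fun x => x / 2).comp (hn a))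
  | natLoad d a => exact hg.setNat measurable_const (apply_index hn (hn a))
  | natStore a b => exact hg.setNat (hn a) (hn b)
  | realOfNat d a =>
    exact hg.setReal measurable_const ((measurable_of_countable (Nat.cast : ℕ → ℝ)).comp (hn a))
  | realAdd d a b => exact hg.setReal measurable_const ((hr a).add (hr b))
  | realSub d a b => exact hg.setReal measurable_const ((hr a).sub (hr b))
  | realMul d a b => exact hg.setReal measurable_const ((hr a).mul (hr b))
  | realDiv d a b => exact hg.setReal measurable_const ((hr a).div (hr b))
  | realSqrt d a => exact hg.setReal measurable_const (hr a).sqrt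
  | realLog d a => exact hg.setReal measurable_const (Real.measurable_log.comp (hr a))
  | realLoad d a => exact hg.setReal measurable_const (apply_index hr (hn a))
  | realStore a b => exact hg.setReal (hn a) (hr b)
  | draw d =>
    have := hg.setReal (measurable_const (a := d)) (measurable_const (a := ((0 : I) : ℝ)))
    exact ⟨this.nat, this.real⟩

lemma measurableSet_holds (hg : MeasurableFamily g) (b : Test) :
    MeasurableSet {ω | b.holds (g ω)} := by
  cases b with
  | natEq a b => exact measurableSet_eq_fun (hg.nat a) (hg.nat b)
  | natLt a b => exact measurableSet_lt (hg.nat a) (hg.nat b)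
  | realLt a b => exact measurableSet_lt (hg.real a) (hg.real b)
  | realLe a b => exact measurableSet_le (hg.real a) (hg.real b)

/-- The effect of any program is measurable, since tests are measurable and indirect addresses take
countably many values. -/
theorem eval (hg : MeasurableFamily g) (c : Prog) : MeasurableFamily fun ω => c.eval (g ω) := by
  induction c generalizing g with
  | skip => exact hg
  | instr i => exact hg.instr i
  | seq c₁ c₂ h₁ h₂ => exact h₂ (h₁ hg)
  | ifte b c₁ c₂ h₁ h₂ =>
    have hb := hg.measurableSet_holds b
    have h₁ := h₁ hg
    have h₂ := h₂ hg
    refine ⟨fun a => ?_, fun a => ?_⟩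
    · simp only [Prog.eval, apply_ite Mem.nat, ite_apply]
      exact Measurable.ite hb (h₁.nat a) (h₂.nat a)
    · simp only [Prog.eval, apply_ite Mem.real, ite_apply]
      exact Measurable.ite hb (h₁.real a) (h₂.real a)
  | loop b c _ => exact hg

end Mem.MeasurableFamily

/-! ### Learners without loops and draws -/

namespace Learner

/-- A learner made of plain programs. -/
structure IsPlain (A : Learner) : Prop where
  play : A.play.IsPlain
  recommend : A.recommend.IsPlain

/-- The memory after the first `t` rounds, on rewards `y`. -/
noncomputable def memory (A : Learner) (p : ℕ) (y : ℕ → I) : ℕ → Mem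
  | 0 => Mem.init
  | t + 1 => (A.play.eval (A.memory p y t).rewind).setReal p (y t)

variable {A : Learner} {p : ℕ}

/-- The time of a learner without loops is linear in the number of rounds. -/
theorem IsPlain.reaches (hA : A.IsPlain) (y : ℕ → I) (z : ℕ → ℕ → I) (t : ℕ) :
    ∃ n ≤ A.play.size * t, A.Reaches p y z t (A.memory p y t) n := by
  induction t with
  | zero => exact ⟨0, le_rfl, .start⟩
  | succ t ih =>
    obtain ⟨n, hn, h⟩ := ih
    obtain ⟨k, hk, e⟩ := hA.play.exec (z t) (A.memory p y t).rewind
    exact ⟨n + k, by rw [mul_add, mul_one]; omega, h.round e⟩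

theorem IsPlain.totalTime (hA : A.IsPlain) (y : ℕ → I) (z : ℕ → ℕ → I) (zhat : ℕ → I) (T : ℕ) :
    ∃ n, A.TotalTime p y z zhat T n ∧ n ≤ A.play.size * T + A.recommend.size := by
  obtain ⟨n₁, hn₁, h₁⟩ := hA.reaches (p := p) y z T
  obtain ⟨n₂, hn₂, h₂⟩ := hA.recommend.exec zhat (A.memory p y T).rewind
  exact ⟨n₁ + n₂, ⟨_, _, _, _, h₁, h₂, rfl⟩, by omega⟩

lemma memory_congr {y y' : ℕ → I} {t : ℕ} (h : ∀ i < t, y i = y' i) :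
    A.memory p y t = A.memory p y' t := by
  induction t with
  | zero => rfl
  | succ t ih => rw [memory, memory, ih fun i hi => h i (by omega), h t (by omega)]

/-- Finitely many rewards, continued arbitrarily. -/
def extend {t : ℕ} (y : Fin t → I) (i : ℕ) : I := if h : i < t then y ⟨i, h⟩ else 0

lemma memory_extend (y : ℕ → I) (t : ℕ) :
    A.memory p (extend fun i : Fin t => y i) t = A.memory p y t :=
  memory_congr fun i hi => by simp [extend, hi]

lemma measurableFamily_memory (t s : ℕ) :
    Mem.MeasurableFamily fun y : Fin t → I => A.memory p (extend y) s := by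
  induction s with
  | zero => exact ⟨fun a => measurable_const, fun a => measurable_const⟩
  | succ s ih =>
    have ih' : Mem.MeasurableFamily fun y : Fin t → I => (A.memory p (extend y) s).rewind :=
      ⟨ih.nat, ih.real⟩
    refine (ih'.eval A.play).setReal measurable_const (measurable_subtype_coe.comp ?_)
    by_cases h : s < t
    · simpa [extend, h] using measurable_pi_apply (⟨s, h⟩ : Fin t)
    · simp [extend, h]

/-- The arm shown in the real registers `0, …, p - 1`, moved into the cube. -/
noncomputable def output (p : ℕ) (m : Mem) : Cube p := Cube.clamp fun i : Fin p => m.real i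

lemma measurable_output {Ω : Type*} [MeasurableSpace Ω] {g : Ω → Mem}
    (hg : Mem.MeasurableFamily g) : Measurable fun ω => output p (g ω) :=
  measurable_pi_lambda _ fun i => continuous_projIcc.measurable.comp (hg.real i)

/-- The strategy implemented by a learner made of plain programs. It ignores its randomisation
variables. -/
noncomputable def strategy (A : Learner) (p : ℕ) : BanditStrategy (Cube p) (ℕ → I) where
  law _ := uniformTape
  isProb_law _ := by unfold uniformTape; infer_instance
  hatLaw _ := uniformTape
  isProb_hatLaw _ := by unfold uniformTape; infer_instance
  arm t h := output p (A.play.eval (A.memory p (extend h.1) t).rewind)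
  measurable_arm t := by
    have h := measurableFamily_memory (A := A) (p := p) t t
    have h' : Mem.MeasurableFamily fun y : Fin t → I => (A.memory p (extend y) t).rewind :=
      ⟨h.nat, h.real⟩
    exact (measurable_output (h'.eval A.play)).comp measurable_fst
  estimate T h := output p (A.recommend.eval (A.memory p (extend h.1.1) T).rewind)
  measurable_estimate T := by
    have h := measurableFamily_memory (A := A) (p := p) T T
    have h' : Mem.MeasurableFamily fun y : Fin T → I => (A.memory p (extend y) T).rewind :=
      ⟨h.nat, h.real⟩
    exact (measurable_output (h'.eval A.recommend)).comp (measurable_fst.comp measurable_fst)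

lemma strategy_arm (y : ℕ → I) (z : ℕ → ℕ → I) (t : ℕ) :
    (A.strategy p).arm t (fun j => y j, fun j => z j)
      = output p (A.play.eval (A.memory p y t).rewind) := by
  simp only [strategy, memory_extend]

lemma strategy_estimate (y : ℕ → I) (z : ℕ → ℕ → I) (zhat : ℕ → I) (T : ℕ) :
    (A.strategy p).estimate T ((fun j => y j, fun j => z j), zhat)
      = output p (A.recommend.eval (A.memory p y T).rewind) := by
  simp only [strategy, memory_extend]

/-- A learner made of plain programs implements its strategy if it always shows points of the
cube. -/
theorem IsPlain.implements (hA : A.IsPlain)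
    (harm : ∀ y t, ∀ i : Fin p,
      (A.play.eval (A.memory p y t).rewind).real i ∈ Set.Icc (0 : ℝ) 1)
    (hest : ∀ y t, ∀ i : Fin p,
      (A.recommend.eval (A.memory p y t).rewind).real i ∈ Set.Icc (0 : ℝ) 1) :
    A.Implements (A.strategy p) where
  law_eq _ := rfl
  hatLaw_eq _ := rfl
  arm_eq y z t := by
    obtain ⟨n, -, h⟩ := hA.reaches (p := p) y z t
    obtain ⟨k, -, e⟩ := hA.play.exec (z t) (A.memory p y t).rewind
    refine ⟨_, n, _, k, h, e, fun i => ?_⟩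
    rw [strategy_arm, output, Cube.clamp_coe (fun i => (harm y t i).1) (fun i => (harm y t i).2)]
  estimate_eq y z zhat T := by
    obtain ⟨n, -, h⟩ := hA.reaches (p := p) y z T
    obtain ⟨k, -, e⟩ := hA.recommend.exec zhat (A.memory p y T).rewind
    refine ⟨_, n, _, k, h, e, fun i => ?_⟩
    rw [strategy_estimate, output,
      Cube.clamp_coe (fun i => (hest y T i).1) (fun i => (hest y T i).2)]

end Learner

end RealRAM

/-! ### The program of the algorithm -/

namespace RealRAM

namespace Prog

/-- A sequence of instructions. -/
def block : List Instr → Prog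
  | [] => skip
  | i :: l => seq (instr i) (block l)

/-- The programs `c 0, …, c (n - 1)` one after the other. -/
def each : ℕ → (ℕ → Prog) → Prog
  | 0, _ => skip
  | n + 1, c => seq (each n c) (c n)

/-- Copy the real register `a` to the real register `d`. -/
def copy (d a : ℕ) : Prog := block [.natConst 0 a, .realLoad d 0]

/-- Copy the real register `a` to the real register `d` if the test `b` holds. -/
def select (b : Test) (d a : ℕ) : Prog := ifte b (copy d a) skip

lemma isPlain_each {c : ℕ → Prog} (hc : ∀ i, (c i).IsPlain) (n : ℕ) : (each n c).IsPlain := by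
  induction n with
  | zero => trivial
  | succ n ih => exact ⟨ih, hc n⟩

end Prog

open Prog

/-! Registers of natural numbers: `0` and `9` are scratch, `1` holds the number `j` of the run, `2`
the phase `m`, `3` the number `s` of samples per cell, `4` the number of samples of the current
cell, `5` the initial value of `s`, `6` the number of the current box, `7` is set if a cell of the
box has survived, `8` is the carry of the odometers, whose digits are in `10 + 2 * i` and
`11 + 2 * i`.

Registers of real numbers: `0, …, p - 1` show the arm, `p` the reward, `p + 1` holds the sum of the
rewards of the current cell, `p + 2` the lower bound for the maximum, `p + 3` the resolution `r` of
the phase, `p + 4` the mean reward of a cell, `p + 5` and `p + 6` are scratch. From `p + 10` on,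
there are the corners of the box, of the hull of its surviving cells, the best arm, the recommended
arm, and from `7 * p + 10` on, the array of all boxes. -/

namespace Adaptive

variable (p : ℕ)

/-- The address of coordinate `i` of the lower corner of the current box. -/
def lo (i : ℕ) : ℕ := p + 10 + i

/-- The address of coordinate `i` of the upper corner of the current box. -/
def hi (i : ℕ) : ℕ := 2 * p + 10 + i

/-- The address of coordinate `i` of the lower corner of the hull of the surviving cells of the
current box. -/
def alo (i : ℕ) : ℕ := 3 * p + 10 + i

/-- The address of coordinate `i` of the upper corner of the hull of the surviving cells of the
current box. -/
def ahi (i : ℕ) : ℕ := 4 * p + 10 + i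

/-- The address of coordinate `i` of the arm with the largest lower confidence bound. -/
def best (i : ℕ) : ℕ := 5 * p + 10 + i

/-- The address of coordinate `i` of the recommended arm. -/
def rcm (i : ℕ) : ℕ := 6 * p + 10 + i

/-- The address of coordinate `i` of the lower corner of the first box of the array. -/
def arrLo (i : ℕ) : ℕ := 7 * p + 10 + i

/-- The address of coordinate `i` of the upper corner of the first box of the array. -/
def arrHi (i : ℕ) : ℕ := 8 * p + 10 + i

/-- Count a reward. -/
def tick : Prog := block [.realAdd (p + 1) (p + 1) p, .natConst 0 1, .natAdd 4 4 0]

/-- Extend the hull of the surviving cells by the current cell. -/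
def absorb : Prog :=
  seq (each p fun i =>
    seq (block [.realSub (p + 5) (hi p i) (lo p i), .realOfNat (p + 6) 1,
      .realDiv (p + 5) (p + 5) (p + 6), .realAdd (p + 5) (p + 5) i, .natConst 9 0]) <|
    seq (select (.natEq 7 9) (alo p i) i) <|
    seq (select (.natEq 7 9) (ahi p i) (p + 5)) <|
    seq (select (.realLt i (alo p i)) (alo p i) i)
      (select (.realLt (ahi p i) (p + 5)) (ahi p i) (p + 5)))
    (block [.natConst 7 1])

/-- Compute the mean reward of the current cell. -/
def mean : Prog := block [.realOfNat (p + 5) 3, .realDiv (p + 4) (p + 1) (p + 5)]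

/-- Keep the current cell unless its mean is too small. -/
def survive : Prog :=
  seq (block [.realAdd (p + 5) (p + 4) (p + 3)]) (ifte (.realLe (p + 2) (p + 5)) (absorb p) skip)

/-- Improve the lower bound for the maximum, if possible. -/
def record : Prog :=
  seq (block [.realSub (p + 5) (p + 4) (p + 3)]) <|
    ifte (.realLt (p + 2) (p + 5))
      (seq (copy (p + 2) (p + 5)) (each p fun i => copy (best p i) i)) skip

/-- Advance the odometer with the digits in the registers `d i`. -/
def advance (d : ℕ → ℕ) : Prog :=
  seq (block [.natConst 8 1]) <| each p fun i =>
    seq (block [.natAdd (d i) (d i) 8]) <|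
      ifte (.natLt (d i) 1) (block [.natConst 8 0]) (block [.natConst (d i) 0])

/-- Start a new run. -/
def newRun : Prog :=
  block [.natConst 0 1, .natAdd 1 1 0, .natAdd 5 5 1, .natConst 0 0, .natAdd 3 5 0, .natConst 2 0,
    .realOfNat (p + 2) 0, .natConst 0 1, .realOfNat (p + 3) 0]

/-- Start a new phase, and a new run after the last phase. -/
def newPhase : Prog :=
  seq (block [.natConst 6 0, .natConst 0 2, .realOfNat (p + 5) 0, .realDiv (p + 3) (p + 3) (p + 5),
    .natAdd 3 3 3, .natAdd 3 3 3, .natConst 0 1, .natAdd 2 2 0]) <|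
  ifte (.natLt 1 2) (newRun p) skip

/-- The distance of the `k`-th box from the beginning of the array. -/
def offset (k : ℕ) : ℕ := 2 * p * k

/-- Put the address `a + offset p k` into register `0`, where `k` is the number of the box. -/
def address (a : ℕ) : Prog :=
  seq (block [.natConst 0 a]) (each (2 * p) fun _ => block [.natAdd 0 0 6])

/-- Replace the current box in the array by the hull of the surviving cells, or by the best arm if
there are none. -/
def close : Prog :=
  seq (block [.natConst 9 0]) <|
  seq (ifte (.natEq 7 9)
    (each p fun i => seq (copy (alo p i) (best p i)) (copy (ahi p i) (best p i))) skip) <|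
  seq (each p fun i =>
    seq (seq (address p (arrLo p i)) (block [.realStore 0 (alo p i)]))
      (seq (address p (arrHi p i)) (block [.realStore 0 (ahi p i)]))) <|
  block [.natConst 7 0, .natConst 0 1, .natAdd 6 6 0]

/-- Load the current box, which is a cell of a fixed grid in the first phase of a run. -/
def load : Prog :=
  seq (block [.natConst 9 0]) <|
  ifte (.natEq 2 9)
    (each p fun i => block [.realOfNat (lo p i) (11 + 2 * i), .natConst 0 1,
      .natAdd 0 0 (11 + 2 * i), .realOfNat (hi p i) 0, .realOfNat (p + 5) 1,
      .realDiv (lo p i) (lo p i) (p + 5), .realDiv (hi p i) (hi p i) (p + 5)])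
    (each p fun i =>
      seq (seq (address p (arrLo p i)) (block [.realLoad (lo p i) 0]))
        (seq (address p (arrHi p i)) (block [.realLoad (hi p i) 0])))

/-- Finish a box. -/
def boxEnd : Prog :=
  seq (close p) <| seq (advance p fun i => 11 + 2 * i) <| seq (block [.natConst 9 0]) <|
  seq (ifte (.natLt 9 8) (newPhase p) skip) (load p)

/-- Finish a cell. -/
def cellEnd : Prog :=
  seq (mean p) <| seq (survive p) <| seq (record p) <|
  seq (block [.natConst 4 0, .realOfNat (p + 1) 4]) <|
  seq (advance p fun i => 10 + 2 * i) <| seq (block [.natConst 9 0]) <|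
  ifte (.natLt 9 8) (boxEnd p) skip

/-- Show the lower corner of the current cell. -/
def show_ : Prog :=
  each p fun i =>
    seq (block [.realSub (p + 5) (hi p i) (lo p i), .realOfNat (p + 6) (10 + 2 * i),
      .realMul (p + 5) (p + 5) (p + 6), .realOfNat (p + 6) 1, .realDiv (p + 5) (p + 5) (p + 6),
      .realAdd (p + 5) (lo p i) (p + 5), .natConst 9 0, .realOfNat (p + 6) 9]) <|
    seq (select (.realLt (p + 5) (p + 6)) (p + 5) (p + 6)) <|
    seq (block [.natConst 9 1, .realOfNat (p + 6) 9]) <|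
    seq (select (.realLt (p + 6) (p + 5)) (p + 5) (p + 6)) <|
    copy i (p + 5)

/-- Process the last reward. -/
def update : Prog :=
  seq (block [.natConst 9 0]) <|
  ifte (.natEq 1 9) (seq (newRun p) (load p))
    (seq (tick p) (ifte (.natLt 4 3) skip (cellEnd p)))

/-- Choose an arm, which is also recommended in the last phase of a run. -/
def play : Prog :=
  seq (update p) <| seq (show_ p) <| ifte (.natEq 2 1) (each p fun i => copy (rcm p i) i) skip

/-- The program for the rounds, and the program which copies the recommended arm to the output. -/
def learner : Learner where
  play := play p
  recommend := each p fun i => copy i (rcm p i)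

lemma isPlain_learner : (learner p).IsPlain := by
  constructor
  all_goals repeat' first
    | exact trivial
    | exact isPlain_each (fun _ => ⟨trivial, trivial⟩) _
    | refine isPlain_each (fun i => ?_) _
    | refine And.intro ?_ ?_

/-! ### The state of the algorithm -/

/-- The part of the memory on which the algorithm depends: the number `j` of the run, the phase `m`,
the number `s` of samples per cell, the number `cnt` of samples of the current cell, the value `s0`
of `s` in the first phase, the number `k` of the current box, the flag for surviving cells, the
carry and the digits of the odometers for cells and boxes, the last reward, the sum of the rewards
of the cell, the lower bound `v` for the maximum, the resolution `r`, the mean reward `u` of the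
cell, and points of the cube. The array of boxes is shown as two functions of the number of a
box. -/
@[ext]
structure State where
  j : ℕ
  m : ℕ
  s : ℕ
  cnt : ℕ
  s0 : ℕ
  k : ℕ
  flag : ℕ
  carry : ℕ
  cd : ℕ → ℕ
  bd : ℕ → ℕ
  rew : ℝ
  sum : ℝ
  v : ℝ
  r : ℝ
  u : ℝ
  arm : Fin p → ℝ
  lo : Fin p → ℝ
  hi : Fin p → ℝ
  alo : Fin p → ℝ
  ahi : Fin p → ℝ
  best : Fin p → ℝ
  rcm : Fin p → ℝ
  arrLo : ℕ → Fin p → ℝ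
  arrHi : ℕ → Fin p → ℝ

/-- The state shown by a memory. -/
def view (m : Mem) : State p where
  j := m.nat 1
  m := m.nat 2
  s := m.nat 3
  cnt := m.nat 4
  s0 := m.nat 5
  k := m.nat 6
  flag := m.nat 7
  carry := m.nat 8
  cd i := m.nat (10 + 2 * i)
  bd i := m.nat (11 + 2 * i)
  rew := m.real p
  sum := m.real (p + 1)
  v := m.real (p + 2)
  r := m.real (p + 3)
  u := m.real (p + 4)
  arm i := m.real i
  lo i := m.real (Adaptive.lo p i)
  hi i := m.real (Adaptive.hi p i)
  alo i := m.real (Adaptive.alo p i)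
  ahi i := m.real (Adaptive.ahi p i)
  best i := m.real (Adaptive.best p i)
  rcm i := m.real (Adaptive.rcm p i)
  arrLo k i := m.real (Adaptive.arrLo p i + offset p k)
  arrHi k i := m.real (Adaptive.arrHi p i + offset p k)

variable {p}

/-- If the program `c i` changes the `i`-th coordinate of some vector of the state only, then
running all of them changes the whole vector. -/
lemma view_each {V : Type*} {c : ℕ → Prog} (get : State p → Fin p → V)
    (set : (Fin p → V) → State p → State p) (val : State p → Fin p → V)
    (h1 : ∀ f g τ, set f (set g τ) = set f τ) (h2 : ∀ f τ, get (set f τ) = f)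
    (h3 : ∀ τ, set (get τ) τ = τ)
    (h4 : ∀ f τ i, f i = get τ i → val (set f τ) i = val τ i)
    (hc : ∀ (i : Fin p) m, view p ((c i).eval m)
      = set (Function.update (get (view p m)) i (val (view p m) i)) (view p m)) (m : Mem) :
    view p ((each p c).eval m) = set (val (view p m)) (view p m) := by
  have key : ∀ n ≤ p, view p ((each n c).eval m)
      = set (fun i => if (i : ℕ) < n then val (view p m) i else get (view p m) i) (view p m) := by
    intro n
    induction n with
    | zero => intro _; simpa [each, eval] using (h3 _).symm
    | succ n ih =>
      intro hn
      rw [each, eval, hc ⟨n, hn⟩, ih (by omega), h1, h2, h4 _ _ _ (by simp)]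
      congr 1
      ext i
      rw [Function.update_apply]
      by_cases hi : i = ⟨n, hn⟩
      · subst hi; simp
      · have : (i : ℕ) ≠ n := fun h => hi (Fin.ext h)
        rw [if_neg hi]
        exact if_congr (by omega) rfl rfl
  simpa using key p le_rfl

end Adaptive

end RealRAM

/-! ### Writing single registers -/

namespace RealRAM

namespace Adaptive

variable {p : ℕ}

lemma view_setNat_zero (m : Mem) (x : ℕ) :
    view p (m.setNat 0 x) = view p m := by
  ext k i' <;> simp only [view, Mem.setNat, Function.update_apply] <;>
    exact if_neg (by omega)

lemma view_setNat_nine (m : Mem) (x : ℕ) :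
    view p (m.setNat 9 x) = view p m := by
  ext k i' <;> simp only [view, Mem.setNat, Function.update_apply] <;>
    exact if_neg (by omega)

lemma view_setNat_j (m : Mem) (x : ℕ) :
    view p (m.setNat 1 x) = { view p m with j := x } := by
  ext k i' <;> simp only [view, Mem.setNat, Function.update_apply] <;>
    first | exact if_neg (by omega) | exact if_pos trivial

lemma view_setNat_m (m : Mem) (x : ℕ) :
    view p (m.setNat 2 x) = { view p m with m := x } := by
  ext k i' <;> simp only [view, Mem.setNat, Function.update_apply] <;>
    first | exact if_neg (by omega) | exact if_pos trivial

lemma view_setNat_s (m : Mem) (x : ℕ) :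
    view p (m.setNat 3 x) = { view p m with s := x } := by
  ext k i' <;> simp only [view, Mem.setNat, Function.update_apply] <;>
    first | exact if_neg (by omega) | exact if_pos trivial

lemma view_setNat_cnt (m : Mem) (x : ℕ) :
    view p (m.setNat 4 x) = { view p m with cnt := x } := by
  ext k i' <;> simp only [view, Mem.setNat, Function.update_apply] <;>
    first | exact if_neg (by omega) | exact if_pos trivial

lemma view_setNat_s0 (m : Mem) (x : ℕ) :
    view p (m.setNat 5 x) = { view p m with s0 := x } := by
  ext k i' <;> simp only [view, Mem.setNat, Function.update_apply] <;>
    first | exact if_neg (by omega) | exact if_pos trivial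

lemma view_setNat_k (m : Mem) (x : ℕ) :
    view p (m.setNat 6 x) = { view p m with k := x } := by
  ext k i' <;> simp only [view, Mem.setNat, Function.update_apply] <;>
    first | exact if_neg (by omega) | exact if_pos trivial

lemma view_setNat_flag (m : Mem) (x : ℕ) :
    view p (m.setNat 7 x) = { view p m with flag := x } := by
  ext k i' <;> simp only [view, Mem.setNat, Function.update_apply] <;>
    first | exact if_neg (by omega) | exact if_pos trivial

lemma view_setNat_carry (m : Mem) (x : ℕ) :
    view p (m.setNat 8 x) = { view p m with carry := x } := by
  ext k i' <;> simp only [view, Mem.setNat, Function.update_apply] <;>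
    first | exact if_neg (by omega) | exact if_pos trivial

lemma view_setNat_cd (m : Mem) (i : ℕ) (x : ℕ) :
    view p (m.setNat (10 + 2 * i) x) = { view p m with
      cd := Function.update (view p m).cd i x } := by
  ext k i' <;> simp only [view, Mem.setNat, Function.update_apply] <;>
    first | exact if_neg (by omega) | exact if_congr (by omega) rfl rfl

lemma view_setNat_bd (m : Mem) (i : ℕ) (x : ℕ) :
    view p (m.setNat (11 + 2 * i) x) = { view p m with
      bd := Function.update (view p m).bd i x } := by
  ext k i' <;> simp only [view, Mem.setNat, Function.update_apply] <;>
    first | exact if_neg (by omega) | exact if_congr (by omega) rfl rfl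

lemma view_setReal_rew (m : Mem) (x : ℝ) :
    view p (m.setReal p x) = { view p m with rew := x } := by
  ext k i' <;> simp only [view, Mem.setReal, Function.update_apply, lo, hi, alo, ahi,
    best, rcm, arrLo, arrHi] <;>
    first | exact if_neg (by omega) | exact if_pos trivial

lemma view_setReal_sum (m : Mem) (x : ℝ) :
    view p (m.setReal (p + 1) x) = { view p m with sum := x } := by
  ext k i' <;> simp only [view, Mem.setReal, Function.update_apply, lo, hi, alo, ahi,
    best, rcm, arrLo, arrHi] <;>
    first | exact if_neg (by omega) | exact if_pos trivial

lemma view_setReal_v (m : Mem) (x : ℝ) :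
    view p (m.setReal (p + 2) x) = { view p m with v := x } := by
  ext k i' <;> simp only [view, Mem.setReal, Function.update_apply, lo, hi, alo, ahi,
    best, rcm, arrLo, arrHi] <;>
    first | exact if_neg (by omega) | exact if_pos trivial

lemma view_setReal_r (m : Mem) (x : ℝ) :
    view p (m.setReal (p + 3) x) = { view p m with r := x } := by
  ext k i' <;> simp only [view, Mem.setReal, Function.update_apply, lo, hi, alo, ahi,
    best, rcm, arrLo, arrHi] <;>
    first | exact if_neg (by omega) | exact if_pos trivial

lemma view_setReal_u (m : Mem) (x : ℝ) :
    view p (m.setReal (p + 4) x) = { view p m with u := x } := by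
  ext k i' <;> simp only [view, Mem.setReal, Function.update_apply, lo, hi, alo, ahi,
    best, rcm, arrLo, arrHi] <;>
    first | exact if_neg (by omega) | exact if_pos trivial

lemma view_setReal_scratch (m : Mem) (x : ℝ) :
    view p (m.setReal (p + 5) x) = view p m := by
  ext k i' <;> simp only [view, Mem.setReal, Function.update_apply, lo, hi, alo, ahi,
    best, rcm, arrLo, arrHi] <;>
    exact if_neg (by omega)

lemma view_setReal_scratch' (m : Mem) (x : ℝ) :
    view p (m.setReal (p + 6) x) = view p m := by
  ext k i' <;> simp only [view, Mem.setReal, Function.update_apply, lo, hi, alo, ahi,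
    best, rcm, arrLo, arrHi] <;>
    exact if_neg (by omega)

lemma view_setReal_arm (m : Mem) (i : Fin p) (x : ℝ) :
    view p (m.setReal i x) = { view p m with arm := Function.update (view p m).arm i x } := by
  ext k i' <;> simp only [view, Mem.setReal, Function.update_apply, Fin.ext_iff, lo, hi, alo, ahi,
    best, rcm, arrLo, arrHi] <;>
    exact if_neg (by omega)

lemma view_setReal_lo (m : Mem) (i : Fin p) (x : ℝ) :
    view p (m.setReal (lo p i) x) = { view p m with lo := Function.update (view p m).lo i x } := by
  ext k i' <;> simp only [view, Mem.setReal, Function.update_apply, Fin.ext_iff, lo, hi, alo, ahi,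
    best, rcm, arrLo, arrHi] <;>
    first | exact if_neg (by omega) | exact if_congr (by omega) rfl rfl

lemma view_setReal_hi (m : Mem) (i : Fin p) (x : ℝ) :
    view p (m.setReal (hi p i) x) = { view p m with hi := Function.update (view p m).hi i x } := by
  ext k i' <;> simp only [view, Mem.setReal, Function.update_apply, Fin.ext_iff, lo, hi, alo, ahi,
    best, rcm, arrLo, arrHi] <;>
    first | exact if_neg (by omega) | exact if_congr (by omega) rfl rfl

lemma view_setReal_alo (m : Mem) (i : Fin p) (x : ℝ) :
    view p (m.setReal (alo p i) x) = { view p m with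
      alo := Function.update (view p m).alo i x } := by
  ext k i' <;> simp only [view, Mem.setReal, Function.update_apply, Fin.ext_iff, lo, hi, alo, ahi,
    best, rcm, arrLo, arrHi] <;>
    first | exact if_neg (by omega) | exact if_congr (by omega) rfl rfl

lemma view_setReal_ahi (m : Mem) (i : Fin p) (x : ℝ) :
    view p (m.setReal (ahi p i) x) = { view p m with
      ahi := Function.update (view p m).ahi i x } := by
  ext k i' <;> simp only [view, Mem.setReal, Function.update_apply, Fin.ext_iff, lo, hi, alo, ahi,
    best, rcm, arrLo, arrHi] <;>
    first | exact if_neg (by omega) | exact if_congr (by omega) rfl rfl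

lemma view_setReal_best (m : Mem) (i : Fin p) (x : ℝ) :
    view p (m.setReal (best p i) x) = { view p m with
      best := Function.update (view p m).best i x } := by
  ext k i' <;> simp only [view, Mem.setReal, Function.update_apply, Fin.ext_iff, lo, hi, alo, ahi,
    best, rcm, arrLo, arrHi] <;>
    first | exact if_neg (by omega) | exact if_congr (by omega) rfl rfl

lemma view_setReal_rcm (m : Mem) (i : Fin p) (x : ℝ) :
    view p (m.setReal (rcm p i) x) = { view p m with
      rcm := Function.update (view p m).rcm i x } := by
  ext k i' <;> simp only [view, Mem.setReal, Function.update_apply, Fin.ext_iff, lo, hi, alo, ahi,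
    best, rcm, arrLo, arrHi] <;>
    first | exact if_neg (by omega) | exact if_congr (by omega) rfl rfl

end Adaptive
end RealRAM

/-! ### Reading registers -/

namespace RealRAM

namespace Mem

lemma nat_setReal (m : Mem) (d : ℕ) (x : ℝ) : (m.setReal d x).nat = m.nat := rfl

lemma real_setNat (m : Mem) (d n : ℕ) : (m.setNat d n).real = m.real := rfl

lemma nat_setNat_self (m : Mem) (d n : ℕ) : (m.setNat d n).nat d = n := by simp [setNat]

lemma nat_setNat_of_ne (m : Mem) {d a : ℕ} (n : ℕ) (h : a ≠ d) :
    (m.setNat d n).nat a = m.nat a := by simp [setNat, h]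

lemma real_setReal_self (m : Mem) (d : ℕ) (x : ℝ) : (m.setReal d x).real d = x := by
  simp [setReal]

lemma real_setReal_of_ne (m : Mem) {d a : ℕ} (x : ℝ) (h : a ≠ d) :
    (m.setReal d x).real a = m.real a := by simp [setReal, h]

end Mem

namespace Prog

lemma eval_copy (d a : ℕ) (m : Mem) :
    (copy d a).eval m = (m.setNat 0 a).setReal d (m.real a) := by
  simp [copy, block, eval, Instr.apply, Mem.nat_setNat_self, Mem.real_setNat]

open Classical in
lemma eval_select (b : Test) (d a : ℕ) (m : Mem) :
    (select b d a).eval m = (m.setNat 0 (if b.holds m then a else m.nat 0)).setReal d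
      (if b.holds m then m.real a else m.real d) := by
  by_cases h : b.holds m
  · simp [select, eval, h, eval_copy]
  · simp [select, eval, h, Mem.setNat, Mem.setReal]

end Prog

open Prog

namespace Adaptive

variable {p : ℕ}

lemma eval_address (a : ℕ) (m : Mem) :
    (address p a).eval m = m.setNat 0 (a + offset p (m.nat 6)) := by
  have h : ∀ n (m : Mem), (each n fun _ => block [.natAdd 0 0 6]).eval m
      = m.setNat 0 (m.nat 0 + n * m.nat 6) := by
    intro n m
    induction n with
    | zero => simp [each, eval, Mem.setNat]
    | succ n ih =>
      rw [each, eval, ih]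
      simp [block, eval, Instr.apply, Mem.setNat, add_mul, add_assoc]
  rw [address, eval, h]
  simp [eval, block, Instr.apply, offset, Mem.setNat]

/-- Different boxes of the array do not share registers. -/
lemma offset_ne {k k' : ℕ} (h : k ≠ k') {a b : ℕ} (ha : a < 2 * p) (hb : b < 2 * p) :
    a + offset p k ≠ b + offset p k' := by
  intro hab
  have h0 : 0 < 2 * p := by omega
  have := congrArg (· / (2 * p)) hab
  simp only [offset, Nat.add_mul_div_left _ _ h0, Nat.div_eq_of_lt ha, Nat.div_eq_of_lt hb] at this
  omega

lemma view_setReal_arrLo (m : Mem) (k : ℕ) (i : Fin p) (x : ℝ) :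
    view p (m.setReal (arrLo p i + offset p k) x) = { view p m with
      arrLo := Function.update (view p m).arrLo k
        (Function.update ((view p m).arrLo k) i x) } := by
  have hi := i.2
  ext k' i'
  case arrLo =>
    simp only [view, Mem.setReal, Function.update_apply]
    by_cases hk : k' = k
    · subst hk
      simp [arrLo, Function.update_apply, Fin.ext_iff]
    · have hi' := i'.2
      have := offset_ne (p := p) hk (a := i') (b := i) (by omega) (by omega)
      rw [if_neg (by simp only [arrLo]; omega), if_neg hk]
  case arrHi =>
    have hi' := i'.2
    simp only [view, Mem.setReal, Function.update_apply]
    refine if_neg ?_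
    by_cases hk : k' = k
    · subst hk; simp only [arrLo, arrHi]; omega
    · have := offset_ne (p := p) hk (a := p + i') (b := i) (by omega) (by omega)
      simp only [arrLo, arrHi]; omega
  all_goals
    simp only [view, Mem.setReal, Function.update_apply, lo, Adaptive.hi, alo, ahi, best, rcm,
      arrLo, ite_eq_right_iff] <;> omega

lemma view_setReal_arrHi (m : Mem) (k : ℕ) (i : Fin p) (x : ℝ) :
    view p (m.setReal (arrHi p i + offset p k) x) = { view p m with
      arrHi := Function.update (view p m).arrHi k
        (Function.update ((view p m).arrHi k) i x) } := by
  have hi := i.2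
  ext k' i'
  case arrHi =>
    simp only [view, Mem.setReal, Function.update_apply]
    by_cases hk : k' = k
    · subst hk
      simp [arrHi, Function.update_apply, Fin.ext_iff]
    · have hi' := i'.2
      have := offset_ne (p := p) hk (a := i') (b := i) (by omega) (by omega)
      rw [if_neg (by simp only [arrHi]; omega), if_neg hk]
  case arrLo =>
    have hi' := i'.2
    simp only [view, Mem.setReal, Function.update_apply]
    refine if_neg ?_
    by_cases hk : k' = k
    · subst hk; simp only [arrLo, arrHi]; omega
    · have := offset_ne (p := p) hk (a := i') (b := p + i) (by omega) (by omega)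
      simp only [arrLo, arrHi]; omega
  all_goals
    simp only [view, Mem.setReal, Function.update_apply, lo, Adaptive.hi, alo, ahi, best, rcm,
      arrHi, ite_eq_right_iff] <;> omega

/-! ### The steps of the algorithm -/

namespace State

/-- Count a reward. -/
noncomputable def tick (τ : State p) : State p :=
  { τ with sum := τ.sum + τ.rew, cnt := τ.cnt + 1 }

/-- Extend the hull of the surviving cells by the current cell. -/
noncomputable def absorb (τ : State p) : State p :=
  { τ with
    alo := fun i => min (τ.arm i) (if τ.flag = 0 then τ.arm i else τ.alo i)
    ahi := fun i => max (if τ.flag = 0 then (τ.hi i - τ.lo i) / τ.j + τ.arm i else τ.ahi i)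
      ((τ.hi i - τ.lo i) / τ.j + τ.arm i)
    flag := 1 }

/-- Compute the mean reward of the current cell. -/
noncomputable def mean (τ : State p) : State p := { τ with u := τ.sum / τ.s }

open Classical in
/-- Keep the current cell unless its mean is too small. -/
noncomputable def survive (τ : State p) : State p := if τ.v ≤ τ.u + τ.r then τ.absorb else τ

open Classical in
/-- Improve the lower bound for the maximum, if possible. -/
noncomputable def record (τ : State p) : State p :=
  if τ.v < τ.u - τ.r then { τ with v := τ.u - τ.r, best := τ.arm } else τ

/-- The first `n` digits of the successor of a number with digits `d` to base `j`, and the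
carry. -/
def succDigits (j : ℕ) (d : ℕ → ℕ) : ℕ → (ℕ → ℕ) × ℕ
  | 0 => (d, 1)
  | n + 1 =>
    let e := succDigits j d n
    if e.1 n + e.2 < j then (Function.update e.1 n (e.1 n + e.2), 0)
    else (Function.update e.1 n 0, e.2)

/-- Advance to the next cell. -/
def nextCell (τ : State p) : State p :=
  { τ with
    cd := (succDigits τ.j τ.cd p).1
    carry := (succDigits τ.j τ.cd p).2 }

/-- Advance to the next box. -/
def nextBox (τ : State p) : State p :=
  { τ with
    bd := (succDigits τ.j τ.bd p).1
    carry := (succDigits τ.j τ.bd p).2 }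

/-- Start a new run. -/
def newRun (τ : State p) : State p :=
  { τ with j := τ.j + 1, s0 := τ.s0 + (τ.j + 1), s := τ.s0 + (τ.j + 1), m := 0, v := 0, r := 1 }

/-- Start a new phase. -/
noncomputable def newPhase (τ : State p) : State p :=
  { τ with k := 0, r := τ.r / 2, s := τ.s + τ.s + (τ.s + τ.s), m := τ.m + 1 }

/-- Replace the current box in the array by the hull of the surviving cells, or by the best arm if
there are none. -/
def close (τ : State p) : State p :=
  let a := if τ.flag = 0 then τ.best else τ.alo
  let b := if τ.flag = 0 then τ.best else τ.ahi
  { τ with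
    alo := a, ahi := b, arrLo := Function.update τ.arrLo τ.k a
    arrHi := Function.update τ.arrHi τ.k b, flag := 0, k := τ.k + 1 }

/-- Load the current box, which is a cell of a fixed grid in the first phase of a run. -/
noncomputable def load (τ : State p) : State p :=
  if τ.m = 0 then
    { τ with lo := fun i => τ.bd i / τ.j, hi := fun i => (1 + τ.bd i : ℕ) / τ.j }
  else { τ with lo := τ.arrLo τ.k, hi := τ.arrHi τ.k }

/-- Start a new phase, and a new run after the last phase. -/
noncomputable def phaseEnd (τ : State p) : State p :=
  if τ.newPhase.j < τ.newPhase.m then τ.newPhase.newRun else τ.newPhase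

/-- Finish a box. -/
noncomputable def boxEnd (τ : State p) : State p :=
  let b := τ.close.nextBox
  if 0 < b.carry then b.phaseEnd.load else b.load

/-- Evaluate the current cell, and get ready to sample the next one. -/
noncomputable def scan (τ : State p) : State p :=
  { τ.mean.survive.record with cnt := 0, sum := 0 }

/-- Finish a cell. -/
noncomputable def cellEnd (τ : State p) : State p :=
  let c := τ.scan.nextCell
  if 0 < c.carry then c.boxEnd else c

/-- The arm shown by a state: the lower corner of the current cell. -/
noncomputable def point (τ : State p) (i : Fin p) : ℝ :=
  min 1 (max (τ.lo i + (τ.hi i - τ.lo i) * τ.cd i / τ.j) 0)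

/-- Show the lower corner of the current cell. -/
noncomputable def show_ (τ : State p) : State p := { τ with arm := τ.point }

/-- Recommend the arm in the last phase of a run. -/
def recommend (τ : State p) : State p := if τ.m = τ.j then { τ with rcm := τ.arm } else τ

/-- Process the last reward. -/
noncomputable def update (τ : State p) : State p :=
  if τ.j = 0 then τ.newRun.load
  else if τ.tick.cnt < τ.s then τ.tick else τ.tick.cellEnd

/-- One round of the algorithm. -/
noncomputable def next (τ : State p) : State p := τ.update.show_.recommend

end State

/-! ### The program follows the algorithm -/

lemma fst_update_pair (a b : Fin p → ℝ) (i : Fin p) (x : ℝ × ℝ) :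
    (fun k => (Function.update (fun k => (a k, b k)) i x k).1) = Function.update a i x.1 := by
  ext k; by_cases h : k = i <;> simp [h]

lemma snd_update_pair (a b : Fin p → ℝ) (i : Fin p) (x : ℝ × ℝ) :
    (fun k => (Function.update (fun k => (a k, b k)) i x k).2) = Function.update b i x.2 := by
  ext k; by_cases h : k = i <;> simp [h]

lemma view_ifte {b : Test} {c₁ c₂ : Prog} {m : Mem} {q : Prop} [Decidable q] {τ₁ τ₂ : State p}
    (hq : b.holds m ↔ q) (h₁ : view p (c₁.eval m) = τ₁) (h₂ : view p (c₂.eval m) = τ₂) :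
    view p ((ifte b c₁ c₂).eval m) = if q then τ₁ else τ₂ := by
  by_cases h : q
  · rw [eval, if_pos (hq.2 h), if_pos h, h₁]
  · rw [eval, if_neg (mt hq.1 h), if_neg h, h₂]

lemma view_tick (m : Mem) : view p ((tick p).eval m) = (view p m).tick := by
  simp (disch := omega) only [tick, block, eval, Instr.apply, Mem.nat_setNat_self,
    Mem.nat_setNat_of_ne, Mem.nat_setReal, view_setNat_zero, view_setNat_cnt, view_setReal_sum]
  rfl

lemma view_mean (m : Mem) : view p ((mean p).eval m) = (view p m).mean := by
  simp (disch := omega) only [mean, block, eval, Instr.apply, Mem.real_setReal_self,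
    Mem.real_setReal_of_ne, view_setReal_scratch, view_setReal_u]
  rfl

lemma view_newRun (m : Mem) : view p ((newRun p).eval m) = (view p m).newRun := by
  simp (disch := omega) only [newRun, block, eval, Instr.apply, Mem.nat_setNat_self,
    Mem.nat_setNat_of_ne, view_setNat_zero, view_setNat_j, view_setNat_m, view_setNat_s,
    view_setNat_s0, view_setReal_v, view_setReal_r, Nat.cast_zero, Nat.cast_one, add_zero]
  rfl

lemma view_show (m : Mem) : view p ((show_ p).eval m) = (view p m).show_ := by
  refine view_each State.arm (fun f τ => { τ with arm := f }) State.point (fun _ _ _ => rfl)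
    (fun _ _ => rfl) (fun _ => rfl) (fun _ _ _ _ => rfl) (fun i m => ?_) m
  have hi := i.2
  simp (disch := (try simp only [lo, Adaptive.hi, alo, ahi, best, arrLo, arrHi]) <;> omega)
    only [block,
    eval, eval_select, eval_copy, Instr.apply, Test.holds, Mem.nat_setNat_self,
    Mem.nat_setNat_of_ne, Mem.real_setReal_self, Mem.real_setReal_of_ne, Mem.nat_setReal,
    Mem.real_setNat, view_setNat_zero, view_setNat_nine, view_setReal_scratch,
    view_setReal_scratch', view_setReal_arm, Nat.cast_zero, Nat.cast_one]
  congr 2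
  simp only [State.point, min_def_lt, max_def_lt]
  rfl

lemma view_absorb (m : Mem) : view p ((absorb p).eval m) = (view p m).absorb := by
  have key := view_each (p := p) (c := fun i =>
      seq (block [.realSub (p + 5) (hi p i) (lo p i), .realOfNat (p + 6) 1,
        .realDiv (p + 5) (p + 5) (p + 6), .realAdd (p + 5) (p + 5) i, .natConst 9 0]) <|
      seq (select (.natEq 7 9) (alo p i) i) <|
      seq (select (.natEq 7 9) (ahi p i) (p + 5)) <|
      seq (select (.realLt i (alo p i)) (alo p i) i)
        (select (.realLt (ahi p i) (p + 5)) (ahi p i) (p + 5)))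
    (fun τ i => (τ.alo i, τ.ahi i))
    (fun f τ => { τ with alo := fun i => (f i).1, ahi := fun i => (f i).2 })
    (fun τ i => (τ.absorb.alo i, τ.absorb.ahi i)) (fun _ _ _ => rfl) (fun _ _ => rfl)
    (fun _ => rfl) (fun f τ i h => by simp [State.absorb, h]) (fun i m => ?_) m
  · rw [absorb, eval]
    refine (view_setNat_flag _ 1).trans ?_
    rw [key]
    rfl
  have hi := i.2
  simp (disch := (try simp only [lo, Adaptive.hi, alo, ahi, best, arrLo, arrHi]) <;> omega)
    only [block,
    eval, eval_select, Instr.apply, Test.holds, Mem.nat_setNat_self, Mem.nat_setNat_of_ne,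
    Mem.real_setReal_self, Mem.real_setReal_of_ne, Mem.nat_setReal, Mem.real_setNat,
    view_setNat_zero, view_setNat_nine, view_setReal_scratch, view_setReal_scratch',
    view_setReal_alo, view_setReal_ahi, Function.update_idem]
  simp only [fst_update_pair, snd_update_pair, State.absorb, min_def_lt, max_def_lt]
  rfl

lemma view_survive (m : Mem) : view p ((survive p).eval m) = (view p m).survive := by
  simp (disch := omega) only [survive, State.survive, block, eval, Instr.apply, Test.holds,
    Mem.real_setReal_self, Mem.real_setReal_of_ne, view_setReal_scratch, apply_ite (view p),
    view_absorb]
  rfl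

lemma view_record (m : Mem) : view p ((record p).eval m) = (view p m).record := by
  have key := view_each (p := p) (c := fun i => copy (best p i) i) State.best
    (fun f τ => { τ with best := f }) State.arm (fun _ _ _ => rfl)
    (fun _ _ => rfl) (fun _ => rfl) (fun _ _ _ _ => rfl) (fun i m => by
      simp only [eval_copy, view_setNat_zero, view_setReal_best]; rfl)
  simp (disch := omega) only [record, State.record, block, eval, eval_copy, Instr.apply,
    Test.holds, Mem.real_setReal_self, Mem.real_setReal_of_ne, view_setNat_zero,
    view_setReal_scratch, apply_ite (view p), key, view_setReal_v]
  rfl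

lemma view_recommend (m : Mem) :
    view p ((ifte (.natEq 2 1) (each p fun i => copy (rcm p i) i) skip).eval m)
      = (view p m).recommend := by
  have key := view_each (p := p) (c := fun i => copy (rcm p i) i) State.rcm
    (fun f τ => { τ with rcm := f }) State.arm (fun _ _ _ => rfl)
    (fun _ _ => rfl) (fun _ => rfl) (fun _ _ _ _ => rfl) (fun i m => by
      simp only [eval_copy, view_setNat_zero, view_setReal_rcm]; rfl)
  exact view_ifte Iff.rfl (key m) rfl

lemma view_newPhase (m : Mem) : view p ((newPhase p).eval m) = (view p m).phaseEnd := by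
  simp (disch := omega) only [newPhase, State.phaseEnd, block, eval, Instr.apply, Test.holds,
    Mem.nat_setNat_self, Mem.nat_setNat_of_ne, Mem.real_setReal_self, Mem.real_setReal_of_ne,
    Mem.nat_setReal, Mem.real_setNat, view_setNat_zero, view_setReal_scratch, view_setNat_s,
    view_setNat_k, view_setNat_m, view_setReal_r, apply_ite (view p), view_newRun, Nat.cast_ofNat]
  rfl

lemma view_close (m : Mem) : view p ((close p).eval m) = (view p m).close := by
  have h1 := view_each (p := p) (c := fun i =>
      seq (copy (alo p i) (best p i)) (copy (ahi p i) (best p i)))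
    (fun τ i => (τ.alo i, τ.ahi i))
    (fun f τ => { τ with alo := fun i => (f i).1, ahi := fun i => (f i).2 })
    (fun τ i => (τ.best i, τ.best i)) (fun _ _ _ => rfl) (fun _ _ => rfl)
    (fun _ => rfl) (fun f τ i h => rfl) (fun i m => by
      have hi := i.2
      simp (disch := (try simp only [lo, Adaptive.hi, alo, ahi, best, arrLo, arrHi]) <;> omega)
        only [eval,
        eval_copy, Mem.real_setReal_of_ne, Mem.real_setNat, view_setNat_zero, view_setReal_alo,
        view_setReal_ahi]
      simp only [fst_update_pair, snd_update_pair]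
      rfl)
  have h2 := view_each (p := p) (c := fun i =>
      seq (seq (address p (arrLo p i)) (block [.realStore 0 (alo p i)]))
        (seq (address p (arrHi p i)) (block [.realStore 0 (ahi p i)])))
    (fun τ i => (τ.arrLo τ.k i, τ.arrHi τ.k i))
    (fun f τ => { τ with
      arrLo := Function.update τ.arrLo τ.k fun i => (f i).1
      arrHi := Function.update τ.arrHi τ.k fun i => (f i).2 })
    (fun τ i => (τ.alo i, τ.ahi i)) (fun _ _ _ => by simp) (fun _ _ => by simp)
    (fun _ => by simp) (fun f τ i h => rfl) (fun i m => by
      have hi := i.2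
      simp (disch := (try simp only [lo, Adaptive.hi, alo, ahi, best, arrLo, arrHi]) <;> omega)
        only [block,
        eval, eval_address, Instr.apply, Mem.nat_setNat_self, Mem.nat_setNat_of_ne,
        Mem.real_setReal_of_ne, Mem.nat_setReal, Mem.real_setNat, view_setNat_zero,
        view_setReal_arrLo, view_setReal_arrHi]
      simp only [fst_update_pair, snd_update_pair]
      rfl)
  have h3 : view p ((seq (block [.natConst 9 0]) (ifte (.natEq 7 9)
      (each p fun i => seq (copy (alo p i) (best p i)) (copy (ahi p i) (best p i))) skip)).eval m)
      = { view p m with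
          alo := if (view p m).flag = 0 then (view p m).best else (view p m).alo
          ahi := if (view p m).flag = 0 then (view p m).best else (view p m).ahi } := by
    rw [eval]
    refine (view_ifte (q := (view p m).flag = 0) ?_ (h1 _) rfl).trans ?_
    · simp (disch := omega) only [block, eval, Instr.apply, Test.holds, Mem.nat_setNat_self,
        Mem.nat_setNat_of_ne]
      rfl
    · simp only [block, eval, Instr.apply, view_setNat_nine]
      split_ifs <;> rfl
  rw [show (close p).eval m = (block [.natConst 7 0, .natConst 0 1, .natAdd 6 6 0]).eval
    ((each p fun i =>
      seq (seq (address p (arrLo p i)) (block [.realStore 0 (alo p i)]))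
        (seq (address p (arrHi p i)) (block [.realStore 0 (ahi p i)]))).eval
      ((seq (block [.natConst 9 0]) (ifte (.natEq 7 9)
        (each p fun i => seq (copy (alo p i) (best p i)) (copy (ahi p i) (best p i)))
        skip)).eval m)) from rfl]
  generalize (seq (block [.natConst 9 0]) (ifte (.natEq 7 9) _ skip)).eval m = m₁ at h3 ⊢
  have h4 := h2 m₁
  rw [h3] at h4
  generalize (each p _).eval m₁ = m₂ at h4 ⊢
  have h5 : view p ((block [.natConst 7 0, .natConst 0 1, .natAdd 6 6 0]).eval m₂)
      = { view p m₂ with flag := 0, k := (view p m₂).k + 1 } := by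
    simp (disch := omega) only [block, eval, Instr.apply, Mem.nat_setNat_self,
      Mem.nat_setNat_of_ne, view_setNat_zero, view_setNat_flag, view_setNat_k]
    rfl
  rw [h5, h4]
  rfl

lemma view_load (m : Mem) : view p ((load p).eval m) = (view p m).load := by
  have h1 := view_each (p := p) (c := fun i => block
      [.realOfNat (lo p i) (11 + 2 * i), .natConst 0 1,
      .natAdd 0 0 (11 + 2 * i), .realOfNat (hi p i) 0, .realOfNat (p + 5) 1,
      .realDiv (lo p i) (lo p i) (p + 5), .realDiv (hi p i) (hi p i) (p + 5)])
    (fun τ i => (τ.lo i, τ.hi i))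
    (fun f τ => { τ with lo := fun i => (f i).1, hi := fun i => (f i).2 })
    (fun τ i => ((τ.bd i / τ.j : ℝ), ((1 + τ.bd i : ℕ) / τ.j : ℝ)))
    (fun _ _ _ => rfl) (fun _ _ => rfl) (fun _ => rfl) (fun f τ i h => rfl) (fun i m => by
      have hi := i.2
      simp (disch := (try simp only [lo, Adaptive.hi, alo, ahi, best, arrLo, arrHi]) <;> omega)
        only [block,
        eval, Instr.apply, Mem.nat_setNat_self, Mem.nat_setNat_of_ne, Mem.real_setReal_self,
        Mem.real_setReal_of_ne, Mem.nat_setReal, Mem.real_setNat, view_setNat_zero,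
        view_setReal_scratch, view_setReal_lo, view_setReal_hi, Function.update_idem]
      simp only [fst_update_pair, snd_update_pair]
      rfl)
  have h2 := view_each (p := p) (c := fun i =>
      seq (seq (address p (arrLo p i)) (block [.realLoad (lo p i) 0]))
        (seq (address p (arrHi p i)) (block [.realLoad (hi p i) 0])))
    (fun τ i => (τ.lo i, τ.hi i))
    (fun f τ => { τ with lo := fun i => (f i).1, hi := fun i => (f i).2 })
    (fun τ i => (τ.arrLo τ.k i, τ.arrHi τ.k i))
    (fun _ _ _ => rfl) (fun _ _ => rfl) (fun _ => rfl) (fun f τ i h => rfl) (fun i m => by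
      have hi := i.2
      simp (disch := (try simp only [lo, Adaptive.hi, alo, ahi, best, arrLo, arrHi]) <;> omega)
        only [block,
        eval, eval_address, Instr.apply, Mem.nat_setNat_self, Mem.nat_setNat_of_ne,
        Mem.real_setReal_of_ne, Mem.nat_setReal, Mem.real_setNat, view_setNat_zero,
        view_setReal_lo, view_setReal_hi]
      simp only [fst_update_pair, snd_update_pair]
      rfl)
  rw [load, eval]
  refine (view_ifte (q := (view p m).m = 0) ?_ (h1 _) (h2 _)).trans ?_
  · simp (disch := omega) only [block, eval, Instr.apply, Test.holds, Mem.nat_setNat_self,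
      Mem.nat_setNat_of_ne]
    rfl
  · simp only [block, eval, Instr.apply, view_setNat_nine]
    rfl

lemma view_nextCell (m : Mem) :
    view p ((advance p fun i => 10 + 2 * i).eval m) = (view p m).nextCell := by
  have key : ∀ n m, (view p m).carry = 1 → view p ((each n fun i =>
      seq (block [.natAdd (10 + 2 * i) (10 + 2 * i) 8]) <|
        ifte (.natLt (10 + 2 * i) 1) (block [.natConst 8 0])
          (block [.natConst (10 + 2 * i) 0])).eval m)
      = { view p m with
          cd := (State.succDigits (view p m).j (view p m).cd n).1
          carry := (State.succDigits (view p m).j (view p m).cd n).2 } := by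
    intro n m hm
    induction n with
    | zero => simp [each, eval, State.succDigits, ← hm]
    | succ n ih =>
      rw [each, eval]
      generalize (each n _).eval m = m' at ih ⊢
      rw [eval]
      refine (view_ifte (q := (view p m').cd n + (view p m').carry < (view p m').j) ?_
        (τ₁ := { view p m' with
          cd := Function.update (view p m').cd n ((view p m').cd n + (view p m').carry)
          carry := 0 })
        (τ₂ := { view p m' with cd := Function.update (view p m').cd n 0 }) ?_ ?_).trans ?_
      · simp (disch := omega) only [block, eval, Instr.apply, Test.holds, Mem.nat_setNat_self,
          Mem.nat_setNat_of_ne]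
        rfl
      · simp (disch := omega) only [block, eval, Instr.apply, view_setNat_cd, view_setNat_carry]
        rfl
      · simp (disch := omega) only [block, eval, Instr.apply, view_setNat_cd, Function.update_idem]
      · rw [ih]
        simp only [State.succDigits]
        split_ifs <;> rfl
  rw [advance, eval, key _ _ (by simp [block, eval, Instr.apply, view, Mem.nat_setNat_self])]
  simp only [block, eval, Instr.apply, view_setNat_carry]
  rfl

lemma view_nextBox (m : Mem) :
    view p ((advance p fun i => 11 + 2 * i).eval m) = (view p m).nextBox := by
  have key : ∀ n m, (view p m).carry = 1 → view p ((each n fun i =>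
      seq (block [.natAdd (11 + 2 * i) (11 + 2 * i) 8]) <|
        ifte (.natLt (11 + 2 * i) 1) (block [.natConst 8 0])
          (block [.natConst (11 + 2 * i) 0])).eval m)
      = { view p m with
          bd := (State.succDigits (view p m).j (view p m).bd n).1
          carry := (State.succDigits (view p m).j (view p m).bd n).2 } := by
    intro n m hm
    induction n with
    | zero => simp [each, eval, State.succDigits, ← hm]
    | succ n ih =>
      rw [each, eval]
      generalize (each n _).eval m = m' at ih ⊢
      rw [eval]
      refine (view_ifte (q := (view p m').bd n + (view p m').carry < (view p m').j) ?_
        (τ₁ := { view p m' with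
          bd := Function.update (view p m').bd n ((view p m').bd n + (view p m').carry)
          carry := 0 })
        (τ₂ := { view p m' with bd := Function.update (view p m').bd n 0 }) ?_ ?_).trans ?_
      · simp (disch := omega) only [block, eval, Instr.apply, Test.holds, Mem.nat_setNat_self,
          Mem.nat_setNat_of_ne]
        rfl
      · simp (disch := omega) only [block, eval, Instr.apply, view_setNat_bd, view_setNat_carry]
        rfl
      · simp (disch := omega) only [block, eval, Instr.apply, view_setNat_bd, Function.update_idem]
      · rw [ih]
        simp only [State.succDigits]
        split_ifs <;> rfl
  rw [advance, eval, key _ _ (by simp [block, eval, Instr.apply, view, Mem.nat_setNat_self])]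
  simp only [block, eval, Instr.apply, view_setNat_carry]
  rfl

lemma view_boxEnd (m : Mem) : view p ((boxEnd p).eval m) = (view p m).boxEnd := by
  rw [boxEnd, eval, eval, eval, eval, view_load]
  have h : view p ((block [.natConst 9 0]).eval
      ((advance p fun i => 11 + 2 * i).eval ((close p).eval m))) = (view p m).close.nextBox := by
    simp only [block, eval, Instr.apply, view_setNat_nine, view_nextBox, view_close]
  rw [view_ifte (q := 0 < (view p m).close.nextBox.carry) ?_ (view_newPhase _) rfl]
  · simp only [h, eval, State.boxEnd]
    split_ifs <;> rfl
  · rw [← h]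
    simp (disch := omega) only [block, eval, Instr.apply, Test.holds, Mem.nat_setNat_self, view]

lemma view_cellEnd (m : Mem) : view p ((cellEnd p).eval m) = (view p m).cellEnd := by
  rw [cellEnd, eval, eval, eval, eval, eval, eval]
  set m' := (block [.natConst 9 0]).eval ((advance p fun i => 10 + 2 * i).eval
    ((block [.natConst 4 0, .realOfNat (p + 1) 4]).eval
      ((record p).eval ((survive p).eval ((mean p).eval m))))) with hm'
  have h : view p m' = (view p m).scan.nextCell := by
    simp (disch := omega) only [hm', block, eval, Instr.apply, view_setNat_nine, view_nextCell,
      view_setNat_cnt, view_setReal_sum, Mem.nat_setNat_self, view_record, view_survive,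
      view_mean, Nat.cast_zero]
    rfl
  refine (view_ifte (q := 0 < (view p m').carry) ?_ (view_boxEnd _) rfl).trans ?_
  · simp (disch := omega) only [hm', block, eval, Instr.apply, Test.holds, Mem.nat_setNat_self,
      view]
  · rw [eval, h]
    rfl

lemma view_update (m : Mem) : view p ((update p).eval m) = (view p m).update := by
  rw [update, eval]
  have h9 : view p ((block [.natConst 9 0]).eval m) = view p m := view_setNat_nine m 0
  refine (view_ifte (q := (view p m).j = 0) ?_ (τ₁ := (view p m).newRun.load) ?_
    (τ₂ := if (view p m).tick.cnt < (view p m).s then (view p m).tick else (view p m).tick.cellEnd)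
    ?_).trans rfl
  · simp (disch := omega) only [block, eval, Instr.apply, Test.holds, Mem.nat_setNat_self,
      Mem.nat_setNat_of_ne]
    rfl
  · rw [eval, view_load, view_newRun, h9]
  · rw [eval]
    refine view_ifte ?_ ?_ ?_
    · rw [← h9, ← view_tick]; rfl
    · rw [eval, view_tick, h9]
    · rw [view_cellEnd, view_tick, h9]

/-- The program implements the algorithm. -/
theorem view_play (m : Mem) : view p ((play p).eval m) = (view p m).next := by
  rw [play, eval, eval, view_recommend, view_show, view_update]
  rfl

lemma real_recommend (m : Mem) (i : Fin p) :
    ((each p fun i => copy i (rcm p i)).eval m).real i = (view p m).rcm i := by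
  have key := view_each (p := p) (c := fun i => copy i (rcm p i)) State.arm
    (fun f τ => { τ with arm := f }) State.rcm (fun _ _ _ => rfl)
    (fun _ _ => rfl) (fun _ => rfl) (fun _ _ _ _ => rfl) (fun i m => by
      simp only [eval_copy, view_setNat_zero, view_setReal_arm]; rfl) m
  exact congrFun (congrArg State.arm key) i

end Adaptive

end RealRAM

namespace RealRAM

namespace Adaptive

/-! ### Odometers -/

/-- The number with the `n` digits `d 0, …, d (n - 1)` to base `j`. -/
def number (j n : ℕ) (d : ℕ → ℕ) : ℕ := ∑ i ∈ Finset.range n, d i * j ^ i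

lemma number_succ (j n : ℕ) (d : ℕ → ℕ) : number j (n + 1) d = number j n d + d n * j ^ n :=
  Finset.sum_range_succ _ _

lemma number_congr {j n : ℕ} {d d' : ℕ → ℕ} (h : ∀ i < n, d i = d' i) :
    number j n d = number j n d' :=
  Finset.sum_congr rfl fun i hi => by rw [h i (Finset.mem_range.1 hi)]

lemma number_lt {j n : ℕ} {d : ℕ → ℕ} (h : ∀ i < n, d i < j) : number j n d < j ^ n := by
  induction n with
  | zero => simp [number]
  | succ n ih =>
    have h1 := ih fun i hi => h i (by omega)
    have h2 : (d n + 1) * j ^ n ≤ j * j ^ n := Nat.mul_le_mul_right _ (h n (by omega))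
    rw [number_succ, pow_succ']
    linarith

lemma number_inj {j n : ℕ} {d d' : ℕ → ℕ} (h : ∀ i < n, d i < j) (h' : ∀ i < n, d' i < j)
    (hd : number j n d = number j n d') : ∀ i < n, d i = d' i := by
  induction n with
  | zero => intro i hi; omega
  | succ n ih =>
    have h1 := number_lt fun i (hi : i < n) => h i (by omega)
    have h2 := number_lt fun i (hi : i < n) => h' i (by omega)
    rw [number_succ, number_succ] at hd
    have h3 : d n = d' n := by
      have := congrArg (· / j ^ n) hd
      have h0 : 0 < j ^ n := by omega
      simpa [Nat.add_mul_div_right _ _ h0, Nat.div_eq_of_lt h1, Nat.div_eq_of_lt h2] using this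
    rw [h3] at hd
    have h4 := ih (fun i hi => h i (by omega)) (fun i hi => h' i (by omega)) (by omega)
    intro i hi
    rcases Nat.lt_succ_iff_lt_or_eq.1 hi with hi | rfl
    · exact h4 i hi
    · exact h3

open State in
lemma succDigits_of_le (j : ℕ) (d : ℕ → ℕ) {n i : ℕ} (hi : n ≤ i) :
    (succDigits j d n).1 i = d i := by
  induction n with
  | zero => rfl
  | succ n ih =>
    have h : i ≠ n := by omega
    simp only [succDigits]
    split_ifs <;> simp [Function.update_of_ne h, ih (by omega)]

open State in
/-- The odometer counts. -/
lemma succDigits_spec {j n : ℕ} {d : ℕ → ℕ} (h : ∀ i < n, d i < j) :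
    (∀ i < n, (succDigits j d n).1 i < j) ∧
      number j n (succDigits j d n).1 + (succDigits j d n).2 * j ^ n = number j n d + 1 ∧
      (succDigits j d n).2 ≤ 1 := by
  induction n with
  | zero => simp [succDigits, number]
  | succ n ih =>
    obtain ⟨h1, h2, h3⟩ := ih fun i hi => h i (by omega)
    have hn := succDigits_of_le j d (le_refl n)
    have hdn := h n (by omega)
    rw [number_succ, number_succ]
    simp only [succDigits]
    have hc : ∀ x, number j n (Function.update (succDigits j d n).1 n x)
        = number j n (succDigits j d n).1 := fun x =>
      number_congr fun i hi => Function.update_of_ne (by omega) _ _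
    split_ifs with hlt
    · refine ⟨fun i hi => ?_, ?_, by simp⟩
      · rcases Nat.lt_succ_iff_lt_or_eq.1 hi with hi | rfl
        · simp only [Function.update_of_ne (show i ≠ n by omega)]; exact h1 i hi
        · simpa only [Function.update_self] using hlt
      · simp only [hc, Function.update_self, hn]
        linarith
    · have hc1 : (succDigits j d n).2 = 1 := by omega
      have hj : d n + 1 = j := by omega
      refine ⟨fun i hi => ?_, ?_, h3⟩
      · rcases Nat.lt_succ_iff_lt_or_eq.1 hi with hi | rfl
        · simp only [Function.update_of_ne (show i ≠ n by omega)]; exact h1 i hi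
        · simp only [Function.update_self]; omega
      · simp only [hc, Function.update_self, hc1, pow_succ'] at h2 ⊢
        have : (d n + 1) * j ^ n = j * j ^ n := by rw [hj]
        linarith

open State in
lemma succDigits_cases {j n : ℕ} {d : ℕ → ℕ} (h : ∀ i < n, d i < j) :
    (number j n d + 1 < j ^ n ∧ (succDigits j d n).2 = 0 ∧
        number j n (succDigits j d n).1 = number j n d + 1) ∨
      (number j n d + 1 = j ^ n ∧ (succDigits j d n).2 = 1 ∧
        number j n (succDigits j d n).1 = 0) := by
  obtain ⟨h1, h2, h3⟩ := succDigits_spec h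
  have h4 := number_lt h1
  have h5 := number_lt h
  rcases Nat.le_one_iff_eq_zero_or_eq_one.1 h3 with h6 | h6 <;> rw [h6] at h2 ⊢
  · exact Or.inl ⟨by omega, rfl, by omega⟩
  · exact Or.inr ⟨by omega, rfl, by omega⟩

/-- Each point of an interval which is divided into `j` equal parts lies in one of them. -/
lemma exists_digit {j : ℕ} (hj : 1 ≤ j) {a b x : ℝ} (ha : a ≤ x) (hb : x ≤ b) :
    ∃ c < j, a + (b - a) * c / j ≤ x ∧ x ≤ (b - a) / j + (a + (b - a) * c / j) := by
  have hj0 : (0 : ℝ) < j := by exact_mod_cast hj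
  have hstep : ∀ c : ℕ, (b - a) / j + (a + (b - a) * c / j) = a + (b - a) * (c + 1 : ℕ) / j := by
    intro c; push_cast; ring
  have hex : ∃ c : ℕ, x ≤ (b - a) / j + (a + (b - a) * c / j) := by
    refine ⟨j - 1, ?_⟩
    rw [hstep, Nat.sub_add_cancel hj, mul_div_assoc, div_self hj0.ne']
    linarith
  classical
  refine ⟨Nat.find hex, ?_, ?_, Nat.find_spec hex⟩
  · have : Nat.find hex ≤ j - 1 := Nat.find_min' hex (by
      rw [hstep, Nat.sub_add_cancel hj, mul_div_assoc, div_self hj0.ne']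
      linarith)
    omega
  · rcases h : Nat.find hex with - | c
    · simpa using ha
    · have := Nat.find_min hex (m := c) (by omega)
      rw [hstep] at this
      exact (not_le.1 this).le

/-! ### The schedule -/

variable {p : ℕ}

/-- The number of samples per cell in the first phase of run `j`. -/
def samples (j : ℕ) : ℕ := ∑ i ∈ Finset.range (j + 1), i

/-- The total weight of phase `m` of run `j`, if each of its rounds has weight `w m`. -/
noncomputable def phaseWeight (p : ℕ) (w : ℕ → ℝ) (j m : ℕ) : ℝ :=
  (j : ℝ) ^ p * j ^ p * (samples j * 4 ^ m) * w m

/-- The total weight of the rounds before a state: the weight of the earlier runs, of the earlier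
phases of the run, of the earlier cells of the phase, and of the earlier samples of the cell. -/
noncomputable def clock (w : ℕ → ℝ) (τ : State p) : ℝ :=
  ∑ j ∈ Finset.range τ.j, ∑ m ∈ Finset.range (j + 1), phaseWeight p w j m
    + ∑ m ∈ Finset.range τ.m, phaseWeight p w τ.j m
    + (τ.k * (τ.j : ℝ) ^ p + number τ.j p τ.cd) * (τ.s * w τ.m) + τ.cnt * w τ.m

/-- The state is a possible state of the schedule. -/
structure Scheduled (τ : State p) : Prop where
  one_le : 1 ≤ τ.j
  m_le : τ.m ≤ τ.j
  s0_eq : τ.s0 = samples τ.j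
  s_eq : τ.s = samples τ.j * 4 ^ τ.m
  r_eq : τ.r = (1 / 2) ^ τ.m
  cnt_lt : τ.cnt < τ.s
  cd_lt : ∀ i < p, τ.cd i < τ.j
  bd_lt : ∀ i < p, τ.bd i < τ.j
  k_eq : τ.k = number τ.j p τ.bd

/-! The following equations name the fields which are changed by a step, so that all other fields
are unchanged by definition. -/

namespace State

lemma survive_eq (τ : State p) :
    ∃ a b fl, τ.survive = { τ with alo := a, ahi := b, flag := fl } := by
  unfold survive
  split_ifs
  · exact ⟨_, _, _, rfl⟩
  · exact ⟨_, _, _, rfl⟩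

lemma record_eq (τ : State p) : ∃ x a, τ.record = { τ with v := x, best := a } := by
  unfold record
  split_ifs
  · exact ⟨_, _, rfl⟩
  · exact ⟨_, _, rfl⟩

lemma scan_eq (τ : State p) : ∃ a b fl y x c, τ.scan = { τ with
    alo := a, ahi := b, flag := fl, u := y, v := x, best := c, cnt := 0, sum := 0 } := by
  obtain ⟨a, b, fl, h⟩ := τ.mean.survive_eq
  obtain ⟨x, c, h'⟩ := (τ.mean.survive).record_eq
  exact ⟨a, b, fl, τ.sum / τ.s, x, c, by rw [scan, h', h]; rfl⟩

lemma load_eq (τ : State p) : ∃ a b, τ.load = { τ with lo := a, hi := b } := by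
  unfold load
  split_ifs
  · exact ⟨_, _, rfl⟩
  · exact ⟨_, _, rfl⟩

lemma recommend_eq (τ : State p) : ∃ a, τ.recommend = { τ with rcm := a } := by
  unfold recommend
  split_ifs
  · exact ⟨_, rfl⟩
  · exact ⟨_, rfl⟩

end State

/-- The possible continuations after a reward: the same cell, the next cell, the next box, the next
phase, or the next run. -/
lemma Scheduled.update_cases {τ : State p} (h : Scheduled τ) :
    (τ.cnt + 1 < τ.s ∧ τ.update = τ.tick) ∨ (τ.cnt + 1 = τ.s ∧
      ((number τ.j p τ.cd + 1 < τ.j ^ p ∧ τ.update = τ.tick.scan.nextCell) ∨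
      (number τ.j p τ.cd + 1 = τ.j ^ p ∧
        ((τ.k + 1 < τ.j ^ p ∧ τ.update = τ.tick.scan.nextCell.close.nextBox.load) ∨
        (τ.k + 1 = τ.j ^ p ∧
          ((τ.m < τ.j ∧ τ.update = τ.tick.scan.nextCell.close.nextBox.newPhase.load) ∨
          (τ.m = τ.j ∧
            τ.update = τ.tick.scan.nextCell.close.nextBox.newPhase.newRun.load))))))) := by
  have hj : τ.j ≠ 0 := by have := h.one_le; omega
  obtain ⟨a, b, fl, y, x, c, hs⟩ := τ.tick.scan_eq
  have hcd : τ.tick.scan.nextCell.carry = (State.succDigits τ.j τ.cd p).2 := by rw [hs]; rfl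
  have hbd : τ.tick.scan.nextCell.close.nextBox.carry = (State.succDigits τ.j τ.bd p).2 := by
    rw [hs]; rfl
  have hpj : τ.tick.scan.nextCell.close.nextBox.newPhase.j = τ.j := by rw [hs]; rfl
  have hpm : τ.tick.scan.nextCell.close.nextBox.newPhase.m = τ.m + 1 := by rw [hs]; rfl
  have hcnt : τ.tick.cnt = τ.cnt + 1 := rfl
  have hlt := h.cnt_lt
  simp only [State.update, if_neg hj, hcnt, State.cellEnd, State.boxEnd, hcd, hbd, State.phaseEnd,
    hpj, hpm]
  by_cases h1 : τ.cnt + 1 < τ.s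
  · exact Or.inl ⟨h1, if_pos h1⟩
  refine Or.inr ⟨by omega, ?_⟩
  rw [if_neg h1]
  rcases succDigits_cases h.cd_lt with ⟨h2, h3, -⟩ | ⟨h2, h3, -⟩
  · exact Or.inl ⟨h2, by simp [h3]⟩
  refine Or.inr ⟨h2, ?_⟩
  rw [h3, if_pos one_pos]
  rcases succDigits_cases h.bd_lt with ⟨h4, h5, -⟩ | ⟨h4, h5, -⟩ <;> rw [← h.k_eq] at h4
  · exact Or.inl ⟨h4, by simp [h5]⟩
  refine Or.inr ⟨h4, ?_⟩
  rw [h5, if_pos one_pos]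
  rcases h.m_le.lt_or_eq with h6 | h6
  · exact Or.inl ⟨h6, by rw [if_neg (by omega)]⟩
  · exact Or.inr ⟨h6, by rw [if_pos (by omega)]⟩

lemma samples_pos {j : ℕ} (hj : 1 ≤ j) : 0 < samples j := by
  refine hj.trans ?_
  exact Finset.single_le_sum (f := fun i => i) (fun _ _ => Nat.zero_le _)
    (Finset.mem_range.2 (Nat.lt_succ_self j))

lemma samples_succ (j : ℕ) : samples (j + 1) = samples j + (j + 1) := Finset.sum_range_succ _ _

/-- A reward keeps the state scheduled and advances the clock by the weight of the phase. -/
lemma Scheduled.update {τ : State p} (h : Scheduled τ) :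
    Scheduled τ.update ∧ ∀ w, clock w τ.update = clock w τ + w τ.m := by
  obtain ⟨a, b, fl, y, x, c, hs⟩ := τ.tick.scan_eq
  obtain ⟨hc1, -, -⟩ := succDigits_spec h.cd_lt
  obtain ⟨hb1, -, -⟩ := succDigits_spec h.bd_lt
  have hc := succDigits_cases h.cd_lt
  have hb := succDigits_cases h.bd_lt
  have hk := h.k_eq
  have hspos : 0 < τ.s := by have := h.cnt_lt; omega
  have hs0 := h.s0_eq
  rcases h.update_cases with ⟨h1, e⟩ | ⟨h1, ⟨h2, e⟩ | ⟨h2, ⟨h3, e⟩ | ⟨h3, ⟨h4, e⟩ | ⟨h4, e⟩⟩⟩⟩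
  · rw [e]
    refine ⟨⟨h.one_le, h.m_le, h.s0_eq, h.s_eq, h.r_eq, h1, h.cd_lt, h.bd_lt, h.k_eq⟩,
      fun w => ?_⟩
    simp only [clock, State.tick]
    push_cast; ring
  · rw [e, hs]
    have hq : number τ.j p (State.succDigits τ.j τ.cd p).1 = number τ.j p τ.cd + 1 := by omega
    refine ⟨⟨h.one_le, h.m_le, h.s0_eq, h.s_eq, h.r_eq, hspos, hc1, h.bd_lt, h.k_eq⟩,
      fun w => ?_⟩
    simp only [clock, State.tick, State.nextCell, hq, ← h1]
    push_cast; ring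
  all_goals
    have h2' : (number τ.j p τ.cd : ℝ) = (τ.j : ℝ) ^ p - 1 := by
      rw [eq_sub_iff_add_eq]; exact_mod_cast h2
    have hq : number τ.j p (State.succDigits τ.j τ.cd p).1 = 0 := by omega
    have h1' : (τ.cnt : ℝ) = τ.s - 1 := by rw [eq_sub_iff_add_eq]; exact_mod_cast h1
  · obtain ⟨l, l', hl⟩ := (τ.tick.scan.nextCell.close.nextBox).load_eq
    rw [e, hl, hs]
    refine ⟨⟨h.one_le, h.m_le, h.s0_eq, h.s_eq, h.r_eq, hspos, hc1, hb1, ?_⟩, fun w => ?_⟩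
    · simp only [State.tick, State.nextCell, State.close, State.nextBox]; omega
    · simp only [clock, State.tick, State.nextCell, State.close, State.nextBox, hq, h2', h1']
      push_cast; ring
  all_goals
    have h3' : (τ.k : ℝ) = (τ.j : ℝ) ^ p - 1 := by
      rw [eq_sub_iff_add_eq]; exact_mod_cast h3
    have hs' := h.s_eq
  · obtain ⟨l, l', hl⟩ := (τ.tick.scan.nextCell.close.nextBox.newPhase).load_eq
    rw [e, hl, hs]
    refine ⟨⟨h.one_le, h4, h.s0_eq, ?_, ?_, ?_, hc1, hb1, ?_⟩, fun w => ?_⟩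
    · simp only [State.tick, State.nextCell, State.close, State.nextBox, State.newPhase, pow_succ]
      rw [hs']; ring
    · simp only [State.tick, State.nextCell, State.close, State.nextBox, State.newPhase, pow_succ]
      rw [h.r_eq]; ring
    · simp only [State.tick, State.nextCell, State.close, State.nextBox, State.newPhase]; omega
    · simp only [State.tick, State.nextCell, State.close, State.nextBox, State.newPhase]; omega
    · simp only [clock, State.tick, State.nextCell, State.close, State.nextBox, State.newPhase, hq,
        h2', h1', h3', Finset.sum_range_succ, phaseWeight, hs']
      push_cast; ring
  · obtain ⟨l, l', hl⟩ := (τ.tick.scan.nextCell.close.nextBox.newPhase.newRun).load_eq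
    rw [e, hl, hs]
    have hss := samples_succ τ.j
    refine ⟨⟨Nat.succ_pos _, Nat.zero_le _, ?_, ?_, ?_, ?_, ?_, ?_, ?_⟩, fun w => ?_⟩
    all_goals simp only [State.tick, State.nextCell, State.close, State.nextBox, State.newPhase,
      State.newRun]
    · omega
    · rw [hss, hs0, pow_zero, mul_one]
    · simp
    · omega
    · exact fun i hi => (hc1 i hi).trans (Nat.lt_succ_self _)
    · exact fun i hi => (hb1 i hi).trans (Nat.lt_succ_self _)
    · have : ∀ i < p, (State.succDigits τ.j τ.bd p).1 i = 0 := by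
        refine number_inj (j := τ.j) hb1 (fun i hi => h.one_le) ?_
        rw [show number τ.j p (fun _ => 0) = 0 by simp [number]]
        omega
      rw [number_congr this]
      simp [number]
    · -- at the end of a run the digits are zero, so their number does not depend on the base
      have hcd : ∀ i < p, (State.succDigits τ.j τ.cd p).1 i = 0 := by
        refine number_inj (j := τ.j) hc1 (fun i hi => h.one_le) ?_
        rw [show number τ.j p (fun _ => 0) = 0 by simp [number]]
        omega
      have hz : number (τ.j + 1) p (State.succDigits τ.j τ.cd p).1 = 0 := by
        rw [number_congr hcd]; simp [number]
      simp only [clock, hz, Finset.sum_range_succ, Finset.sum_range_zero,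
        h2', h1', h3', phaseWeight, hs', h4]
      push_cast; ring

lemma Scheduled.next {τ : State p} (h : Scheduled τ) :
    Scheduled τ.next ∧ ∀ w, clock w τ.next = clock w τ + w τ.m := by
  obtain ⟨h1, h2⟩ := h.update
  obtain ⟨a, ha⟩ := τ.update.show_.recommend_eq
  rw [State.next, ha]
  exact ⟨⟨h1.one_le, h1.m_le, h1.s0_eq, h1.s_eq, h1.r_eq, h1.cnt_lt, h1.cd_lt, h1.bd_lt, h1.k_eq⟩,
    h2⟩

end Adaptive

end RealRAM

namespace RealRAM

namespace Adaptive

open Cube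

variable {p : ℕ}

/-! ### The boxes of a good run -/

/-- The regret is at most `ρ` on the box. -/
structure GoodBox (f : Cube p → ℝ) (j : ℕ) (ρ : ℝ) (lo hi : Fin p → ℝ) : Prop where
  isBox : IsBox j lo hi
  gap_le : ∀ x ∈ Set.Icc lo hi, gap f x ≤ ρ

/-- The points `a`, `b` are the corners of a part of a box, each of whose faces contains a point of
regret at most `ρ`. -/
structure GoodHull (f : Cube p → ℝ) (ρ : ℝ) (lo hi a b : Fin p → ℝ) : Prop where
  lo_le : lo ≤ a
  le : a ≤ b
  le_hi : b ≤ hi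
  face : ∀ i, (∃ y ∈ Set.Icc a b, y i = a i ∧ gap f y ≤ ρ) ∧
    ∃ y ∈ Set.Icc a b, y i = b i ∧ gap f y ≤ ρ

/-- The hull of the union of two good hulls is good. -/
lemma GoodHull.union {f : Cube p → ℝ} {ρ : ℝ} {lo hi a b a' b' : Fin p → ℝ}
    (h : GoodHull f ρ lo hi a b) (h' : GoodHull f ρ lo hi a' b') :
    GoodHull f ρ lo hi (a ⊓ a') (b ⊔ b') where
  lo_le := le_inf h.lo_le h'.lo_le
  le := (inf_le_left.trans h.le).trans le_sup_left
  le_hi := sup_le h.le_hi h'.le_hi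
  face i := by
    have s : Set.Icc a b ⊆ Set.Icc (a ⊓ a') (b ⊔ b') := Set.Icc_subset_Icc inf_le_left le_sup_left
    have s' : Set.Icc a' b' ⊆ Set.Icc (a ⊓ a') (b ⊔ b') :=
      Set.Icc_subset_Icc inf_le_right le_sup_right
    obtain ⟨⟨y, hy, hyi, hyg⟩, z, hz, hzi, hzg⟩ := h.face i
    obtain ⟨⟨y', hy', hyi', hyg'⟩, z', hz', hzi', hzg'⟩ := h'.face i
    constructor
    · rcases le_total (a i) (a' i) with hle | hle
      · exact ⟨y, s hy, by simp [hyi, hle], hyg⟩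
      · exact ⟨y', s' hy', by simp [hyi', hle], hyg'⟩
    · rcases le_total (b i) (b' i) with hle | hle
      · exact ⟨z', s' hz', by simp [hzi', hle], hzg'⟩
      · exact ⟨z, s hz, by simp [hzi, hle], hzg⟩

/-- The lower corner of the cell with digits `d`. -/
noncomputable def cellLo (j : ℕ) (lo hi : Fin p → ℝ) (d : ℕ → ℕ) (i : Fin p) : ℝ :=
  lo i + (hi i - lo i) * d i / j

/-- The upper corner of the cell with digits `d`. -/
noncomputable def cellHi (j : ℕ) (lo hi : Fin p → ℝ) (d : ℕ → ℕ) (i : Fin p) : ℝ :=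
  (hi i - lo i) / j + cellLo j lo hi d i

/-- The lower corner of the box of the grid with digits `d`. -/
noncomputable def gridLo (j : ℕ) (d : ℕ → ℕ) (i : Fin p) : ℝ := d i / j

/-- The upper corner of the box of the grid with digits `d`. -/
noncomputable def gridHi (j : ℕ) (d : ℕ → ℕ) (i : Fin p) : ℝ := (1 + d i : ℕ) / j

/-- Each point of a box lies in one of its cells. -/
lemma exists_cell {j : ℕ} (hj : 1 ≤ j) {lo hi x : Fin p → ℝ} (hx : x ∈ Set.Icc lo hi) :
    ∃ d : ℕ → ℕ, (∀ i < p, d i < j) ∧ x ∈ Set.Icc (cellLo j lo hi d) (cellHi j lo hi d) := by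
  choose c hc h1 h2 using fun i => exists_digit hj (hx.1 i) (hx.2 i)
  refine ⟨fun i => if h : i < p then c ⟨i, h⟩ else 0, fun i hi => by simpa [hi] using hc _,
    fun i => ?_, fun i => ?_⟩
  · simpa [cellLo] using h1 i
  · simpa [cellHi, cellLo] using h2 i

/-- Each point of the cube lies in one of the boxes of the grid. -/
lemma exists_grid {j : ℕ} (hj : 1 ≤ j) {x : Fin p → ℝ} (hx : x ∈ Set.Icc (0 : Fin p → ℝ) 1) :
    ∃ d : ℕ → ℕ, (∀ i < p, d i < j) ∧ x ∈ Set.Icc (gridLo j d) (gridHi j d) := by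
  obtain ⟨d, hd, h1, h2⟩ := exists_cell hj hx
  refine ⟨d, hd, fun i => ?_, fun i => ?_⟩
  · simpa [cellLo, gridLo] using h1 i
  · have := h2 i
    simp only [cellHi, cellLo, Pi.one_apply, Pi.zero_apply] at this
    simp only [gridHi]
    refine this.trans (le_of_eq ?_)
    push_cast
    ring

lemma isBox_grid {j : ℕ} (hj : 1 ≤ j) {d : ℕ → ℕ} (hd : ∀ i < p, d i < j) :
    IsBox (p := p) j (gridLo j d) (gridHi j d) := by
  intro i
  have hj0 : (0 : ℝ) < j := by exact_mod_cast hj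
  have := hd i i.2
  simp only [gridLo, gridHi]
  refine ⟨by positivity, by gcongr; omega, ?_, ?_⟩
  · rw [div_le_one hj0]; exact_mod_cast (by omega : 1 + d i ≤ j)
  · rw [← sub_div]; gcongr; push_cast; linarith

section Cell

variable {j : ℕ} {lo hi : Fin p → ℝ} {d : ℕ → ℕ}

lemma cellLo_le_cellHi (hle : lo ≤ hi) : cellLo j lo hi d ≤ cellHi j lo hi d := fun i => by
  have := div_nonneg (sub_nonneg.2 (hle i)) (Nat.cast_nonneg (α := ℝ) j)
  simp only [cellHi]; linarith

lemma le_cellLo (hle : lo ≤ hi) : lo ≤ cellLo j lo hi d := fun i => by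
  have : 0 ≤ (hi i - lo i) * d i / j :=
    div_nonneg (mul_nonneg (sub_nonneg.2 (hle i)) (Nat.cast_nonneg _)) (Nat.cast_nonneg _)
  simp only [cellLo]; linarith

lemma cellHi_le (hle : lo ≤ hi) (hd : ∀ i < p, d i < j) : cellHi j lo hi d ≤ hi := fun i => by
  have hi' := hd i i.2
  have hj0 : (0 : ℝ) < j := by exact_mod_cast (by omega : 0 < j)
  have h1 : ((d i : ℕ) + 1 : ℝ) / j ≤ 1 := by
    rw [div_le_one hj0]; exact_mod_cast hi'
  have h2 := mul_le_mul_of_nonneg_left h1 (sub_nonneg.2 (hle i))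
  have h3 : cellHi j lo hi d i = lo i + (hi i - lo i) * (((d i : ℕ) + 1 : ℝ) / j) := by
    simp only [cellHi, cellLo]; ring
  rw [h3]; linarith

lemma cell_subset (hle : lo ≤ hi) (hd : ∀ i < p, d i < j) :
    Set.Icc (cellLo j lo hi d) (cellHi j lo hi d) ⊆ Set.Icc lo hi :=
  Set.Icc_subset_Icc (le_cellLo hle) (cellHi_le hle hd)

lemma abs_sub_le_of_mem_cell {x y : Fin p → ℝ}
    (hx : x ∈ Set.Icc (cellLo j lo hi d) (cellHi j lo hi d))
    (hy : y ∈ Set.Icc (cellLo j lo hi d) (cellHi j lo hi d)) (i : Fin p) :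
    |x i - y i| ≤ (hi i - lo i) / j := by
  have h1 := hx.1 i
  have h2 := hx.2 i
  have h3 := hy.1 i
  have h4 := hy.2 i
  simp only [cellHi] at h2 h4
  rw [abs_le]; constructor <;> linarith

end Cell

/-- The arm shown is the lower corner of the current cell. -/
lemma State.point_eq (τ : State p) (h : IsBox τ.j τ.lo τ.hi) (hd : ∀ i < p, τ.cd i < τ.j) :
    τ.point = cellLo τ.j τ.lo τ.hi τ.cd := by
  have hle := h.le
  have hmem := h.subset (cell_subset hle hd ⟨le_rfl, cellLo_le_cellHi hle⟩)
  ext i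
  have h1 := hmem.1 i
  have h2 := hmem.2 i
  have : τ.point i = min 1 (max (cellLo τ.j τ.lo τ.hi τ.cd i) 0) := rfl
  rw [this, max_eq_left (by exact h1), min_eq_right (by exact h2)]

/-! ### Good phases -/

variable {f : Cube p → ℝ} {K : ℝ} {xs : Fin p → ℝ}

/-- The point `xs` is in the `k`-th box of the current phase. -/
def InBox (xs : Fin p → ℝ) (τ : State p) (k : ℕ) : Prop :=
  (τ.m = 0 → ∃ d : ℕ → ℕ, (∀ i < p, d i < τ.j) ∧ number τ.j p d = k ∧
    xs ∈ Set.Icc (gridLo τ.j d) (gridHi τ.j d)) ∧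
  (τ.m ≠ 0 → xs ∈ Set.Icc (τ.arrLo k) (τ.arrHi k))

/-- The state of a good run after `n` boxes of the current phase, where `xs` is a maximum. The new
boxes have half the regret, the maximum is in some box, and once this box has been processed, the
lower bound for the maximum is good enough for the next phase. -/
structure PhaseGood (f : Cube p → ℝ) (K : ℝ) (xs : Fin p → ℝ) (n : ℕ) (τ : State p) : Prop where
  v_le : τ.v ≤ (⨆ y, f y) - gap f τ.best
  le_v : (⨆ y, f y) - 4 * τ.r ≤ τ.v
  flag : τ.flag = 0
  done : ∀ k < n, GoodBox f τ.j (K / 2 * τ.r) (τ.arrLo k) (τ.arrHi k)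
  todo : τ.m ≠ 0 → ∀ k, n ≤ k → k < τ.j ^ p → GoodBox f τ.j (K * τ.r) (τ.arrLo k) (τ.arrHi k)
  star : ((⨆ y, f y) - 2 * τ.r ≤ τ.v ∧ ∃ k < n, xs ∈ Set.Icc (τ.arrLo k) (τ.arrHi k)) ∨
    ∃ k, n ≤ k ∧ k < τ.j ^ p ∧ InBox xs τ k

/-- The state of a good run after `q` cells of the current box. -/
structure BoxGood (f : Cube p → ℝ) (K : ℝ) (xs : Fin p → ℝ) (q : ℕ) (τ : State p) : Prop where
  v_le : τ.v ≤ (⨆ y, f y) - gap f τ.best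
  le_v : (⨆ y, f y) - 4 * τ.r ≤ τ.v
  done : ∀ k < τ.k, GoodBox f τ.j (K / 2 * τ.r) (τ.arrLo k) (τ.arrHi k)
  todo : τ.m ≠ 0 → ∀ k, τ.k < k → k < τ.j ^ p →
    GoodBox f τ.j (K * τ.r) (τ.arrLo k) (τ.arrHi k)
  box : GoodBox f τ.j (K * τ.r) τ.lo τ.hi
  hull : τ.flag ≠ 0 → GoodHull f (7 * τ.r) τ.lo τ.hi τ.alo τ.ahi
  star : ((⨆ y, f y) - 2 * τ.r ≤ τ.v ∧ ((∃ k < τ.k, xs ∈ Set.Icc (τ.arrLo k) (τ.arrHi k)) ∨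
      (τ.flag ≠ 0 ∧ xs ∈ Set.Icc τ.alo τ.ahi))) ∨
    (∃ k, τ.k < k ∧ k < τ.j ^ p ∧ InBox xs τ k) ∨
    ∃ d : ℕ → ℕ, (∀ i < p, d i < τ.j) ∧ q ≤ number τ.j p d ∧
      xs ∈ Set.Icc (cellLo τ.j τ.lo τ.hi d) (cellHi τ.j τ.lo τ.hi d)

/-- The new box is the hull of the surviving cells, and has half the regret of the old one. -/
lemma BoxGood.close {q : ℕ} {τ : State p} (h : BoxGood f K xs q τ) (hq : τ.j ^ p ≤ q)
    (hK : 8 ≤ K) (hr : 0 ≤ τ.r) (hreg : BoxRegularity f K τ.j)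
    (hbest : τ.best ∈ Set.Icc (0 : Fin p → ℝ) 1) : PhaseGood f K xs (τ.k + 1) τ.close := by
  have hnew : GoodBox f τ.j (K / 2 * τ.r) (if τ.flag = 0 then τ.best else τ.alo)
      (if τ.flag = 0 then τ.best else τ.ahi) := by
    split_ifs with hfl
    · refine ⟨fun i => ⟨hbest.1 i, le_rfl, hbest.2 i, by simp⟩, fun x hx => ?_⟩
      rw [Set.Icc_self, Set.mem_singleton_iff] at hx
      rw [hx]
      -- the best arm has regret at most `4 * r`, and `4 ≤ K / 2`
      have := h.v_le
      have := h.le_v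
      nlinarith
    · have hh := h.hull hfl
      have hb := h.box.isBox.mono hh.lo_le hh.le hh.le_hi
      exact ⟨hb, hreg.hull _ _ hb _ hh.face⟩
  have hstar : ((⨆ y, f y) - 2 * τ.r ≤ τ.v ∧
      ((∃ k < τ.k, xs ∈ Set.Icc (τ.arrLo k) (τ.arrHi k)) ∨
      (τ.flag ≠ 0 ∧ xs ∈ Set.Icc τ.alo τ.ahi))) ∨
    (∃ k, τ.k < k ∧ k < τ.j ^ p ∧ InBox xs τ k) := by
    rcases h.star with h1 | h1 | ⟨d, hd, hqd, -⟩
    · exact Or.inl h1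
    · exact Or.inr h1
    · exact absurd (number_lt hd) (by omega)
  have hold : ∀ k ≠ τ.k, τ.close.arrLo k = τ.arrLo k ∧ τ.close.arrHi k = τ.arrHi k := fun k hk =>
    ⟨Function.update_of_ne hk _ _, Function.update_of_ne hk _ _⟩
  have hself : τ.close.arrLo τ.k = (if τ.flag = 0 then τ.best else τ.alo) ∧
      τ.close.arrHi τ.k = (if τ.flag = 0 then τ.best else τ.ahi) :=
    ⟨Function.update_self _ _ _, Function.update_self _ _ _⟩
  refine ⟨h.v_le, h.le_v, rfl, fun k hk => ?_, fun hm k hk hk' => ?_, ?_⟩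
  · rcases Nat.lt_succ_iff_lt_or_eq.1 hk with hk | rfl
    · rw [(hold k hk.ne).1, (hold k hk.ne).2]
      exact h.done k hk
    · rw [hself.1, hself.2]
      exact hnew
  · rw [(hold k (by omega)).1, (hold k (by omega)).2]
    exact h.todo hm k (by omega) hk'
  · rcases hstar with ⟨hv, ⟨k, hk, hx⟩ | ⟨hfl, hx⟩⟩ | ⟨k, hk, hk', hx⟩
    · refine Or.inl ⟨hv, k, by omega, ?_⟩
      rwa [(hold k hk.ne).1, (hold k hk.ne).2]
    · refine Or.inl ⟨hv, τ.k, by omega, ?_⟩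
      rwa [hself.1, hself.2, if_neg hfl, if_neg hfl]
    · refine Or.inr ⟨k, hk, hk', hx.1, fun hm => ?_⟩
      rw [(hold k (by omega)).1, (hold k (by omega)).2]
      exact hx.2 hm

/-- If the maximum is in the box which is loaded, it is in one of the cells of that box. -/
lemma PhaseGood.load {τ : State p} (h : PhaseGood f K xs τ.k τ) (hj : 1 ≤ τ.j)
    (hbd : ∀ i < p, τ.bd i < τ.j) (hk : τ.k = number τ.j p τ.bd) (hkj : τ.k < τ.j ^ p)
    (hzero : τ.m = 0 → ∀ x, gap f x ≤ K * τ.r) : BoxGood f K xs 0 τ.load := by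
  have hbox : GoodBox f τ.j (K * τ.r) τ.load.lo τ.load.hi := by
    by_cases hm : τ.m = 0
    · simp only [State.load, if_pos hm]
      exact ⟨isBox_grid hj hbd, fun x _ => hzero hm x⟩
    · simp only [State.load, if_neg hm]
      exact h.todo hm _ le_rfl hkj
  have hin : InBox xs τ τ.k → xs ∈ Set.Icc τ.load.lo τ.load.hi := by
    intro hx
    by_cases hm : τ.m = 0
    · simp only [State.load, if_pos hm]
      obtain ⟨d, hd, hdk, hx⟩ := hx.1 hm
      have hdb := number_inj hd hbd (hdk.trans hk)
      have h1 : gridLo (p := p) τ.j d = fun i : Fin p => (τ.bd i / τ.j : ℝ) := by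
        ext i; simp only [gridLo, hdb i i.2]
      have h2 : gridHi (p := p) τ.j d = fun i : Fin p => ((1 + τ.bd i : ℕ) / τ.j : ℝ) := by
        ext i; simp only [gridHi, hdb i i.2]
      rwa [h1, h2] at hx
    · simp only [State.load, if_neg hm]
      exact hx.2 hm
  obtain ⟨a, b, e⟩ := τ.load_eq
  rw [e] at hbox hin ⊢
  refine ⟨h.v_le, h.le_v, h.done, fun hm k hk => h.todo hm k (le_of_lt hk), hbox,
    fun hfl => absurd h.flag hfl, ?_⟩
  rcases h.star with ⟨hv, hx⟩ | ⟨k, hk, hk', hx⟩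
  · exact Or.inl ⟨hv, Or.inl hx⟩
  rcases hk.eq_or_lt with rfl | hk
  · obtain ⟨d, hd, hx⟩ := exists_cell hj (hin hx)
    exact Or.inr (Or.inr ⟨d, hd, Nat.zero_le _, hx⟩)
  · exact Or.inr (Or.inl ⟨k, hk, hk', hx⟩)

lemma PhaseGood.load_of_scheduled {τ : State p} (h : PhaseGood f K xs τ.k τ)
    (hs : Scheduled τ.load) (hK : 8 ≤ K) (hone : ∀ x, gap f x ≤ 1) :
    BoxGood f K xs (number τ.load.j p (fun _ => 0)) τ.load := by
  have hz : number τ.load.j p (fun _ => 0) = 0 := by simp [number]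
  rw [hz]
  obtain ⟨a, b, e⟩ := τ.load_eq
  rw [e] at hs
  refine h.load hs.one_le hs.bd_lt hs.k_eq (hs.k_eq.trans_lt (number_lt hs.bd_lt))
    fun hm x => (hone x).trans ?_
  have : τ.r = (1 / 2) ^ τ.m := hs.r_eq
  rw [this, hm]
  linarith

/-- The boxes of a finished phase are small enough for the next phase, with half the resolution. -/
lemma PhaseGood.newPhase {τ : State p} (h : PhaseGood f K xs (τ.j ^ p) τ) :
    PhaseGood f K xs 0 τ.newPhase := by
  rcases h.star with ⟨hv, k, hk, hx⟩ | ⟨k, hk, hk', -⟩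
  · refine ⟨h.v_le, ?_, h.flag, fun k hk => by omega, fun _ k _ hk => ?_,
      Or.inr ⟨k, Nat.zero_le _, hk, fun hm => absurd hm (Nat.succ_ne_zero _), fun _ => hx⟩⟩
    · simp only [State.newPhase]; linarith
    · have := h.done k hk
      simp only [State.newPhase]
      rwa [mul_div_assoc', mul_div_right_comm]
  · omega

/-- A run starts with the trivial lower bound `0`, which is good enough since rewards are in
`[0,1]`. -/
lemma phaseGood_newRun {τ : State p} (hfl : τ.flag = 0) (h0 : ∀ x, 0 ≤ f x)
    (h1 : ⨆ y, f y ≤ 1) (hxs : xs ∈ Set.Icc (0 : Fin p → ℝ) 1) :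
    PhaseGood f K xs 0 τ.newRun := by
  obtain ⟨d, hd, hx⟩ := exists_grid (j := τ.j + 1) (Nat.succ_pos _) hxs
  refine ⟨?_, ?_, hfl, fun k hk => by omega, fun hm => absurd rfl hm,
    Or.inr ⟨_, Nat.zero_le _, number_lt hd, fun _ => ⟨d, hd, rfl, hx⟩, fun hm => absurd rfl hm⟩⟩
  · have := h0 (clamp τ.best)
    simp only [State.newRun, gap, simpleRegret]
    linarith
  · simp only [State.newRun]
    linarith

/-! ### Good cells -/

/-- A cell which survives has regret at most `7 * r`, and the cell of the maximum survives. -/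
lemma BoxGood.survive {τ : State p} (h : BoxGood f K xs (number τ.j p τ.cd) τ)
    (hgap : ∀ x, 0 ≤ gap f x)
    (hreg : BoxRegularity f K τ.j) (hcd : ∀ i < p, τ.cd i < τ.j) (harm : τ.arm = τ.point)
    (hxs : gap f xs = 0) (hu : |τ.u - ((⨆ y, f y) - gap f τ.arm)| ≤ τ.r / 4) :
    ∃ a b fl, τ.survive = { τ with alo := a, ahi := b, flag := fl } ∧
      (fl ≠ 0 → GoodHull f (7 * τ.r) τ.lo τ.hi a b) ∧
      (τ.flag ≠ 0 → xs ∈ Set.Icc τ.alo τ.ahi → fl ≠ 0 ∧ xs ∈ Set.Icc a b) ∧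
      (xs ∈ Set.Icc (cellLo τ.j τ.lo τ.hi τ.cd) (cellHi τ.j τ.lo τ.hi τ.cd) →
        fl ≠ 0 ∧ xs ∈ Set.Icc a b ∧ (⨆ y, f y) - 2 * τ.r ≤ τ.u - τ.r) := by
  have hle := h.box.isBox.le
  have harm' : τ.arm = cellLo τ.j τ.lo τ.hi τ.cd := harm.trans (τ.point_eq h.box.isBox hcd)
  have hhi : (fun i => (τ.hi i - τ.lo i) / τ.j + τ.arm i) = cellHi τ.j τ.lo τ.hi τ.cd := by
    ext i; rw [harm']; rfl
  have hmem : τ.arm ∈ Set.Icc (cellLo τ.j τ.lo τ.hi τ.cd) (cellHi τ.j τ.lo τ.hi τ.cd) := by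
    rw [harm']; exact ⟨le_rfl, cellLo_le_cellHi hle⟩
  have hosc : ∀ x ∈ Set.Icc (cellLo τ.j τ.lo τ.hi τ.cd) (cellHi τ.j τ.lo τ.hi τ.cd),
      |gap f x - gap f τ.arm| ≤ 3 / 4 * τ.r := fun x hx =>
    hreg.osc _ _ h.box.isBox _ h.box.gap_le x (cell_subset hle hcd hx) _
      (cell_subset hle hcd hmem) (abs_sub_le_of_mem_cell hx hmem)
  have hu' := abs_le.1 hu
  have hlev := h.le_v
  have hvle := h.v_le
  have hx : xs ∈ Set.Icc (cellLo τ.j τ.lo τ.hi τ.cd) (cellHi τ.j τ.lo τ.hi τ.cd) →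
      (⨆ y, f y) ≤ τ.u + τ.r := by
    intro hx
    have := abs_le.1 (hosc xs hx)
    linarith
  by_cases hs : τ.v ≤ τ.u + τ.r
  · have hcell : GoodHull f (7 * τ.r) τ.lo τ.hi τ.arm
        (fun i => (τ.hi i - τ.lo i) / τ.j + τ.arm i) := by
      rw [hhi]
      have hg : ∀ x ∈ Set.Icc (cellLo τ.j τ.lo τ.hi τ.cd) (cellHi τ.j τ.lo τ.hi τ.cd),
          gap f x ≤ 7 * τ.r := fun x hx => by
        -- the lower corner has regret at most `(1 / 4 + 1 + 4) * r`, as `v` is at most `4 * r`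
        -- below the maximum, and the regret varies by at most `3 / 4 * r` over the cell
        have := abs_le.1 (hosc x hx)
        linarith
      have hmem' : cellHi τ.j τ.lo τ.hi τ.cd ∈
          Set.Icc (cellLo τ.j τ.lo τ.hi τ.cd) (cellHi τ.j τ.lo τ.hi τ.cd) :=
        ⟨cellLo_le_cellHi hle, le_rfl⟩
      refine ⟨?_, ?_, cellHi_le hle hcd, fun i => ?_⟩
      · rw [harm']; exact le_cellLo hle
      · exact hmem.2
      · rw [harm'] at hmem ⊢
        exact ⟨⟨_, hmem, rfl, hg _ hmem⟩, _, hmem', rfl, hg _ hmem'⟩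
    have hcx : xs ∈ Set.Icc (cellLo τ.j τ.lo τ.hi τ.cd) (cellHi τ.j τ.lo τ.hi τ.cd) →
        xs ∈ Set.Icc τ.arm (fun i => (τ.hi i - τ.lo i) / τ.j + τ.arm i) := by
      rw [hhi, harm']; exact id
    refine ⟨_, _, _, if_pos hs, fun _ => ?_, fun hfl hx' => ⟨one_ne_zero, ?_⟩,
      fun hx' => ⟨one_ne_zero, ?_, by linarith [hx hx']⟩⟩
    · by_cases hfl : τ.flag = 0
      · simpa [State.absorb, hfl] using hcell
      · simp only [hfl, if_false]
        rw [show (fun i => max (τ.ahi i) ((τ.hi i - τ.lo i) / τ.j + τ.arm i))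
          = τ.ahi ⊔ (fun i => (τ.hi i - τ.lo i) / τ.j + τ.arm i) from rfl, sup_comm]
        exact hcell.union (h.hull hfl)
    · simp only [hfl, if_false]
      exact ⟨fun i => (min_le_right _ _).trans (hx'.1 i),
        fun i => (hx'.2 i).trans (le_max_left _ _)⟩
    · exact ⟨fun i => (min_le_left _ _).trans ((hcx hx').1 i),
        fun i => ((hcx hx').2 i).trans (le_max_right _ _)⟩
  · -- a cell which does not survive cannot contain a maximum
    refine ⟨τ.alo, τ.ahi, τ.flag, if_neg hs, h.hull, fun h1 h2 => ⟨h1, h2⟩, fun hx' => ?_⟩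
    have := hx hx'
    have hg := hgap τ.best
    linarith

/-- The lower bound for the maximum stays below the mean reward of the best arm. -/
lemma State.record_le {τ : State p} {F : ℝ} (h : τ.v ≤ F - gap f τ.best)
    (h' : τ.u - τ.r ≤ F - gap f τ.arm) :
    ∃ x a, τ.record = { τ with v := x, best := a } ∧ x ≤ F - gap f a ∧ τ.v ≤ x ∧
      τ.u - τ.r ≤ x := by
  by_cases hlt : τ.v < τ.u - τ.r
  · exact ⟨_, _, if_pos hlt, h', hlt.le, le_rfl⟩
  · exact ⟨_, _, if_neg hlt, h, le_rfl, not_lt.1 hlt⟩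

/-- Once a cell has been evaluated, one more cell of the box is finished. -/
lemma BoxGood.scan {τ : State p} (h : BoxGood f K xs (number τ.j p τ.cd) τ)
    (hgap : ∀ x, 0 ≤ gap f x) (hr : 0 ≤ τ.r)
    (hreg : BoxRegularity f K τ.j) (hcd : ∀ i < p, τ.cd i < τ.j) (harm : τ.arm = τ.point)
    (hxs : gap f xs = 0) (hu : |τ.sum / τ.s - ((⨆ y, f y) - gap f τ.arm)| ≤ τ.r / 4) :
    BoxGood f K xs (number τ.j p τ.cd + 1) τ.scan := by
  have hm : BoxGood f K xs (number τ.mean.j p τ.mean.cd) τ.mean :=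
    ⟨h.v_le, h.le_v, h.done, h.todo, h.box, h.hull, h.star⟩
  obtain ⟨a, b, fl, e, hhull, hkeep, hnew⟩ := hm.survive hgap hreg hcd harm hxs hu
  obtain ⟨x, c, e', hx, hvx, hux⟩ := State.record_le
    (τ := { τ.mean with alo := a, ahi := b, flag := fl }) (F := ⨆ y, f y) h.v_le
    (by have := (abs_le.1 hu).2; simp only [State.mean]; linarith)
  rw [State.scan, e, e']
  have hvx : τ.v ≤ x := hvx
  refine ⟨hx, h.le_v.trans hvx, h.done, h.todo, h.box, hhull, ?_⟩
  rcases h.star with ⟨hv, hk | ⟨hfl, hk⟩⟩ | hk | ⟨d, hd, hq, hk⟩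
  · exact Or.inl ⟨hv.trans hvx, Or.inl hk⟩
  · exact Or.inl ⟨hv.trans hvx, Or.inr (hkeep hfl hk)⟩
  · exact Or.inr (Or.inl hk)
  rcases hq.eq_or_lt with hq | hq
  · have hdc := number_inj hd hcd hq.symm
    have h1 : cellLo τ.j τ.lo τ.hi d = cellLo τ.j τ.lo τ.hi τ.cd := by
      ext i; simp only [cellLo, hdc i i.2]
    have h2 : cellHi τ.j τ.lo τ.hi d = cellHi τ.j τ.lo τ.hi τ.cd := by
      ext i; simp only [cellHi, h1]
    rw [h1, h2] at hk
    obtain ⟨h3, h4, h5⟩ := hnew hk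
    exact Or.inl ⟨h5.trans hux, Or.inr ⟨h3, h4⟩⟩
  · exact Or.inr (Or.inr ⟨d, hd, hq, hk⟩)

lemma State.point_mem (τ : State p) : τ.point ∈ Set.Icc (0 : Fin p → ℝ) 1 :=
  ⟨fun _ => le_min zero_le_one (le_max_right _ _), fun _ => min_le_left _ _⟩

lemma State.scan_best (τ : State p) : τ.scan.best = τ.best ∨ τ.scan.best = τ.arm := by
  obtain ⟨a, b, fl, h⟩ := τ.mean.survive_eq
  rw [scan, h]
  unfold record
  split_ifs
  · exact Or.inr rfl
  · exact Or.inl rfl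

/-- The digits of the cells are all zero at the beginning of a box. -/
lemma Scheduled.number_cd {τ : State p} (h : Scheduled τ)
    (hq : number τ.j p τ.cd + 1 = τ.j ^ p) (j : ℕ) :
    number j p (State.succDigits τ.j τ.cd p).1 = number j p (fun _ => 0) := by
  have h1 := succDigits_cases h.cd_lt
  refine number_congr (number_inj (succDigits_spec h.cd_lt).1 (fun i _ => h.one_le) ?_)
  rw [show number τ.j p (fun _ => 0) = 0 by simp [number]]
  omega

/-- A good run remains good as long as the mean rewards of the cells are accurate. -/
lemma BoxGood.update {τ : State p} (h : BoxGood f K xs (number τ.j p τ.cd) τ)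
    (hτ : Scheduled τ) (hgap : ∀ x, 0 ≤ gap f x) (hK : 8 ≤ K) (hreg : BoxRegularity f K τ.j)
    (harm : τ.arm = τ.point) (hbest : τ.best ∈ Set.Icc (0 : Fin p → ℝ) 1)
    (hone : ∀ x, gap f x ≤ 1) (hxs : gap f xs = 0)
    (hu : τ.cnt + 1 = τ.s →
      |(τ.sum + τ.rew) / τ.s - ((⨆ y, f y) - gap f τ.arm)| ≤ τ.r / 4)
    (hj : τ.update.j = τ.j) :
    BoxGood f K xs (number τ.update.j p τ.update.cd) τ.update := by
  have hr : 0 ≤ τ.r := by rw [hτ.r_eq]; positivity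
  have hup := hτ.update.1
  have htick : BoxGood f K xs (number τ.tick.j p τ.tick.cd) τ.tick :=
    ⟨h.v_le, h.le_v, h.done, h.todo, h.box, h.hull, h.star⟩
  have hcd := succDigits_cases hτ.cd_lt
  obtain ⟨a, b, fl, y, x, c, hs⟩ := τ.tick.scan_eq
  rcases hτ.update_cases with ⟨h1, e⟩ | ⟨h1, hrest⟩
  · rw [e]; exact htick
  have hscan := htick.scan hgap hr hreg hτ.cd_lt harm hxs (hu h1)
  have hcell : BoxGood f K xs (number τ.j p τ.cd + 1) τ.tick.scan.nextCell :=
    ⟨hscan.v_le, hscan.le_v, hscan.done, hscan.todo, hscan.box, hscan.hull, hscan.star⟩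
  rcases hrest with ⟨h2, e⟩ | ⟨h2, hrest⟩
  · have hq : number τ.update.j p τ.update.cd = number τ.j p τ.cd + 1 := by
      have : number τ.update.j p τ.update.cd = number τ.j p (State.succDigits τ.j τ.cd p).1 := by
        rw [e, hs]; rfl
      omega
    rw [hq, e]
    exact hcell
  have hcj : τ.tick.scan.nextCell.j = τ.j := by rw [hs]; rfl
  have hcr : τ.tick.scan.nextCell.r = τ.r := by rw [hs]; rfl
  have hck : τ.tick.scan.nextCell.k = τ.k := by rw [hs]; rfl
  have hcb : τ.tick.scan.nextCell.best ∈ Set.Icc (0 : Fin p → ℝ) 1 := by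
    rcases τ.tick.scan_best with e | e
    · exact e.symm ▸ hbest
    · have : τ.tick.scan.nextCell.best = τ.point := e.trans harm
      rw [this]
      exact τ.point_mem
  have hclose := hcell.close (by rw [hcj]; omega) hK (by rwa [hcr]) (by rwa [hcj]) hcb
  rw [hck] at hclose
  have hbox : PhaseGood f K xs (τ.k + 1) τ.tick.scan.nextCell.close.nextBox :=
    ⟨hclose.v_le, hclose.le_v, hclose.flag, hclose.done, hclose.todo, hclose.star⟩
  have hbk : τ.tick.scan.nextCell.close.nextBox.k = τ.k + 1 := by rw [hs]; rfl
  have hbj : τ.tick.scan.nextCell.close.nextBox.j = τ.j := by rw [hs]; rfl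
  have hbc : τ.tick.scan.nextCell.close.nextBox.cd = (State.succDigits τ.j τ.cd p).1 := by
    rw [hs]; rfl
  rcases hrest with ⟨h3, e⟩ | ⟨h3, ⟨h4, e⟩ | ⟨h4, e⟩⟩
  · rw [e] at hup hj ⊢
    have := PhaseGood.load_of_scheduled (by rwa [hbk]) hup hK hone
    obtain ⟨l, l', hl⟩ := (τ.tick.scan.nextCell.close.nextBox).load_eq
    rwa [← hτ.number_cd h2, ← hbc,
      show τ.tick.scan.nextCell.close.nextBox.cd = τ.tick.scan.nextCell.close.nextBox.load.cd by
        rw [hl]] at this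
  · rw [e] at hup hj ⊢
    rw [h3, ← hbj] at hbox
    have := PhaseGood.load_of_scheduled hbox.newPhase hup hK hone
    obtain ⟨l, l', hl⟩ := (τ.tick.scan.nextCell.close.nextBox.newPhase).load_eq
    rwa [← hτ.number_cd h2, ← hbc,
      show τ.tick.scan.nextCell.close.nextBox.cd
          = τ.tick.scan.nextCell.close.nextBox.newPhase.load.cd by
        rw [hl]; rfl] at this
  · obtain ⟨l, l', hl⟩ := (τ.tick.scan.nextCell.close.nextBox.newPhase.newRun).load_eq
    have : τ.update.j = τ.j + 1 := by rw [e, hl, hs]; rfl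
    omega

/-- A run is good at its beginning. -/
lemma Scheduled.boxGood_newRun {τ : State p} (hτ : Scheduled τ) (hK : 8 ≤ K)
    (h0 : ∀ x, 0 ≤ f x) (h1 : ⨆ y, f y ≤ 1) (hxs : xs ∈ Set.Icc (0 : Fin p → ℝ) 1)
    (hj : τ.update.j ≠ τ.j) :
    BoxGood f K xs (number τ.update.j p τ.update.cd) τ.update ∧ τ.update.j = τ.j + 1 ∧
      τ.m = τ.j := by
  have hup := hτ.update.1
  obtain ⟨a, b, fl, y, x, c, hs⟩ := τ.tick.scan_eq
  have hone : ∀ x, gap f x ≤ 1 := fun x => by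
    have := h0 (clamp x)
    simp only [gap, simpleRegret]; linarith
  rcases hτ.update_cases with ⟨-, e⟩ | ⟨-, ⟨-, e⟩ | ⟨h2, ⟨-, e⟩ | ⟨-, ⟨-, e⟩ | ⟨hm, e⟩⟩⟩⟩
  · exact absurd (by rw [e]; rfl) hj
  · exact absurd (by rw [e, hs]; rfl) hj
  · obtain ⟨l, l', hl⟩ := (τ.tick.scan.nextCell.close.nextBox).load_eq
    exact absurd (by rw [e, hl, hs]; rfl) hj
  · obtain ⟨l, l', hl⟩ := (τ.tick.scan.nextCell.close.nextBox.newPhase).load_eq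
    exact absurd (by rw [e, hl, hs]; rfl) hj
  · obtain ⟨l, l', hl⟩ := (τ.tick.scan.nextCell.close.nextBox.newPhase.newRun).load_eq
    refine ⟨?_, by rw [e, hl, hs]; rfl, hm⟩
    rw [e] at hup ⊢
    have hnew : PhaseGood f K xs 0 τ.tick.scan.nextCell.close.nextBox.newPhase.newRun :=
      phaseGood_newRun rfl h0 h1 hxs
    have := hnew.load_of_scheduled hup hK hone
    rwa [← hτ.number_cd h2, show (State.succDigits τ.j τ.cd p).1
          = τ.tick.scan.nextCell.close.nextBox.newPhase.newRun.load.cd by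
        rw [hl, hs]; rfl] at this

end Adaptive

end RealRAM

namespace RealRAM

namespace Adaptive

open Cube

variable {p : ℕ}

/-! ### Trajectories -/

lemma Scheduled.update_fields {τ : State p} (h : Scheduled τ) :
    τ.update.rcm = τ.rcm ∧ (τ.update.best = τ.best ∨ τ.update.best = τ.arm) ∧
      (τ.update.j = τ.j ∨ τ.m = τ.j ∧ τ.update.j = τ.j + 1) ∧
      ((τ.cnt + 1 < τ.s ∧ τ.update = τ.tick) ∨ (τ.update.cnt = 0 ∧ τ.update.sum = 0)) := by
  have hb := τ.tick.scan_best
  obtain ⟨a, b, fl, y, x, c, hs⟩ := τ.tick.scan_eq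
  rcases h.update_cases with ⟨h1, e⟩ | ⟨-, ⟨-, e⟩ | ⟨-, ⟨-, e⟩ | ⟨-, ⟨-, e⟩ | ⟨hm, e⟩⟩⟩⟩
  · rw [e]
    exact ⟨rfl, Or.inl rfl, Or.inl rfl, Or.inl ⟨h1, rfl⟩⟩
  all_goals rw [hs] at hb
  · rw [e, hs]
    exact ⟨rfl, hb, Or.inl rfl, Or.inr ⟨rfl, rfl⟩⟩
  · obtain ⟨l, l', hl⟩ := (τ.tick.scan.nextCell.close.nextBox).load_eq
    rw [e, hl, hs]
    exact ⟨rfl, hb, Or.inl rfl, Or.inr ⟨rfl, rfl⟩⟩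
  · obtain ⟨l, l', hl⟩ := (τ.tick.scan.nextCell.close.nextBox.newPhase).load_eq
    rw [e, hl, hs]
    exact ⟨rfl, hb, Or.inl rfl, Or.inr ⟨rfl, rfl⟩⟩
  · obtain ⟨l, l', hl⟩ := (τ.tick.scan.nextCell.close.nextBox.newPhase.newRun).load_eq
    rw [e, hl, hs]
    exact ⟨rfl, hb, Or.inr ⟨hm, rfl⟩, Or.inr ⟨rfl, rfl⟩⟩

/-- The state in which the arm of round `t` is played, on rewards `y`. -/
noncomputable def traj (p : ℕ) (y : ℕ → ℝ) : ℕ → State p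
  | 0 => (view p Mem.init).next
  | t + 1 => State.next { traj p y t with rew := y t }

/-- The program shows the states of the trajectory. -/
lemma view_memory (y : ℕ → I) (t : ℕ) :
    view p ((play p).eval ((learner p).memory p y t).rewind) = traj p (fun i => y i) t := by
  rw [view_play]
  induction t with
  | zero => rfl
  | succ t ih =>
    rw [traj, ← ih]
    change (view p (((play p).eval ((learner p).memory p y t).rewind).setReal p (y t))).next = _
    rw [view_setReal_rew, view_play]

variable {y : ℕ → ℝ}

lemma traj_zero : ∃ a b c d, traj p y 0 = { view p Mem.init with
    j := 1, s0 := 1, s := 1, r := 1, arm := c, lo := a, hi := b, rcm := d } := by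
  obtain ⟨a, b, e⟩ := (view p Mem.init).newRun.load_eq
  have e' : (view p Mem.init).update = _ := if_pos rfl
  obtain ⟨d, e''⟩ := (view p Mem.init).update.show_.recommend_eq
  rw [traj, State.next, e'', e', e]
  exact ⟨_, _, _, _, rfl⟩

lemma scheduled_traj (t : ℕ) : Scheduled (traj p y t) ∧
    ∀ w, clock w (traj p y t) = ∑ i ∈ Finset.range t, w (traj p y i).m := by
  induction t with
  | zero =>
    obtain ⟨a, b, c, d, e⟩ := traj_zero (p := p) (y := y)
    rw [e]
    constructor
    · constructor
      all_goals simp [view, Mem.init, samples, number, Finset.sum_range_succ]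
    · intro w
      simp [clock, view, Mem.init, samples, number, phaseWeight]
  | succ t ih =>
    obtain ⟨h1, h2⟩ := ih
    have h : Scheduled { traj p y t with rew := y t } :=
      ⟨h1.one_le, h1.m_le, h1.s0_eq, h1.s_eq, h1.r_eq, h1.cnt_lt, h1.cd_lt, h1.bd_lt, h1.k_eq⟩
    refine ⟨h.next.1, fun w => ?_⟩
    rw [traj, h.next.2 w, Finset.sum_range_succ, ← h2]
    rfl

lemma scheduled_rew (t : ℕ) : Scheduled { traj p y t with rew := y t } :=
  have h1 := (scheduled_traj t).1
  ⟨h1.one_le, h1.m_le, h1.s0_eq, h1.s_eq, h1.r_eq, h1.cnt_lt, h1.cd_lt, h1.bd_lt, h1.k_eq⟩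

/-- Showing and recommending the arm changes these two parts of the state only. -/
lemma traj_succ (t : ℕ) : ∃ a, traj p y (t + 1) =
    { ({ traj p y t with rew := y t } : State p).update with
      arm := ({ traj p y t with rew := y t } : State p).update.point, rcm := a } := by
  obtain ⟨a, e⟩ := ({ traj p y t with rew := y t } : State p).update.show_.recommend_eq
  exact ⟨a, by rw [traj, State.next, e]; rfl⟩

lemma traj_arm (t : ℕ) : (traj p y t).arm = (traj p y t).point := by
  cases t with
  | zero =>
    obtain ⟨d, e⟩ := (view p Mem.init).update.show_.recommend_eq
    rw [traj, State.next, e]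
    rfl
  | succ t =>
    obtain ⟨a, e⟩ := traj_succ (p := p) (y := y) t
    rw [e]
    rfl

lemma traj_arm_mem (t : ℕ) : (traj p y t).arm ∈ Set.Icc (0 : Fin p → ℝ) 1 := by
  rw [traj_arm]; exact State.point_mem _

lemma traj_best_mem (t : ℕ) : (traj p y t).best ∈ Set.Icc (0 : Fin p → ℝ) 1 := by
  induction t with
  | zero =>
    obtain ⟨a, b, c, d, e⟩ := traj_zero (p := p) (y := y)
    rw [e]
    exact ⟨le_rfl, fun _ => zero_le_one⟩
  | succ t ih =>
    obtain ⟨a, e⟩ := traj_succ (p := p) (y := y) t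
    rw [e]
    rcases (scheduled_rew (p := p) (y := y) t).update_fields.2.1 with h | h
    · exact h.symm ▸ ih
    · exact h.symm ▸ traj_arm_mem t

lemma recommend_rcm (τ : State p) : (τ.m = τ.j → τ.recommend.rcm = τ.arm) ∧
    (τ.m ≠ τ.j → τ.recommend.rcm = τ.rcm) := by
  unfold State.recommend
  constructor <;> intro h <;> simp [h]

lemma traj_succ_rcm (t : ℕ) :
    ((traj p y (t + 1)).m = (traj p y (t + 1)).j →
      (traj p y (t + 1)).rcm = (traj p y (t + 1)).arm) ∧
    ((traj p y (t + 1)).m ≠ (traj p y (t + 1)).j →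
      (traj p y (t + 1)).rcm = (traj p y t).rcm) := by
  obtain ⟨a, e⟩ := ({ traj p y t with rew := y t } : State p).update.show_.recommend_eq
  have h := recommend_rcm ({ traj p y t with rew := y t } : State p).update.show_
  have h' := (scheduled_rew (p := p) (y := y) t).update_fields.1
  rw [traj, State.next]
  rw [e] at h ⊢
  exact ⟨h.1, fun hm => (h.2 hm).trans h'⟩

lemma traj_rcm_mem (t : ℕ) : (traj p y t).rcm ∈ Set.Icc (0 : Fin p → ℝ) 1 := by
  induction t with
  | zero =>
    have h := recommend_rcm (view p Mem.init).update.show_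
    by_cases hm : (view p Mem.init).update.show_.m = (view p Mem.init).update.show_.j
    · rw [traj, State.next, h.1 hm]
      exact State.point_mem _
    · rw [traj, State.next, h.2 hm]
      obtain ⟨a, b, e⟩ := (view p Mem.init).newRun.load_eq
      have e' : (view p Mem.init).update = _ := if_pos rfl
      rw [e', e]
      exact ⟨le_rfl, fun _ => zero_le_one⟩
  | succ t ih =>
    obtain ⟨h1, h2⟩ := traj_succ_rcm (p := p) (y := y) t
    by_cases hm : (traj p y (t + 1)).m = (traj p y (t + 1)).j
    · rw [h1 hm]; exact traj_arm_mem _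
    · rw [h2 hm]; exact ih

/-- The rewards of the current cell have been obtained from the arm which is now shown. -/
lemma traj_sum (t : ℕ) : (traj p y t).cnt ≤ t ∧
    (traj p y t).sum = ∑ i ∈ Finset.range (traj p y t).cnt, y (t - (traj p y t).cnt + i) ∧
    ∀ i < (traj p y t).cnt, (traj p y (t - (traj p y t).cnt + i)).arm = (traj p y t).arm := by
  induction t with
  | zero =>
    obtain ⟨a, b, c, d, e⟩ := traj_zero (p := p) (y := y)
    rw [e]
    simp [view, Mem.init]
  | succ t ih =>
    obtain ⟨h1, h2, h3⟩ := ih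
    obtain ⟨a, e⟩ := traj_succ (p := p) (y := y) t
    rcases (scheduled_rew (p := p) (y := y) t).update_fields.2.2.2 with ⟨-, h⟩ | ⟨hc, hs⟩
    · have hcnt : (traj p y (t + 1)).cnt = (traj p y t).cnt + 1 := by rw [e, h]; rfl
      have hsum : (traj p y (t + 1)).sum = (traj p y t).sum + y t := by rw [e, h]; rfl
      have harm : (traj p y (t + 1)).arm = (traj p y t).arm := by
        rw [traj_arm t, e, h]; rfl
      have hsub : t + 1 - ((traj p y t).cnt + 1) = t - (traj p y t).cnt := by omega
      rw [hcnt, hsum, harm, hsub]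
      refine ⟨by omega, ?_, fun i hi => ?_⟩
      · rw [Finset.sum_range_succ, ← h2, Nat.sub_add_cancel h1]
      · rcases Nat.lt_succ_iff_lt_or_eq.1 hi with hi | rfl
        · exact h3 i hi
        · rw [Nat.sub_add_cancel h1]
    · have hcnt : (traj p y (t + 1)).cnt = 0 := by rw [e]; exact hc
      have hsum : (traj p y (t + 1)).sum = 0 := by rw [e]; exact hs
      simp [hcnt, hsum]

/-! ### Regret bounds for trajectories -/

variable {f : Cube p → ℝ} {K : ℝ} {j₀ : ℕ}

/-- From run `j₀` on, the boxes are good, if the mean rewards of the cells are accurate. Nothing is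
known about earlier runs, but each run starts afresh. As `2 ≤ j₀`, the first run is among these. -/
lemma boxGood_traj {xs : Fin p → ℝ} (hj₀ : 2 ≤ j₀) (hK : 8 ≤ K)
    (hreg : ∀ j ≥ j₀, BoxRegularity f K j) (h0 : ∀ x, 0 ≤ f x) (h1 : ⨆ y, f y ≤ 1)
    (hgap : ∀ x, 0 ≤ gap f x) (hxs : gap f xs = 0) (hxs' : xs ∈ Set.Icc (0 : Fin p → ℝ) 1)
    (hu : ∀ t, j₀ ≤ (traj p y t).j → (traj p y t).cnt + 1 = (traj p y t).s →
      |((traj p y t).sum + y t) / (traj p y t).s - ((⨆ y, f y) - gap f (traj p y t).arm)|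
        ≤ (traj p y t).r / 4) (t : ℕ) (ht : j₀ ≤ (traj p y t).j) :
    BoxGood f K xs (number (traj p y t).j p (traj p y t).cd) (traj p y t) := by
  have hone : ∀ x, gap f x ≤ 1 := fun x => by
    have := h0 (clamp x)
    simp only [gap, simpleRegret]; linarith
  induction t with
  | zero =>
    obtain ⟨a, b, c, d, e⟩ := traj_zero (p := p) (y := y)
    rw [e] at ht
    simp at ht
    omega
  | succ t ih =>
    obtain ⟨a, e⟩ := traj_succ (p := p) (y := y) t
    have hs := scheduled_rew (p := p) (y := y) t
    have hup : BoxGood f K xs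
        (number ({ traj p y t with rew := y t } : State p).update.j p
          ({ traj p y t with rew := y t } : State p).update.cd)
        ({ traj p y t with rew := y t } : State p).update := by
      by_cases hj : ({ traj p y t with rew := y t } : State p).update.j = (traj p y t).j
      · have htj : j₀ ≤ (traj p y t).j := by rw [← hj]; rw [e] at ht; exact ht
        have h := ih htj
        have h' : BoxGood f K xs (number (traj p y t).j p (traj p y t).cd)
            { traj p y t with rew := y t } :=
          ⟨h.v_le, h.le_v, h.done, h.todo, h.box, h.hull, h.star⟩
        exact h'.update hs hgap hK (hreg _ htj) (traj_arm t) (traj_best_mem t) hone hxs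
          (hu t htj) hj
      · exact (hs.boxGood_newRun hK h0 h1 hxs' hj).1
    rw [e]
    exact ⟨hup.v_le, hup.le_v, hup.done, hup.todo, hup.box, hup.hull, hup.star⟩

lemma BoxGood.gap_arm_le {xs : Fin p → ℝ} {τ : State p} {q : ℕ} (h : BoxGood f K xs q τ)
    (hτ : Scheduled τ) (harm : τ.arm = τ.point) : gap f τ.arm ≤ K * (1 / 2) ^ τ.m := by
  rw [← hτ.r_eq]
  refine h.box.gap_le _ ?_
  rw [harm, τ.point_eq h.box.isBox hτ.cd_lt]
  exact cell_subset h.box.isBox.le hτ.cd_lt ⟨le_rfl, cellLo_le_cellHi h.box.isBox.le⟩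

/-- The recommended arm comes from the last phase of the current run or of the one before. -/
lemma gap_rcm_le (hj₀ : 2 ≤ j₀) (hK : 0 ≤ K)
    (h : ∀ t, j₀ ≤ (traj p y t).j → gap f (traj p y t).arm ≤ K * (1 / 2) ^ (traj p y t).m)
    (t : ℕ) :
    (j₀ ≤ (traj p y t).j → (traj p y t).m = (traj p y t).j →
      gap f (traj p y t).rcm ≤ K * (1 / 2) ^ (traj p y t).j) ∧
    (j₀ + 1 ≤ (traj p y t).j → gap f (traj p y t).rcm ≤ 2 * K * (1 / 2) ^ (traj p y t).j) := by
  induction t with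
  | zero =>
    obtain ⟨a, b, c, d, e⟩ := traj_zero (p := p) (y := y)
    rw [e]
    constructor <;> intro ht <;> simp only at ht <;> omega
  | succ t ih =>
    obtain ⟨h1, h2⟩ := traj_succ_rcm (p := p) (y := y) t
    have hlast : j₀ ≤ (traj p y (t + 1)).j → (traj p y (t + 1)).m = (traj p y (t + 1)).j →
        gap f (traj p y (t + 1)).rcm ≤ K * (1 / 2) ^ (traj p y (t + 1)).j := fun hj hm => by
      rw [h1 hm, ← hm]
      exact h _ hj
    refine ⟨hlast, fun hj => ?_⟩
    by_cases hm : (traj p y (t + 1)).m = (traj p y (t + 1)).j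
    · have : 0 ≤ K * (1 / 2) ^ (traj p y (t + 1)).j := by positivity
      linarith [hlast (by omega) hm]
    rw [h2 hm]
    obtain ⟨a, e⟩ := traj_succ (p := p) (y := y) t
    have hj' : (traj p y (t + 1)).j = ({ traj p y t with rew := y t } : State p).update.j := by
      rw [e]
    rcases (scheduled_rew (p := p) (y := y) t).update_fields.2.2.1 with hjj | ⟨hmj, hjj⟩
    · have hjj' : (traj p y (t + 1)).j = (traj p y t).j := hj'.trans hjj
      rw [hjj'] at hj ⊢
      exact ih.2 hj
    · have hjj' : (traj p y (t + 1)).j = (traj p y t).j + 1 := hj'.trans hjj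
      have := ih.1 (by omega) hmj
      rw [hjj', pow_succ]
      linarith

end Adaptive

end RealRAM

namespace RealRAM

namespace Adaptive

open Cube

variable {p : ℕ}

/-! ### The length of runs -/

lemma samples_le (j : ℕ) : samples j ≤ (j + 1) ^ 2 := by
  refine (Finset.sum_le_card_nsmul _ _ j fun i hi => ?_).trans ?_
  · have := Finset.mem_range.1 hi; omega
  · simp only [Finset.card_range, smul_eq_mul]; nlinarith

lemma two_mul_samples (j : ℕ) : 2 * samples j = j * (j + 1) := by
  have := Finset.sum_range_id_mul_two (j + 1)
  rw [samples, mul_comm, this, Nat.add_sub_cancel, mul_comm]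

lemma phaseWeight_nonneg {w : ℕ → ℝ} (hw : ∀ m, 0 ≤ w m) (j m : ℕ) :
    0 ≤ phaseWeight p w j m := by
  have := hw m
  unfold phaseWeight
  positivity

/-- The weight of the rounds up to now is at most the weight of all runs up to now. -/
lemma Scheduled.clock_add_le {τ : State p} (h : Scheduled τ) {w : ℕ → ℝ} (hw : ∀ m, 0 ≤ w m) :
    clock w τ + w τ.m ≤
      ∑ j ∈ Finset.range (τ.j + 1), ∑ m ∈ Finset.range (j + 1), phaseWeight p w j m := by
  have hq : (number τ.j p τ.cd : ℝ) + 1 ≤ (τ.j : ℝ) ^ p := by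
    exact_mod_cast number_lt h.cd_lt
  have hk : (τ.k : ℝ) + 1 ≤ (τ.j : ℝ) ^ p := by
    rw [h.k_eq]; exact_mod_cast number_lt h.bd_lt
  have hc : (τ.cnt : ℝ) + 1 ≤ τ.s := by exact_mod_cast h.cnt_lt
  have hs : (τ.s : ℝ) = samples τ.j * 4 ^ τ.m := by exact_mod_cast h.s_eq
  have hphase : (τ.k * (τ.j : ℝ) ^ p + number τ.j p τ.cd) * (τ.s * w τ.m) + τ.cnt * w τ.m + w τ.m
      ≤ phaseWeight p w τ.j τ.m := by
    have hw' := hw τ.m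
    have h1 : (τ.k * (τ.j : ℝ) ^ p + number τ.j p τ.cd) * τ.s + τ.cnt + 1
        ≤ (τ.j : ℝ) ^ p * τ.j ^ p * τ.s := by
      have hJ : (0 : ℝ) ≤ (τ.j : ℝ) ^ p := by positivity
      have h2 := mul_le_mul_of_nonneg_right hk hJ
      have h3 : τ.k * (τ.j : ℝ) ^ p + number τ.j p τ.cd + 1 ≤ (τ.j : ℝ) ^ p * τ.j ^ p := by
        linarith
      have h4 := mul_le_mul_of_nonneg_right h3 (Nat.cast_nonneg (α := ℝ) τ.s)
      linarith
    have h5 := mul_le_mul_of_nonneg_right h1 hw'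
    rw [phaseWeight, ← hs]
    linarith
  have hrun : ∑ m ∈ Finset.range (τ.m + 1), phaseWeight p w τ.j m
      ≤ ∑ m ∈ Finset.range (τ.j + 1), phaseWeight p w τ.j m :=
    Finset.sum_le_sum_of_subset_of_nonneg
      (Finset.range_subset_range.2 (by have := h.m_le; omega))
      fun m _ _ => phaseWeight_nonneg hw _ _
  rw [Finset.sum_range_succ] at hrun
  rw [Finset.sum_range_succ, clock]
  linarith

/-- Up to powers of the number of runs, the weight of a phase is that of `4 ^ m` rounds. -/
lemma Scheduled.clock_add_le_mul {τ : State p} (h : Scheduled τ) {w : ℕ → ℝ}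
    (hw : ∀ m, 0 ≤ w m) {B : ℝ} (hB : ∀ m ≤ τ.j, 4 ^ m * w m ≤ B) :
    clock w τ + w τ.m ≤ ((τ.j : ℝ) + 1) ^ (2 * p + 4) * B := by
  have hJ : (0 : ℝ) ≤ τ.j := Nat.cast_nonneg _
  have hB0 : 0 ≤ B := (mul_nonneg (by positivity) (hw 0)).trans (hB 0 (Nat.zero_le _))
  have hterm : ∀ j ≤ τ.j, ∀ m ≤ j, phaseWeight p w j m ≤ ((τ.j : ℝ) + 1) ^ (2 * p + 2) * B := by
    intro j hj m hm
    have hj' : (j : ℝ) ≤ τ.j + 1 := by exact_mod_cast hj.trans (Nat.le_succ _)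
    have hs : (samples j : ℝ) ≤ ((τ.j : ℝ) + 1) ^ 2 := by
      refine (Nat.cast_le.2 (samples_le j)).trans ?_
      push_cast
      gcongr
    have hw' := hw m
    calc phaseWeight p w j m = (j : ℝ) ^ p * j ^ p * samples j * (4 ^ m * w m) := by
          unfold phaseWeight; ring
      _ ≤ ((τ.j : ℝ) + 1) ^ p * (τ.j + 1) ^ p * ((τ.j : ℝ) + 1) ^ 2 * B := by
          gcongr
          exact hB m (hm.trans hj)
      _ = _ := by ring
  refine (h.clock_add_le hw).trans ?_
  calc ∑ j ∈ Finset.range (τ.j + 1), ∑ m ∈ Finset.range (j + 1), phaseWeight p w j m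
      ≤ ∑ j ∈ Finset.range (τ.j + 1), ∑ m ∈ Finset.range (τ.j + 1),
          ((τ.j : ℝ) + 1) ^ (2 * p + 2) * B := by
        refine Finset.sum_le_sum fun j hj => ?_
        have hj' : j ≤ τ.j := by have := Finset.mem_range.1 hj; omega
        refine (Finset.sum_le_sum fun m hm => hterm j hj' m ?_).trans
          (Finset.sum_le_sum_of_subset_of_nonneg (Finset.range_subset_range.2 (by omega))
            fun _ _ _ => by positivity)
        have := Finset.mem_range.1 hm; omega
    _ = _ := by
        simp only [Finset.sum_const, Finset.card_range, nsmul_eq_mul]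
        push_cast; ring

variable {y : ℕ → ℝ}

/-- The number of rounds in terms of the current run. -/
lemma traj_time_le (t : ℕ) : (t : ℝ) + 1 ≤ (((traj p y t).j : ℝ) + 1) ^ (2 * p + 4)
    * 4 ^ (traj p y t).j := by
  obtain ⟨h, hc⟩ := scheduled_traj (p := p) (y := y) t
  have := h.clock_add_le_mul (w := fun _ => 1) (fun _ => zero_le_one)
    (B := 4 ^ (traj p y t).j) fun m hm => by
      rw [mul_one]; exact pow_le_pow_right₀ (by norm_num) hm
  simpa [hc] using this

/-- The total resolution of the rounds in terms of the current run. -/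
lemma sum_half_pow_le (t : ℕ) : ∑ i ∈ Finset.range (t + 1), (1 / 2 : ℝ) ^ (traj p y i).m
    ≤ (((traj p y t).j : ℝ) + 1) ^ (2 * p + 4) * 2 ^ (traj p y t).j := by
  obtain ⟨h, hc⟩ := scheduled_traj (p := p) (y := y) t
  have := h.clock_add_le_mul (w := fun m => (1 / 2 : ℝ) ^ m) (fun _ => by positivity)
    (B := 2 ^ (traj p y t).j) fun m hm => by
      rw [← mul_pow]; norm_num
      exact pow_le_pow_right₀ (by norm_num) hm
  rw [hc] at this
  rwa [Finset.sum_range_succ]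

/-- The last phase of the run before the current one has been completed. -/
lemma four_pow_le (t : ℕ) : (4 : ℝ) ^ ((traj p y t).j - 1) ≤ t + 1 := by
  obtain ⟨h, hc⟩ := scheduled_traj (p := p) (y := y) t
  obtain ⟨j, hj⟩ : ∃ j, (traj p y t).j = j + 1 := ⟨_, (Nat.succ_pred_eq_of_pos h.one_le).symm⟩
  rw [hj, Nat.add_sub_cancel]
  rcases Nat.eq_zero_or_pos j with rfl | hjpos
  · simp
  have h1 : clock (fun _ => 1) (traj p y t) = t := by simp [hc]
  have hw : ∀ m : ℕ, (0 : ℝ) ≤ (fun _ => 1 : ℕ → ℝ) m := fun _ => zero_le_one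
  have h2 : phaseWeight p (fun _ => 1) j j ≤ ∑ i ∈ Finset.range (traj p y t).j,
      ∑ m ∈ Finset.range (i + 1), phaseWeight p (fun _ => 1) i m :=
    (Finset.single_le_sum (f := fun m => phaseWeight p (fun _ => 1) j m)
      (fun m _ => phaseWeight_nonneg hw _ _) (Finset.mem_range.2 (Nat.lt_succ_self j))).trans
    (Finset.single_le_sum
      (f := fun i => ∑ m ∈ Finset.range (i + 1), phaseWeight p (fun _ => 1) i m)
      (fun i _ => Finset.sum_nonneg fun m _ => phaseWeight_nonneg hw _ _)
      (Finset.mem_range.2 (by omega)))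
  have h3 : (4 : ℝ) ^ j ≤ phaseWeight p (fun _ => 1) j j := by
    have h4 : (1 : ℝ) ≤ j := by exact_mod_cast hjpos
    have h5 : (1 : ℝ) ≤ samples j := by exact_mod_cast samples_pos hjpos
    have h6 : (1 : ℝ) ≤ (j : ℝ) ^ p := one_le_pow₀ h4
    have h7 : (1 : ℝ) ≤ (j : ℝ) ^ p * j ^ p * samples j := by
      have := one_le_mul_of_one_le_of_one_le h6 h6
      exact one_le_mul_of_one_le_of_one_le this h5
    have h8 := le_mul_of_one_le_left (by positivity : (0 : ℝ) ≤ 4 ^ j) h7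
    unfold phaseWeight
    linarith
  have h9 : 0 ≤ ∑ m ∈ Finset.range (traj p y t).m, phaseWeight p (fun _ => 1) (traj p y t).j m :=
    Finset.sum_nonneg fun m _ => phaseWeight_nonneg hw _ _
  have h10 : (0 : ℝ) ≤ ((traj p y t).k * ((traj p y t).j : ℝ) ^ p
      + number (traj p y t).j p (traj p y t).cd) * ((traj p y t).s * 1) + (traj p y t).cnt * 1 := by
    positivity
  rw [clock] at h1
  linarith

lemma two_pow_le (t : ℕ) : (2 : ℝ) ^ (traj p y t).j ≤ 2 * √((t : ℝ) + 1) := by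
  have h := four_pow_le (p := p) (y := y) t
  have h1 := (scheduled_traj (p := p) (y := y) t).1.one_le
  have h2 : (2 : ℝ) ^ ((traj p y t).j - 1) ≤ √((t : ℝ) + 1) := by
    refine Real.le_sqrt_of_sq_le ?_
    rw [← pow_mul, mul_comm, pow_mul]
    norm_num
    exact h
  obtain ⟨j, hj⟩ : ∃ j, (traj p y t).j = j + 1 := ⟨_, (Nat.succ_pred_eq_of_pos h1).symm⟩
  rw [hj, Nat.add_sub_cancel] at h2
  rw [hj, pow_succ]
  linarith

/-- The number of runs is logarithmic in the number of rounds. -/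
lemma traj_j_le (t : ℕ) (ht : 1 ≤ t) :
    ((traj p y t).j : ℝ) + 1 ≤ 4 * Real.log ((t : ℝ) + 1) := by
  have h := four_pow_le (p := p) (y := y) t
  have h1 := (scheduled_traj (p := p) (y := y) t).1.one_le
  obtain ⟨j, hj⟩ : ∃ j, (traj p y t).j = j + 1 := ⟨_, (Nat.succ_pred_eq_of_pos h1).symm⟩
  rw [hj, Nat.add_sub_cancel] at h
  have h2 := Real.log_le_log (by positivity) h
  have h3 : Real.log 4 = 2 * Real.log 2 := by
    rw [show (4 : ℝ) = 2 ^ 2 by norm_num, Real.log_pow]; norm_num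
  rw [Real.log_pow, h3] at h2
  have h4 := Real.log_two_gt_d9
  have ht' : (1 : ℝ) ≤ t := by exact_mod_cast ht
  have h5 : Real.log 2 ≤ Real.log ((t : ℝ) + 1) := Real.log_le_log (by norm_num) (by linarith)
  rw [hj]
  push_cast
  have hj0 : (0 : ℝ) ≤ j := Nat.cast_nonneg _
  nlinarith

/-! ### Accuracy of the means -/

/-- In late runs, the number of samples per cell beats the logarithmic terms of the deviation
bounds. -/
lemma exists_samples_bound (p : ℕ) (b : ℝ) : ∃ j₁ : ℕ, ∀ j ≥ j₁, ∀ n : ℕ,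
    (n : ℝ) ≤ ((j : ℝ) + 1) ^ (2 * p + 4) * 4 ^ j →
    16 * (2 * Real.log ((n : ℝ) + 2) + b) ≤ samples j := by
  obtain ⟨j₁, hj₁⟩ := exists_nat_ge (64 * (2 * p + 8) + 32 * |b| + 128 : ℝ)
  refine ⟨j₁, fun j hj n hn => ?_⟩
  have hj' : (64 * (2 * p + 8) + 32 * |b| + 128 : ℝ) ≤ j := hj₁.trans (by exact_mod_cast hj)
  have hb := abs_nonneg b
  have hp0 : (0 : ℝ) ≤ p := Nat.cast_nonneg _
  have hj1 : (1 : ℝ) ≤ j := by linarith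
  have h1 : (1 : ℝ) ≤ ((j : ℝ) + 1) ^ (2 * p + 4) * 4 ^ j :=
    one_le_mul_of_one_le_of_one_le (one_le_pow₀ (by linarith)) (one_le_pow₀ (by norm_num))
  have hlog : Real.log ((n : ℝ) + 2) ≤ 2 + (2 * p + 4) * j + 2 * j := by
    have h2 : (n : ℝ) + 2 ≤ 3 * (((j : ℝ) + 1) ^ (2 * p + 4) * 4 ^ j) := by linarith
    have h3 : Real.log 3 ≤ 2 := by
      have := Real.log_le_sub_one_of_pos (show (0 : ℝ) < 3 by norm_num); linarith
    have h4 : Real.log 4 ≤ 2 := by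
      rw [show (4 : ℝ) = 2 ^ 2 by norm_num, Real.log_pow]
      have := Real.log_two_lt_d9
      push_cast; linarith
    have h5 : Real.log ((j : ℝ) + 1) ≤ j := by
      have := Real.log_le_sub_one_of_pos (show (0 : ℝ) < (j : ℝ) + 1 by positivity); linarith
    refine (Real.log_le_log (by positivity) h2).trans ?_
    rw [Real.log_mul (by norm_num) (by positivity), Real.log_mul (by positivity) (by positivity),
      Real.log_pow, Real.log_pow]
    push_cast
    nlinarith
  have hs : (2 : ℝ) * samples j = j * (j + 1) := by exact_mod_cast two_mul_samples j
  have hbj : b ≤ |b| * j := (le_abs_self b).trans (le_mul_of_one_le_right hb hj1)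
  have h6 := mul_le_mul_of_nonneg_left hj' (by linarith : (0 : ℝ) ≤ j)
  nlinarith

end Adaptive

end RealRAM

namespace RealRAM

namespace Adaptive

open Cube

variable {p : ℕ}

/-! ### Regret and computation time -/

/-- In late runs, if the deviations are bounded, the mean reward of a cell differs from the mean
reward of its arm by at most a quarter of the resolution of the phase. -/
lemma abs_mean_sub_le {b : ℝ} {j : ℕ} {y : ℕ → ℝ} {g : (Fin p → ℝ) → ℝ} (t : ℕ)
    (hb : ∀ n : ℕ, (n : ℝ) ≤ ((j : ℝ) + 1) ^ (2 * p + 4) * 4 ^ j →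
      16 * (2 * Real.log ((n : ℝ) + 2) + b) ≤ samples j)
    (hdev : ∀ t n : ℕ, |∑ i ∈ Finset.range n, (y (t + i) - g (traj p y (t + i)).arm)|
      ≤ √(n * BanditStrategy.logTerm b t n))
    (hj : (traj p y t).j = j) (hcnt : (traj p y t).cnt + 1 = (traj p y t).s) :
    |((traj p y t).sum + y t) / (traj p y t).s - g (traj p y t).arm| ≤ (traj p y t).r / 4 := by
  obtain ⟨h1, h2, h3⟩ := traj_sum (p := p) (y := y) t
  have hτ := (scheduled_traj (p := p) (y := y) t).1
  have htime := traj_time_le (p := p) (y := y) t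
  set τ := traj p y t with hτdef
  have hs0 : (0 : ℝ) < τ.s := by exact_mod_cast (by omega : 0 < τ.s)
  have hr0 : 0 < τ.r := by rw [hτ.r_eq]; positivity
  have hsum : ∑ i ∈ Finset.range τ.s, (y (t - τ.cnt + i) - g (traj p y (t - τ.cnt + i)).arm)
      = τ.sum + y t - τ.s * g τ.arm := by
    rw [Finset.sum_sub_distrib]
    congr 1
    · rw [← hcnt, Finset.sum_range_succ, ← h2, Nat.sub_add_cancel h1]
    · rw [Finset.sum_congr rfl (g := fun _ => g τ.arm), Finset.sum_const, Finset.card_range,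
        nsmul_eq_mul]
      intro i hi
      have hi := Finset.mem_range.1 hi
      rcases Nat.lt_succ_iff_lt_or_eq.1 (hi.trans_eq hcnt.symm) with hi | rfl
      · rw [h3 i hi]
      · rw [Nat.sub_add_cancel h1]
  have hd := hdev (t - τ.cnt) τ.s
  rw [hsum] at hd
  have hL : 16 * BanditStrategy.logTerm b (t - τ.cnt) τ.s ≤ τ.s * τ.r ^ 2 := by
    have h4 : (τ.s : ℝ) * τ.r ^ 2 = samples j := by
      rw [hτ.s_eq, hτ.r_eq, hj, ← pow_mul, mul_comm τ.m 2, pow_mul]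
      push_cast
      rw [mul_assoc, ← mul_pow]
      norm_num
    rw [h4]
    refine le_trans ?_ (hb (t + 1) (by rw [hj] at htime; exact_mod_cast htime))
    have h5 : Real.log (((t - τ.cnt : ℕ) : ℝ) + 2) ≤ Real.log (((t + 1 : ℕ) : ℝ) + 2) :=
      Real.log_le_log (by positivity)
        (by have : (t - τ.cnt : ℕ) ≤ t + 1 := by omega
            have : ((t - τ.cnt : ℕ) : ℝ) ≤ (t + 1 : ℕ) := by exact_mod_cast this
            linarith)
    have h6 : Real.log ((τ.s : ℝ) + 2) ≤ Real.log (((t + 1 : ℕ) : ℝ) + 2) :=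
      Real.log_le_log (by positivity)
        (by have : τ.s ≤ t + 1 := by omega
            have : (τ.s : ℝ) ≤ (t + 1 : ℕ) := by exact_mod_cast this
            linarith)
    unfold BanditStrategy.logTerm
    linarith
  have hd' : |τ.sum + y t - τ.s * g τ.arm| ≤ τ.s * (τ.r / 4) := by
    refine hd.trans (Real.sqrt_le_iff.2 ⟨by positivity, ?_⟩)
    have := mul_le_mul_of_nonneg_left hL hs0.le
    nlinarith
  have hdiv : (τ.sum + y t) / τ.s - g τ.arm = (τ.sum + y t - τ.s * g τ.arm) / τ.s := by
    field_simp
  rw [hdiv, abs_div, abs_of_pos hs0, div_le_iff₀ hs0]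
  linarith

lemma output_play (y : ℕ → I) (t : ℕ) :
    Learner.output p ((play p).eval ((learner p).memory p y t).rewind)
      = clamp (traj p (fun i => y i) t).arm := by
  rw [← view_memory]; rfl

lemma real_recommend_memory (y : ℕ → I) (t : ℕ) (i : Fin p) :
    (((learner p).recommend).eval ((learner p).memory p y (t + 1)).rewind).real i
      = (traj p (fun i => y i) t).rcm i := by
  refine (real_recommend _ i).trans ?_
  have : view p ((learner p).memory p y (t + 1)).rewind
      = { view p ((play p).eval ((learner p).memory p y t).rewind) with rew := y t } :=
    view_setReal_rew ((play p).eval ((learner p).memory p y t).rewind) (y t)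
  rw [this, view_memory]

theorem implements (p : ℕ) : (learner p).Implements ((learner p).strategy p) := by
  refine (isPlain_learner p).implements (fun y t i => ?_) (fun y t i => ?_)
  · have h : ((learner p).play.eval ((learner p).memory p y t).rewind).real i
        = (traj p (fun i => y i) t).arm i := by rw [← view_memory]; rfl
    rw [h]
    exact ⟨(traj_arm_mem t).1 i, (traj_arm_mem t).2 i⟩
  · cases t with
    | zero =>
      have h : ((learner p).recommend.eval ((learner p).memory p y 0).rewind).real i = 0 :=
        real_recommend _ i
      rw [h]
      exact ⟨le_rfl, zero_le_one⟩
    | succ t =>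
      rw [real_recommend_memory]
      exact ⟨(traj_rcm_mem t).1 i, (traj_rcm_mem t).2 i⟩

/-- The analysis of the algorithm on a sequence of rewards with small deviations. -/
theorem exists_regret_bound {f : Cube p → ℝ} (hp : 0 < p) (hf : ZoomingContinuous f)
    (h01 : ∀ x, f x ∈ Set.Icc (0 : ℝ) 1) (b : ℝ) : ∃ D : ℝ, 0 ≤ D ∧ ∀ y : ℕ → ℝ,
      (∀ t n : ℕ, |∑ i ∈ Finset.range n, (y (t + i) - f (clamp (traj p y (t + i)).arm))|
        ≤ √(n * BanditStrategy.logTerm b t n)) →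
      (∀ t, gap f (traj p y t).arm ≤ D * (1 / 2) ^ (traj p y t).m) ∧
      ∀ t, gap f (traj p y t).rcm ≤ D * (1 / 2) ^ (traj p y t).j := by
  obtain ⟨K, hK, j₁, hreg⟩ := hf.exists_boxRegularity hp
  obtain ⟨j₂, hj₂⟩ := exists_samples_bound p b
  obtain ⟨x, hx⟩ := exists_isGlobalMax hf.continuous
  set j₀ := max 2 (max j₁ j₂) with hj₀
  have hsup : ⨆ y, f y ≤ 1 := hx.iSup_eq.trans_le (h01 x).2
  have hgap : ∀ x, 0 ≤ gap f x := fun x => simpleRegret_nonneg hf.continuous _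
  have hone : ∀ x, gap f x ≤ 1 := fun x => by
    have := (h01 (clamp x)).1
    simp only [gap, simpleRegret]; linarith
  have hxmem : (fun i => (x i : ℝ)) ∈ Set.Icc (0 : Fin p → ℝ) 1 :=
    ⟨fun i => (x i).2.1, fun i => (x i).2.2⟩
  have hxgap : gap f (fun i => (x i : ℝ)) = 0 := by
    have : clamp (fun i => (x i : ℝ)) = x := by
      ext i; exact clamp_coe hxmem.1 hxmem.2 i
    rw [gap, this, hx.simpleRegret_eq_zero]
  -- in early runs the resolution is bounded below, so the trivial bound for the regret suffices
  have hearly : ∀ j ≤ j₀, ∀ m ≤ j, (1 : ℝ) ≤ (2 * K + 2 ^ j₀) * (1 / 2) ^ m := by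
    intro j hj m hm
    have h1 : (2 : ℝ) ^ m ≤ 2 ^ j₀ := pow_le_pow_right₀ (by norm_num) (hm.trans hj)
    have h2 : (2 : ℝ) ^ m * (1 / 2) ^ m = 1 := by rw [← mul_pow]; norm_num
    have h3 : (0 : ℝ) ≤ (1 / 2) ^ m := by positivity
    nlinarith
  have hlarge : ∀ m : ℕ, 2 * K * (1 / 2) ^ m ≤ (2 * K + 2 ^ j₀) * (1 / 2) ^ m := fun m => by
    have : (0 : ℝ) ≤ 2 ^ j₀ := by positivity
    gcongr
    linarith
  refine ⟨2 * K + 2 ^ j₀, by positivity, fun y hdev => ?_⟩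
  have hgood : ∀ t, j₀ ≤ (traj p y t).j →
      gap f (traj p y t).arm ≤ K * (1 / 2) ^ (traj p y t).m := fun t ht =>
    (boxGood_traj (le_max_left _ _) hK
      (fun j hj => hreg j ((le_max_left _ _).trans ((le_max_right _ _).trans hj)))
      (fun x => (h01 x).1) hsup hgap hxgap hxmem (fun t ht hcnt => by
        have := abs_mean_sub_le (g := fun x => f (clamp x)) t
          (hj₂ _ ((le_max_right _ _).trans ((le_max_right _ _).trans ht))) hdev rfl hcnt
        simpa only [gap, simpleRegret, sub_sub_cancel] using this) t ht).gap_arm_le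
      (scheduled_traj t).1 (traj_arm t)
  constructor
  · intro t
    rcases le_total j₀ (traj p y t).j with h | h
    · refine (hgood t h).trans ((hlarge _).trans' ?_)
      have : (0 : ℝ) ≤ K * (1 / 2) ^ (traj p y t).m := by positivity
      linarith
    · exact (hone _).trans (hearly _ h _ (scheduled_traj t).1.m_le)
  · intro t
    rcases le_or_gt (traj p y t).j j₀ with h | h
    · exact (hone _).trans (hearly _ h _ le_rfl)
    · exact ((gap_rcm_le (le_max_left _ _) (by linarith) hgood t).2 h).trans (hlarge _)

end Adaptive

end RealRAM

open RealRAM RealRAM.Adaptive Cube in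
theorem mainTheorem1 (p : ℕ) (hp : 0 < p) (ε : ℝ) (hε0 : 0 < ε) (hε1 : ε < 1) :
    ∃ (S : BanditStrategy (Cube p) (ℕ → I)) (A : RealRAM.Learner) (k : ℕ),
      A.Implements S ∧
      ∀ μ : Cube p → ℝ, Cube.ZoomingContinuous μ →
        ∃ C : ℝ, ∀ (P : Kernel (Cube p) I) [IsMarkovKernel P], rewardFunction P = μ →
          ∀ {Ω : Type*} [MeasurableSpace Ω] (Pr : Measure Ω) [IsProbabilityMeasure Pr]
            (Y : ℕ → Ω → I) (Z Zhat : ℕ → Ω → ℕ → I), S.IsRun P Pr Y Z Zhat →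
            ∃ E : Set Ω, MeasurableSet E ∧ ENNReal.ofReal (1 - ε) ≤ Pr E ∧
              ∀ ω ∈ E, ∀ T : ℕ, 2 ≤ T →
                cumulativeRegret μ (fun t => S.armAt Y Z t ω) T
                    ≤ C * √(T : ℝ) * Real.log T ^ k ∧
                simpleRegret μ (S.estimateAt Y Z Zhat T ω)
                    ≤ C * (1 / √(T : ℝ)) * Real.log T ^ k ∧
                ∃ n : ℕ, A.TotalTime p (fun t => Y t ω) (fun t => Z t ω) (Zhat T ω) T n ∧
                  (n : ℝ) ≤ C * (T : ℝ) * Real.log T ^ k := by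
  obtain ⟨b, hb, hdev⟩ := BanditStrategy.exists_deviation_bound hε0
  refine ⟨(learner p).strategy p, learner p, 2 * p + 4, implements p, fun μ hμ => ?_⟩
  by_cases h01 : ∀ x, μ x ∈ Set.Icc (0 : ℝ) 1
  swap
  · -- There are no reward distributions on `[0,1]` with such means.
    refine ⟨0, fun P _ hP => absurd (fun x => ?_) h01⟩
    rw [← hP]
    refine ⟨integral_nonneg fun y => y.2.1, ?_⟩
    have : ∫ y, (y : ℝ) ∂(P x) ≤ ∫ _, (1 : ℝ) ∂(P x) := by
      refine integral_mono_of_nonneg (ae_of_all _ fun y => y.2.1) (integrable_const _)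
        (ae_of_all _ fun y => y.2.2)
    exact this.trans_eq (by simp)
  obtain ⟨D, hD, hbound⟩ := exists_regret_bound hp hμ h01 b
  set s : ℝ := (learner p).play.size + (learner p).recommend.size with hs
  refine ⟨(2 * D + s) * 4 ^ (2 * p + 4), ?_⟩
  intro P _ hP Ω _ Pr _ Y Z Zhat hrun
  obtain ⟨E, hE, hPE, hωE⟩ := hdev hrun (by rw [hP]; exact hμ.continuous.measurable)
  refine ⟨E, hE, hPE, fun ω hω T hT => ?_⟩
  -- the last of `T + 1` rounds is round `T`, whose state determines the estimate
  obtain ⟨T, rfl⟩ : ∃ t, T = t + 1 := ⟨T - 1, by omega⟩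
  set y : ℕ → I := fun t => Y t ω with hy
  have harm : ∀ t, ((learner p).strategy p).armAt Y Z t ω = clamp (traj p (fun i => y i) t).arm :=
    fun t => (Learner.strategy_arm y (fun t => Z t ω) t).trans (output_play y t)
  have hest : ((learner p).strategy p).estimateAt Y Z Zhat (T + 1) ω
      = clamp (traj p (fun i => y i) T).rcm := by
    refine (Learner.strategy_estimate y (fun t => Z t ω) (Zhat (T + 1) ω) (T + 1)).trans ?_
    simp only [Learner.output, real_recommend_memory]
  obtain ⟨h1, h2⟩ := hbound (fun i => y i) (fun t n => by
    have := hωE ω hω t n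
    simpa only [BanditStrategy.deviation, hP, harm] using this)
  have hj := traj_j_le (p := p) (y := fun i => y i) T (by omega)
  have hpow := two_pow_le (p := p) (y := fun i => y i) T
  have htime := traj_time_le (p := p) (y := fun i => y i) T
  have hsum := sum_half_pow_le (p := p) (y := fun i => y i) T
  have hcast : ((T + 1 : ℕ) : ℝ) = (T : ℝ) + 1 := by push_cast; ring
  rw [hcast]
  set L := Real.log ((T : ℝ) + 1) with hL
  set J : ℝ := ((traj p (fun i => (y i : ℝ)) T).j : ℝ) + 1 with hJ
  set j := (traj p (fun i => (y i : ℝ)) T).j with hjdef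
  have hJ1 : 1 ≤ J := by rw [hJ]; linarith [Nat.cast_nonneg (α := ℝ) j]
  have hJL : J ^ (2 * p + 4) ≤ 4 ^ (2 * p + 4) * L ^ (2 * p + 4) := by
    rw [← mul_pow]; gcongr
  have hJ1' : 1 ≤ J ^ (2 * p + 4) := one_le_pow₀ hJ1
  have hs0 : 0 ≤ s := by positivity
  have hL0 : 0 ≤ L := by linarith
  have hT0 : (0 : ℝ) < (T : ℝ) + 1 := by positivity
  have hsq : 0 < √((T : ℝ) + 1) := Real.sqrt_pos.2 hT0
  refine ⟨?_, ?_, ?_⟩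
  · calc cumulativeRegret μ (fun t => ((learner p).strategy p).armAt Y Z t ω) (T + 1)
        = ∑ t ∈ Finset.range (T + 1), gap μ (traj p (fun i => y i) t).arm := by
          simp only [cumulativeRegret, harm, gap, simpleRegret]
      _ ≤ ∑ t ∈ Finset.range (T + 1), D * (1 / 2) ^ (traj p (fun i => (y i : ℝ)) t).m :=
          Finset.sum_le_sum fun t _ => h1 t
      _ ≤ D * (J ^ (2 * p + 4) * 2 ^ j) := by
          rw [← Finset.mul_sum]; gcongr
      _ ≤ D * (4 ^ (2 * p + 4) * L ^ (2 * p + 4) * (2 * √((T : ℝ) + 1))) := by gcongr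
      _ = 2 * D * (4 ^ (2 * p + 4) * √((T : ℝ) + 1) * L ^ (2 * p + 4)) := by ring
      _ ≤ (2 * D + s) * (4 ^ (2 * p + 4) * √((T : ℝ) + 1) * L ^ (2 * p + 4)) := by
          gcongr
          linarith
      _ = _ := by ring
  · have hle : √((T : ℝ) + 1) ≤ J ^ (2 * p + 4) * 2 ^ j := by
      refine Real.sqrt_le_iff.2 ⟨by positivity, htime.trans ?_⟩
      rw [mul_pow, ← pow_mul 2 j 2, mul_comm j 2, pow_mul, show (2 : ℝ) ^ 2 = 4 by norm_num]
      exact mul_le_mul_of_nonneg_right (le_self_pow₀ hJ1' two_ne_zero) (by positivity)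
    have hhalf : (1 / 2 : ℝ) ^ j ≤ J ^ (2 * p + 4) * (1 / √((T : ℝ) + 1)) := by
      rw [mul_one_div, le_div_iff₀ hsq]
      have : (1 / 2 : ℝ) ^ j * 2 ^ j = 1 := by rw [← mul_pow]; norm_num
      calc (1 / 2 : ℝ) ^ j * √((T : ℝ) + 1) ≤ (1 / 2) ^ j * (J ^ (2 * p + 4) * 2 ^ j) := by gcongr
        _ = J ^ (2 * p + 4) * ((1 / 2) ^ j * 2 ^ j) := by ring
        _ = _ := by rw [this, mul_one]
    have hq : 0 ≤ 1 / √((T : ℝ) + 1) := by positivity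
    calc simpleRegret μ (((learner p).strategy p).estimateAt Y Z Zhat (T + 1) ω)
        ≤ D * (1 / 2) ^ j := by rw [hest]; exact h2 T
      _ ≤ D * (4 ^ (2 * p + 4) * L ^ (2 * p + 4) * (1 / √((T : ℝ) + 1))) := by
          gcongr
          exact hhalf.trans (mul_le_mul_of_nonneg_right hJL hq)
      _ ≤ (2 * D + s) * (4 ^ (2 * p + 4) * L ^ (2 * p + 4) * (1 / √((T : ℝ) + 1))) := by
          gcongr
          linarith
      _ = _ := by ring
  · obtain ⟨n, hn, hle⟩ := (isPlain_learner p).totalTime (p := p) y (fun t => Z t ω)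
      (Zhat (T + 1) ω) (T + 1)
    refine ⟨n, hn, ?_⟩
    have hn' : (n : ℝ) ≤ (learner p).play.size * ((T : ℝ) + 1) + (learner p).recommend.size := by
      exact_mod_cast hle
    calc (n : ℝ) ≤ s * ((T : ℝ) + 1) := by
          rw [hs, add_mul]
          have : (0 : ℝ) ≤ (learner p).recommend.size := Nat.cast_nonneg _
          have : (0 : ℝ) ≤ T := Nat.cast_nonneg _
          nlinarith
      _ ≤ (2 * D + s) * ((T : ℝ) + 1) * (4 ^ (2 * p + 4) * L ^ (2 * p + 4)) := by
          have h3 : s * ((T : ℝ) + 1) ≤ (2 * D + s) * ((T : ℝ) + 1) := by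
            gcongr; linarith
          exact h3.trans (le_mul_of_one_le_right (by positivity) (hJ1'.trans hJL))
      _ = _ := by ring
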